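/- Let $\tau$ be a finite vocabulary of function and relation symbols. Formulas of inclusion logic $\mathrm{FO}(\subseteq)$ over $\tau$ are built from literals $t_1=t_2$, $t_1\neq t_2$, $R(\mathbf t)$, $\neg R(\mathbf t)$ and inclusion atoms $\mathbf t\subseteq\mathbf u$ (with $\mathbf t,\mathbf u$ tuples of terms of equal length) by $\wedge,\vee,\exists x,\forall x$. They are evaluated on a structure $\mathcal A$ with non-empty universe $A$ and a team $T$, i.e. a set of assignments $s\colon X\to A$ with a common domain $X$ of variables, under the (lax) team semantics: literals hold if they hold for every $s\in T$; $\mathcal A,T\models\mathbf t\subseteq\mathbf u$ iff for every $s\in T$ there is $s'\in T$ with $\mathbf t^{\mathcal A}\langle s\rangle=\mathbf u^{\mathcal A}\langle s'\rangle$; $\wedge$ is conjunction; $\mathcal A,T\models\varphi_0\vee\varphi_1$ iff $T=T_0\cup T_1$ for some $T_0,T_1$ with $\mathcal A,T_i\models\varphi_i$; $\mathcal A,T\models\exists x\varphi$ iff there is $f\colon T\to\mathcal P(A)\setminus\{\emptyset\}$ such that $\{s^x_a: s\in T,\ a\in f(s)\}$ satisfies $\varphi$; $\mathcal A,T\models\forall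 x\varphi$ iff $\{s^x_a: s\in T,\ a\in A\}$ satisfies $\varphi$. For a formula $\varphi$, the parameterized problem $\text{p-}\mathrm{WT}_\varphi$ is: given (the binary encoding of) a finite $\tau$-structure $\mathcal A$ and $k\in\mathbb N$, with parameter $k$, is there a team $T$ whose domain is the set of free variables of $\varphi$ such that $|T|=k$ and $\mathcal A,T\models\varphi$? **Theorem.** Let $\varphi$ be an $\mathrm{FO}(\subseteq)$-sentence (a formula without free variables). Then: 1. $\text{p-}\mathrm{WT}_\varphi$ is fixed-parameter tractable: there are a computable function $f$, a polynomial $p$ and a deterministic Turing machine that decides every instance $(x,k)$ of $\text{p-}\mathrm{WT}_\varphi$ in at most $f(k)\cdot p(|x|)$ steps. 2. For every $\tau$-structure $\mathcal A$, some non-empty team with empty domain satisfies $\varphi$ in $\mathcal A$ if and only if $\mathcal A,\{\emptyset\}\models\varphi$, where $\{\emptyset\}$ is the team consisting of the empty assignment only. 3. It is decidable in polynomial time whether a given finite $\tau$-structure $\mathcal A$ satisfies $\mathcal A,\{\emptyset\}\models\varphi$. -/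

import Mathlib

universe u v w

/-! ### Inclusion logic `FO(⊆)` -/

/-- Formulas of inclusion logic over the vocabulary `L`, in negation normal form; the variables
are `0, 1, 2, …`. The atom `incl ts us` is the inclusion atom `ts ⊆ us` between two tuples of
terms of the same length. -/
inductive IncFormula (L : FirstOrder.Language.{u, v}) : Type (max u v)
  | eq (t t' : L.Term ℕ) : IncFormula L
  | neq (t t' : L.Term ℕ) : IncFormula L
  | rel {k : ℕ} (R : L.Relations k) (ts : Fin k → L.Term ℕ) : IncFormula L
  | nrel {k : ℕ} (R : L.Relations k) (ts : Fin k → L.Term ℕ) : IncFormula L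
  | incl {k : ℕ} (ts us : Fin k → L.Term ℕ) : IncFormula L
  | and (φ ψ : IncFormula L) : IncFormula L
  | or (φ ψ : IncFormula L) : IncFormula L
  | ex (x : ℕ) (φ : IncFormula L) : IncFormula L
  | all (x : ℕ) (φ : IncFormula L) : IncFormula L

/-- The free variables of a formula. -/
def IncFormula.freeVars {L : FirstOrder.Language.{u, v}} : IncFormula L → Finset ℕ
  | .eq t t' => t.varFinset ∪ t'.varFinset
  | .neq t t' => t.varFinset ∪ t'.varFinset
  | .rel _ ts => Finset.univ.biUnion fun i => (ts i).varFinset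
  | .nrel _ ts => Finset.univ.biUnion fun i => (ts i).varFinset
  | .incl ts us => Finset.univ.biUnion fun i => (ts i).varFinset ∪ (us i).varFinset
  | .and φ ψ => φ.freeVars ∪ ψ.freeVars
  | .or φ ψ => φ.freeVars ∪ ψ.freeVars
  | .ex x φ => φ.freeVars.erase x
  | .all x φ => φ.freeVars.erase x

/-- A sentence is a formula without free variables. -/
def IncFormula.IsSentence {L : FirstOrder.Language.{u, v}} (φ : IncFormula L) : Prop :=
  φ.freeVars = ∅

/-- An assignment is a partial function from the variables to the universe `A`; it is undefined
at `x` if its value there is `none`. -/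
abbrev Assignment (A : Type w) : Type w := ℕ → Option A

/-- The assignment with empty domain. -/
def emptyAssignment (A : Type w) : Assignment A := fun _ => none

/-- `T` is a team with domain `X`: a set of assignments that are all defined exactly on `X`. -/
def IsTeamOver {A : Type w} (X : Finset ℕ) (T : Set (Assignment A)) : Prop :=
  ∀ s ∈ T, ∀ x : ℕ, (s x).isSome ↔ x ∈ X

/-- The modified assignment that maps `x` to `a` and agrees with `s` elsewhere. -/
def Assignment.modify {A : Type w} (s : Assignment A) (x : ℕ) (a : A) : Assignment A :=
  Function.update s x (some a)

/-- The supplemented team, containing the modification of `s` at `x` to `a` for all `s ∈ T` and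
all `a ∈ f s`. -/
def supplement {A : Type w} (T : Set (Assignment A)) (x : ℕ) (f : Assignment A → Set A) :
    Set (Assignment A) :=
  {s' | ∃ s ∈ T, ∃ a ∈ f s, s' = s.modify x a}

open Classical in
/-- The value of a term under an assignment in the structure `S`; it is defined as soon as the
assignment is defined on all variables of the term. -/
noncomputable def termValue {L : FirstOrder.Language.{u, v}} {A : Type w} (S : L.Structure A)
    (s : Assignment A) : L.Term ℕ → Option A
  | .var x => s x
  | .func f ts =>
      if h : ∀ i, (termValue S s (ts i)).isSome then
        some (S.funMap f fun i => (termValue S s (ts i)).get (h i))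
      else none

/-- Team semantics: the team `T` satisfies the formula in the structure `S`. It is meant for teams
whose domain contains the free variables of the formula. -/
def Sat {L : FirstOrder.Language.{u, v}} {A : Type w} (S : L.Structure A) :
    Set (Assignment A) → IncFormula L → Prop
  | T, .eq t t' => ∀ s ∈ T, termValue S s t = termValue S s t'
  | T, .neq t t' => ∀ s ∈ T, termValue S s t ≠ termValue S s t'
  | T, .rel R ts => ∀ s ∈ T, ∃ a, (∀ i, termValue S s (ts i) = some (a i)) ∧ S.RelMap R a
  | T, .nrel R ts => ∀ s ∈ T, ∃ a, (∀ i, termValue S s (ts i) = some (a i)) ∧ ¬ S.RelMap R a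
  | T, .incl ts us => ∀ s ∈ T, ∃ s' ∈ T, ∀ i, termValue S s (ts i) = termValue S s' (us i)
  | T, .and φ ψ => Sat S T φ ∧ Sat S T ψ
  | T, .or φ ψ => ∃ T₀ T₁, T₀ ∪ T₁ = T ∧ Sat S T₀ φ ∧ Sat S T₁ ψ
  | T, .ex x φ => ∃ f : Assignment A → Set A,
      (∀ s ∈ T, (f s).Nonempty) ∧ Sat S (supplement T x f) φ
  | T, .all x φ => Sat S (supplement T x fun _ => Set.univ) φ

/-! ### Finite structures as words -/

/-- A finite vocabulary, with a fixed order of its function symbols and of its relation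
symbols (constants are function symbols of arity `0`). -/
structure FiniteVocabulary (L : FirstOrder.Language.{u, v}) where
  funs : List (Σ k, L.Functions k)
  rels : List (Σ k, L.Relations k)
  funs_nodup : funs.Nodup
  rels_nodup : rels.Nodup
  mem_funs : ∀ f, f ∈ funs
  mem_rels : ∀ R, R ∈ rels

open Classical in
/-- The characteristic word, of length `n ^ k`, of a `k`-ary relation on `{0, …, n - 1}`; the
tuple `a` has position `∑ j, a j * n ^ j`. -/
noncomputable def charWord {n k : ℕ} (R : (Fin k → Fin n) → Prop) : List Bool :=
  List.ofFn fun i : Fin (n ^ k) => decide (R (finFunctionFinEquiv.symm i))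

/-- The standard binary encoding of a structure with universe `{0, …, n - 1}`: the universe in
unary, an end marker, the characteristic words of the graphs of the functions (as relations
between the value, in coordinate `0`, and the arguments), and the characteristic words of the
relations. -/
noncomputable def encodeStructure {L : FirstOrder.Language.{u, v}} (τ : FiniteVocabulary L) {n : ℕ}
    (S : L.Structure (Fin n)) : List Bool :=
  List.replicate n true ++ [false] ++
    (τ.funs.flatMap fun f =>
      charWord fun a : Fin (f.1 + 1) → Fin n => S.funMap f.2 (Fin.tail a) = a 0) ++
    (τ.rels.flatMap fun R => charWord fun a : Fin R.1 → Fin n => S.RelMap R.2 a)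

/-! ### The decision problems -/

/-- Parameterized weighted team definability for `φ`: the instances `(x, k)` such that `x` encodes
a finite structure (with non-empty universe) in which some team over the free variables of `φ`
with exactly `k` elements satisfies `φ`. The parameter is `k`. -/
def pWT {L : FirstOrder.Language.{u, v}} (τ : FiniteVocabulary L) (φ : IncFormula L) :
    Set (List Bool × ℕ) :=
  {p | ∃ n : ℕ, 0 < n ∧ ∃ S : L.Structure (Fin n), p.1 = encodeStructure τ S ∧
    ∃ T : Set (Assignment (Fin n)), IsTeamOver φ.freeVars T ∧ T.encard = p.2 ∧ Sat S T φ}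

/-- The model checking problem of `φ`: the words that encode a finite structure (with non-empty
universe) in which the team consisting of the empty assignment satisfies `φ`. -/
def modelChecking {L : FirstOrder.Language.{u, v}} (τ : FiniteVocabulary L) (φ : IncFormula L) :
    Set (List Bool) :=
  {x | ∃ n : ℕ, 0 < n ∧ ∃ S : L.Structure (Fin n), x = encodeStructure τ S ∧
    Sat S {emptyAssignment (Fin n)} φ}

/-! ### Complexity classes, over Mathlib's multi-stack Turing machines -/

/-- The input word for the instance `(x, k)`: the word `x` followed by `k` in binary, written
with separate symbols. -/
def encodeInstance {Γ : Type} (x : List Γ) (k : ℕ) : List (Γ ⊕ Bool) :=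
  x.map Sum.inl ++ (Computability.encodeNat k).map Sum.inr

open Classical in
/-- A parameterized problem is fixed-parameter tractable if some deterministic Turing machine
decides, for all words `x` and all `k`, whether `(x, k)` belongs to it, within
`f k * p (|x|)` steps, for a computable function `f` and a polynomial `p`. -/
def FPT {Γ : Type} (P : Set (List Γ × ℕ)) : Prop :=
  ∃ (M : Turing.TM2ComputableAux (Γ ⊕ Bool) Bool) (f : ℕ → ℕ) (p : Polynomial ℕ),
    Computable f ∧
    ∀ (x : List Γ) (k : ℕ),
      Nonempty (Turing.TM2OutputsInTime M.tm
        ((encodeInstance x k).map M.inputAlphabet.symm)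
        (some ([decide ((x, k) ∈ P)].map M.outputAlphabet.symm))
        (f k * p.eval x.length))

open Classical in
/-- A language is decidable in polynomial time. -/
def PolyTimeDecidable {Γ : Type} (P : Set (List Γ)) : Prop :=
  Nonempty (Turing.TM2ComputableInPolyTime (fun x : List Γ => x) (fun b : Bool => [b])
    fun x => decide (x ∈ P))

/-! ### A structured language for stack machines -/

/-! Over an empty domain there are only two teams, `∅` and the team of the empty assignment. The
empty team satisfies every formula (`sat_empty`). So for weight 0 the answer is yes as soon as the
input encodes a structure, for weight at least 2 it is no, and for weight 1 the problem is model
checking (`exists_team_encard_iff`). Tractability thus reduces to polynomial-time parsing and model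
checking, and the parameter only selects one of three cases. The statement on non-empty teams is an
instance of locality (`Sat.of_agree`): satisfaction depends only on the restrictions of the
assignments to the free variables, and without free variables all non-empty teams look alike.

Model checking is the computation of a greatest fixed point. Choose `R` above all variables and all
arities in the formula. Each occurrence of a subformula receives a set of tuples standing for its
team, and each occurrence of a subterm a relation whose last coordinate carries the value of the
term. That these sets witness satisfaction is a system of local conditions (`Family`), each of the
form "every tuple of this set satisfies an expression in which the sets occur only positively". The
equality of teams at a conjunction and the union at a disjunction are split into inclusions of this
form.

Such a system has a greatest solution. Start with all tuples and keep removing those that violate a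
condition. By monotonicity (`BExp.Polar.mono`) no element of any solution is ever removed
(`subset_eliminate`), and since there are only polynomially many tuples, the process becomes
stationary at a solution (`family_eliminate`). By locality any non-empty team may replace the team
of the empty assignment, so the sentence is true exactly if the set at the root of the greatest
solution is non-empty (`sat_emptyAssignment_iff`, `modelCheck_spec`).

For the machine model, parsing and elimination are written in a loop language with Boolean arrays of
fixed dimension and index variables over the universe (`BExp`, `Cmd`). Every loop runs over `{0, …,
n - 1}` and the nesting is fixed, so running times are polynomial in `n` (`Cmd.run_prog`). Arrays
and unary indices live on stacks, and the resulting structured stack programs are compiled to `TM2`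
machines (`StackProg.Exec.reachesIn`, `exists_machine`). The polynomial bound in the length of the
whole instance is finally separated into a factor for `k` and a factor for `x` (`eval_mul_le`). -/

/-- Structured programs over a family of stacks with alphabets `Γ` and control states `σ`. -/
inductive StackProg {K : Type} (Γ : K → Type) (σ : Type) : Type
  | push (k : K) (f : σ → Γ k)
  | pop (k : K) (f : σ → Option (Γ k) → σ)
  | load (f : σ → σ)
  | seq (c d : StackProg Γ σ)
  | ite (p : σ → Bool) (c d : StackProg Γ σ)
  | loop (k : K) (f : σ → Option (Γ k) → σ) (p : σ → Bool) (c : StackProg Γ σ)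

namespace StackProg

variable {K : Type} {Γ : K → Type} {σ : Type}

/-- `Exec c x S t x' S'`: started in control state `x` with stacks `S`, the program `c` stops within
`t` steps in control state `x'` with stacks `S'`. The loop pops the stack `k` before each test. -/
inductive Exec [DecidableEq K] : StackProg Γ σ → σ → (∀ k, List (Γ k)) → ℕ → σ →
    (∀ k, List (Γ k)) → Prop
  | push {k f x S t} (ht : 1 ≤ t) : Exec (push k f) x S t x (Function.update S k (f x :: S k))
  | pop {k f x S t} (ht : 1 ≤ t) :
      Exec (pop k f) x S t (f x (S k).head?) (Function.update S k (S k).tail)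
  | load {f x S t} (ht : 1 ≤ t) : Exec (load f) x S t (f x) S
  | seq {c d x S t₁ x' S' t₂ x'' S'' t} (h₁ : Exec c x S t₁ x' S') (h₂ : Exec d x' S' t₂ x'' S'')
      (ht : t₁ + t₂ ≤ t) : Exec (seq c d) x S t x'' S''
  | ite_true {p c d x S t₁ x' S' t} (hp : p x = true) (h : Exec c x S t₁ x' S')
      (ht : t₁ + 1 ≤ t) : Exec (ite p c d) x S t x' S'
  | ite_false {p c d x S t₁ x' S' t} (hp : p x = false) (h : Exec d x S t₁ x' S')
      (ht : t₁ + 1 ≤ t) : Exec (ite p c d) x S t x' S'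
  | loop_exit {k f p c x S t} (hp : p (f x (S k).head?) = false) (ht : 1 ≤ t) :
      Exec (loop k f p c) x S t (f x (S k).head?) (Function.update S k (S k).tail)
  | loop_step {k f p c x S t₁ x' S' t₂ x'' S'' t} (hp : p (f x (S k).head?) = true)
      (h₁ : Exec c (f x (S k).head?) (Function.update S k (S k).tail) t₁ x' S')
      (h₂ : Exec (loop k f p c) x' S' t₂ x'' S'') (ht : 1 + t₁ + t₂ ≤ t) :
      Exec (loop k f p c) x S t x'' S''

theorem Exec.mono [DecidableEq K] {c : StackProg Γ σ} {x x' : σ} {S S' : ∀ k, List (Γ k)}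
    {t t' : ℕ} (h : Exec c x S t x' S') (ht : t ≤ t') : Exec c x S t' x' S' := by
  cases h with
  | push h => exact .push (h.trans ht)
  | pop h => exact .pop (h.trans ht)
  | load h => exact .load (h.trans ht)
  | seq h₁ h₂ h => exact .seq h₁ h₂ (h.trans ht)
  | ite_true hp h₁ h => exact .ite_true hp h₁ (h.trans ht)
  | ite_false hp h₁ h => exact .ite_false hp h₁ (h.trans ht)
  | loop_exit hp h => exact .loop_exit hp (h.trans ht)
  | loop_step hp h₁ h₂ h => exact .loop_step hp h₁ h₂ (h.trans ht)

/-- The total height of the stacks. -/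
def height [Fintype K] (S : ∀ k, List (Γ k)) : ℕ := ∑ k, (S k).length

theorem height_update_add [DecidableEq K] [Fintype K] (S : ∀ k, List (Γ k)) (k : K)
    (l : List (Γ k)) :
    height (Function.update S k l) + (S k).length = height S + l.length := by
  unfold height
  rw [← Finset.add_sum_erase _ _ (Finset.mem_univ k),
    ← Finset.add_sum_erase _ (fun k => (S k).length) (Finset.mem_univ k)]
  have : ∑ x ∈ Finset.univ.erase k, (Function.update S k l x).length =
      ∑ x ∈ Finset.univ.erase k, (S x).length :=
    Finset.sum_congr rfl fun x hx => by rw [Function.update_of_ne (Finset.ne_of_mem_erase hx)]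
  rw [this, Function.update_self]
  omega

theorem height_update_tail_le [DecidableEq K] [Fintype K] (S : ∀ k, List (Γ k)) (k : K) :
    height (Function.update S k (S k).tail) ≤ height S := by
  have := height_update_add S k (S k).tail
  rw [List.length_tail] at this
  omega

/-- Each unit of time pushes at most one symbol. This bounds the time needed to empty all stacks
before the output is written. -/
theorem Exec.height_le [DecidableEq K] [Fintype K] {c : StackProg Γ σ} {x x' : σ}
    {S S' : ∀ k, List (Γ k)} {t : ℕ} (h : Exec c x S t x' S') : height S' ≤ height S + t := by
  induction h with
  | @push k f x S t ht =>
    have := height_update_add S k (f x :: S k)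
    rw [List.length_cons] at this
    omega
  | @pop k f x S t ht => exact (height_update_tail_le S k).trans (Nat.le_add_right _ _)
  | load ht => exact Nat.le_add_right _ _
  | seq _ _ _ ih₁ ih₂ => omega
  | ite_true _ _ _ ih => omega
  | ite_false _ _ _ ih => omega
  | @loop_exit k f p c x S t hp ht =>
    exact (height_update_tail_le S k).trans (Nat.le_add_right _ _)
  | @loop_step k f p c x S t₁ x' S' t₂ x'' S'' t hp h₁ h₂ ht ih₁ ih₂ =>
    have := height_update_tail_le S k
    omega

/-! ### Compilation to `TM2` machines -/

/-- The labels of the machine for a program. -/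
def Label : StackProg Γ σ → Type
  | push _ _ => Unit
  | pop _ _ => Unit
  | load _ => Unit
  | seq c d => Label c ⊕ Label d
  | ite _ c d => Option (Label c ⊕ Label d)
  | loop _ _ _ c => Option (Label c)

theorem finite_label : ∀ c : StackProg Γ σ, Finite (Label c)
  | push _ _ => inferInstanceAs (Finite Unit)
  | pop _ _ => inferInstanceAs (Finite Unit)
  | load _ => inferInstanceAs (Finite Unit)
  | seq c d =>
    have := finite_label c
    have := finite_label d
    inferInstanceAs (Finite (Label c ⊕ Label d))
  | ite _ c d =>
    have := finite_label c
    have := finite_label d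
    inferInstanceAs (Finite (Option (Label c ⊕ Label d)))
  | loop _ _ _ c =>
    have := finite_label c
    inferInstanceAs (Finite (Option (Label c)))

/-- The label at which a program starts. -/
def entry : ∀ c : StackProg Γ σ, Label c
  | push _ _ => ()
  | pop _ _ => ()
  | load _ => ()
  | seq c _ => Sum.inl (entry c)
  | ite _ _ _ => none
  | loop _ _ _ _ => none

/-- The statement at each label of a program, where `i` embeds the labels of the program into those
of the machine and `e` is the label at which the machine continues after the program. -/
def code {Λ : Type} : ∀ c : StackProg Γ σ, (Label c → Λ) → Λ → Label c → Turing.TM2.Stmt Γ Λ σ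
  | push k f, _, e, _ => .push k f (.goto fun _ => e)
  | pop k f, _, e, _ => .pop k f (.goto fun _ => e)
  | load f, _, e, _ => .load f (.goto fun _ => e)
  | seq c d, i, e, l =>
    match l with
    | Sum.inl l => code c (fun a => i (Sum.inl a)) (i (Sum.inr (entry d))) l
    | Sum.inr l => code d (fun a => i (Sum.inr a)) e l
  | ite p c d, i, e, l =>
    match l with
    | none => .branch p (.goto fun _ => i (some (Sum.inl (entry c))))
        (.goto fun _ => i (some (Sum.inr (entry d))))
    | some (Sum.inl l) => code c (fun a => i (some (Sum.inl a))) e l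
    | some (Sum.inr l) => code d (fun a => i (some (Sum.inr a))) e l
  | loop k f p c, i, e, l =>
    match l with
    | none => .pop k f (.branch p (.goto fun _ => i (some (entry c))) (.goto fun _ => e))
    | some l => code c (fun a => i (some a)) (i none) l

/-- The machine `M` gets from the configuration `a` to `b` in at most `t` steps. -/
def ReachesIn [DecidableEq K] {Λ : Type} (M : Λ → Turing.TM2.Stmt Γ Λ σ)
    (a : Turing.TM2.Cfg Γ Λ σ) (t : ℕ) (b : Turing.TM2.Cfg Γ Λ σ) : Prop :=
  ∃ m ≤ t, (flip bind (Turing.TM2.step M))^[m] (some a) = some b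

theorem ReachesIn.trans [DecidableEq K] {Λ : Type} {M : Λ → Turing.TM2.Stmt Γ Λ σ}
    {a b c : Turing.TM2.Cfg Γ Λ σ} {t₁ t₂ t : ℕ} (h₁ : ReachesIn M a t₁ b)
    (h₂ : ReachesIn M b t₂ c) (ht : t₁ + t₂ ≤ t) : ReachesIn M a t c := by
  obtain ⟨m₁, hm₁, h₁⟩ := h₁
  obtain ⟨m₂, hm₂, h₂⟩ := h₂
  exact ⟨m₂ + m₁, by omega, by rw [Function.iterate_add_apply, h₁, h₂]⟩

theorem ReachesIn.single [DecidableEq K] {Λ : Type} {M : Λ → Turing.TM2.Stmt Γ Λ σ}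
    {a b : Turing.TM2.Cfg Γ Λ σ} {t : ℕ} (h : Turing.TM2.step M a = some b) (ht : 1 ≤ t) :
    ReachesIn M a t b :=
  ⟨1, ht, h⟩

/-- The program is treated as a fragment of an arbitrary machine, with any embedding `i` of its
labels and any exit label `e`. The induction needs this generality: the first half of a sequence
exits to the entry of the second half, and a loop body exits to the label of the loop test. -/
theorem Exec.reachesIn [DecidableEq K] {Λ : Type} {M : Λ → Turing.TM2.Stmt Γ Λ σ}
    {c : StackProg Γ σ} {x x' : σ} {S S' : ∀ k, List (Γ k)} {t : ℕ} (h : Exec c x S t x' S') :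
    ∀ (i : Label c → Λ) (e : Λ), (∀ l, M (i l) = code c i e l) →
      ReachesIn M ⟨some (i (entry c)), x, S⟩ t ⟨some e, x', S'⟩ := by
  induction h with
  | push ht | pop ht | load ht =>
    intro i e hM
    refine .single ?_ ht
    rw [Turing.TM2.step, hM]
    simp [code]
  | seq h₁ h₂ ht ih₁ ih₂ =>
    intro i e hM
    exact (ih₁ (fun a => i (Sum.inl a)) _ fun l => hM _).trans
      (ih₂ (fun a => i (Sum.inr a)) e fun l => hM _) ht
  | ite_true hp h ht ih =>
    intro i e hM
    refine (ReachesIn.single (t := 1) ?_ le_rfl).trans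
      (ih (fun a => i (some (Sum.inl a))) e fun l => hM _) (by omega)
    rw [Turing.TM2.step, hM]
    simp [code, entry, hp]
  | ite_false hp h ht ih =>
    intro i e hM
    refine (ReachesIn.single (t := 1) ?_ le_rfl).trans
      (ih (fun a => i (some (Sum.inr a))) e fun l => hM _) (by omega)
    rw [Turing.TM2.step, hM]
    simp [code, entry, hp]
  | loop_exit hp ht =>
    intro i e hM
    refine .single ?_ ht
    rw [Turing.TM2.step, hM]
    simp [code, entry, hp]
  | loop_step hp h₁ h₂ ht ih₁ ih₂ =>
    intro i e hM
    refine ((ReachesIn.single (t := 1) ?_ le_rfl).trans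
      (ih₁ (fun a => i (some a)) (i none) fun l => hM _) le_rfl).trans
      (ih₂ i e hM) ht
    rw [Turing.TM2.step, hM]
    simp [code, entry, hp]

/-- The machine that runs a program and halts. -/
def machineCode (c : StackProg Γ σ) : Option (Label c) → Turing.TM2.Stmt Γ (Option (Label c)) σ
  | none => .halt
  | some l => code c some none l

theorem Exec.reachesIn_halt [DecidableEq K] {c : StackProg Γ σ} {x x' : σ}
    {S S' : ∀ k, List (Γ k)} {t : ℕ} (h : Exec c x S t x' S') :
    ReachesIn (machineCode c) ⟨some (some (entry c)), x, S⟩ (t + 1) ⟨none, x', S'⟩ :=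
  (h.reachesIn some none fun _ => rfl).trans (.single rfl le_rfl) le_rfl

end StackProg

/-! ### Programs over bit stacks -/

/-- The control states: a result bit, the symbol popped last, and a counter with three values. -/
structure Ctl where
  res : Bool
  top : Option Bool
  cat : Fin 3

instance : Finite Ctl :=
  Finite.of_surjective (fun p : Bool × Option Bool × Fin 3 => Ctl.mk p.1 p.2.1 p.2.2)
    fun x => ⟨(x.res, x.top, x.cat), rfl⟩

/-- The alphabets: `Γ₀` for the distinguished stack `none`, bits for the others. -/
abbrev RawAlphabet (Γ₀ : Type) {N : Type} : Option N → Type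
  | none => Γ₀
  | some _ => Bool

/-- Stacks with content `w` on the distinguished stack and contents `S` on the bit stacks. -/
def withRaw {Γ₀ N : Type} (w : List Γ₀) (S : N → List Bool) : ∀ k, List (RawAlphabet Γ₀ (N := N) k)
  | none => w
  | some k => S k

/-- Programs over one stack with alphabet `Γ₀` and bit stacks with names in `N`. -/
abbrev BitProg (Γ₀ N : Type) : Type := StackProg (RawAlphabet Γ₀ (N := N)) Ctl

theorem update_withRaw {Γ₀ N : Type} [DecidableEq N] (w : List Γ₀) (S : N → List Bool) (k : N)
    (l : List Bool) :
    Function.update (withRaw w S) (some k) l = withRaw w (Function.update S k l) := by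
  funext k'
  cases k' with
  | none => rfl
  | some k' =>
    by_cases h : k' = k
    · subst h
      simp [withRaw]
    · rw [Function.update_of_ne (by simpa using h)]
      simp [withRaw, h]

theorem update_withRaw_none {Γ₀ N : Type} [DecidableEq N] (w w' : List Γ₀) (S : N → List Bool) :
    Function.update (withRaw w S) none w' = withRaw w' S := by
  funext k'
  cases k' with
  | none => simp [withRaw]
  | some k' => rw [Function.update_of_ne (by simp)]; rfl

namespace BitProg

open StackProg Function

variable {Γ₀ N : Type}

/-- Push a bit computed from the control state. -/
def put (k : N) (f : Ctl → Bool) : BitProg Γ₀ N := .push (some k) f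

/-- Pop a bit into `top`. -/
def take (k : N) : BitProg Γ₀ N := .pop (some k) fun x o => { x with top := o }

/-- Pop bits into `top` until the stack is empty, running `c` after each of them. -/
def each (k : N) (c : BitProg Γ₀ N) : BitProg Γ₀ N :=
  .loop (some k) (fun x o => { x with top := o }) (fun x => x.top.isSome) c

/-- The program that does nothing. -/
def skip : BitProg Γ₀ N := .load id

/-- Run `c` once for every element of the stack `k` of `true`s, using `t` to restore `k`. -/
def rep (k t : N) (c : BitProg Γ₀ N) : BitProg Γ₀ N :=
  .seq (each k (.seq c (put t fun _ => true))) (each t (put k fun _ => true))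

/-- Move a bit from `a` to `b`, if there is one. -/
def move (a b : N) : BitProg Γ₀ N :=
  .seq (take a) (.ite (fun x => x.top.isSome) (put b fun x => x.top.getD false) skip)

/-- Move all bits from `a` to `b`. -/
def moveAll (a b : N) : BitProg Γ₀ N := each a (put b fun x => x.top.getD false)

variable [DecidableEq N]

/-- `Run c x S t x' S'`: the program `c` gets from control state `x` and bit stacks `S` to `x'` and
`S'` within `t` steps, without touching the distinguished stack. -/
def Run (c : BitProg Γ₀ N) (x : Ctl) (S : N → List Bool) (t : ℕ) (x' : Ctl)
    (S' : N → List Bool) : Prop :=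
  ∀ w : List Γ₀, Exec c x (withRaw w S) t x' (withRaw w S')

theorem Run.mono {c : BitProg Γ₀ N} {x x' : Ctl} {S S' : N → List Bool} {t t' : ℕ}
    (h : Run c x S t x' S') (ht : t ≤ t') : Run c x S t' x' S' :=
  fun w => (h w).mono ht

theorem Run.put {k : N} {f : Ctl → Bool} {x : Ctl} {S : N → List Bool} :
    Run (put k f : BitProg Γ₀ N) x S 1 x (update S k (f x :: S k)) := fun w => by
  rw [← update_withRaw]
  exact Exec.push le_rfl

theorem Run.take {k : N} {x : Ctl} {S : N → List Bool} :
    Run (take k : BitProg Γ₀ N) x S 1 { x with top := (S k).head? }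
      (update S k (S k).tail) := fun w => by
  rw [← update_withRaw]
  exact Exec.pop (Γ := RawAlphabet Γ₀ (N := N)) (k := some k)
    (f := fun (x : Ctl) (o : Option Bool) => { x with top := o }) le_rfl

theorem Run.load {f : Ctl → Ctl} {x : Ctl} {S : N → List Bool} :
    Run (.load f : BitProg Γ₀ N) x S 1 (f x) S := fun _ => Exec.load le_rfl

theorem Run.skip {x : Ctl} {S : N → List Bool} :
    Run (skip : BitProg Γ₀ N) x S 1 x S := Run.load

theorem Run.seq {c d : BitProg Γ₀ N} {x x' x'' : Ctl} {S S' S'' : N → List Bool} {t₁ t₂ : ℕ}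
    (h₁ : Run c x S t₁ x' S') (h₂ : Run d x' S' t₂ x'' S'') :
    Run (.seq c d) x S (t₁ + t₂) x'' S'' := fun w => .seq (h₁ w) (h₂ w) le_rfl

theorem Run.ite_true {c d : BitProg Γ₀ N} {p : Ctl → Bool} {x x' : Ctl} {S S' : N → List Bool}
    {t : ℕ} (hp : p x = true) (h : Run c x S t x' S') :
    Run (.ite p c d) x S (t + 1) x' S' := fun w => .ite_true hp (h w) le_rfl

theorem Run.ite_false {c d : BitProg Γ₀ N} {p : Ctl → Bool} {x x' : Ctl} {S S' : N → List Bool}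
    {t : ℕ} (hp : p x = false) (h : Run d x S t x' S') :
    Run (.ite p c d) x S (t + 1) x' S' := fun w => .ite_false hp (h w) le_rfl

theorem Run.each_nil {k : N} {c : BitProg Γ₀ N} {x : Ctl} {S : N → List Bool} (hk : S k = []) :
    Run (each k c) x S 1 { x with top := none } S := fun w => by
  have h := Exec.loop_exit (Γ := RawAlphabet Γ₀ (N := N)) (k := some k)
    (f := fun x o => { x with top := o }) (p := fun x => x.top.isSome) (c := c) (x := x)
    (S := withRaw w S) (t := 1) (by simp [withRaw, hk]) le_rfl
  have h2 : (withRaw w S (some k)) = [] := hk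
  have h3 : update (withRaw w S) (some k) [] = withRaw w S := by
    rw [← h2, update_eq_self]
  rw [h2, List.tail_nil, h3] at h
  exact h

theorem Run.each_cons {k : N} {c : BitProg Γ₀ N} {x x' x'' : Ctl} {S S' S'' : N → List Bool}
    {a : Bool} {l : List Bool} {t₁ t₂ : ℕ} (hk : S k = a :: l)
    (h₁ : Run c { x with top := some a } (update S k l) t₁ x' S')
    (h₂ : Run (each k c) x' S' t₂ x'' S'') :
    Run (each k c) x S (1 + t₁ + t₂) x'' S'' := fun w => by
  have hk' : withRaw w S (some k) = a :: l := hk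
  refine Exec.loop_step (t₁ := t₁) (x' := x') (S' := withRaw w S') ?_ ?_ (h₂ w) le_rfl
  · simp [hk']
  · rw [hk', List.tail_cons]
    erw [update_withRaw]
    exact h₁ w

theorem Run.moveAll {a b : N} (hab : a ≠ b) (x : Ctl) (l : List Bool) (S : N → List Bool)
    (hl : S a = l) :
    Run (moveAll a b : BitProg Γ₀ N) x S (l.length * 2 + 1) { x with top := none }
      (update (update S a []) b (l.reverse ++ S b)) := by
  induction l generalizing x S with
  | nil =>
    have h := Run.each_nil (Γ₀ := Γ₀) (c := BitProg.put b fun x => x.top.getD false) (x := x) hl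
    have e : update S a [] = S := by rw [← hl, update_eq_self]
    simpa [e, BitProg.moveAll] using h
  | cons c l ih =>
    have h := Run.each_cons (c := BitProg.put b fun x => x.top.getD false) (Γ₀ := Γ₀) (x := x) hl
      Run.put (ih _ _ (by simp [hab]))
    rw [BitProg.moveAll]
    convert h.mono (t' := (c :: l).length * 2 + 1) (by simp; omega) using 1
    · funext k
      by_cases hb : k = b
      · subst hb; simp [hab.symm]
      · by_cases ha : k = a
        · subst ha; simp [hb]
        · simp [ha, hb]

theorem Run.each_put {k t : N} (hkt : k ≠ t) (m : ℕ) (x : Ctl) (S : N → List Bool)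
    (hk : S k = List.replicate m true) :
    Run (BitProg.each k (BitProg.put t fun _ => true) : BitProg Γ₀ N) x S (m * 2 + 1)
      { x with top := none } (update (update S k []) t (List.replicate m true ++ S t)) := by
  induction m generalizing x S with
  | zero =>
    have h := Run.each_nil (Γ₀ := Γ₀) (c := BitProg.put t fun _ => true) (x := x) hk
    have e : update S k [] = S := by rw [← List.replicate_zero (a := true), ← hk, update_eq_self]
    simpa [e] using h
  | succ m ih =>
    have h := Run.each_cons (Γ₀ := Γ₀) (c := BitProg.put t fun _ => true) (x := x) hk Run.put
      (ih _ _ (by simp [hkt]))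
    convert h.mono (t' := (m + 1) * 2 + 1) (by omega) using 1
    · funext k'
      by_cases hb : k' = t
      · subst hb
        simp only [update_self, update_of_ne hkt.symm]
        rw [List.append_cons, ← List.replicate_succ']
      · by_cases ha : k' = k
        · subst ha; simp [hb]
        · simp [ha, hb]

section rep

variable {k t : N} {c : BitProg Γ₀ N} {I : (N → List Bool) → Prop}
  {G : (N → List Bool) → N → List Bool} {T : ℕ}

/-- While `c` runs, the counter is split between `k` and `t`, so its effect `G` has to commute with
any change of these two stacks, and the precondition `I` must not depend on them. The second loop
moves the counter back; each round costs `T + 2` on the way out and 2 on the way back. -/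
theorem Run.rep (hkt : k ≠ t) (hc : ∀ x S, I S → ∃ o, Run c x S T { x with top := o } (G S))
    (hIk : ∀ S l, I S → I (update S k l)) (hIt : ∀ S l, I S → I (update S t l))
    (hIG : ∀ S, I S → I (G S)) (hGk : ∀ S l, G (update S k l) = update (G S) k l)
    (hGt : ∀ S l, G (update S t l) = update (G S) t l) (m : ℕ) (x : Ctl) (S : N → List Bool)
    (hS : I S) (hk : S k = List.replicate m true) (ht : S t = []) :
    ∃ o, Run (rep k t c) x S (m * (T + 4) + 2) { x with top := o } (G^[m] S) := by
  have hGk' : ∀ S, G S k = S k := fun S => by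
    have := congrFun (hGk S (S k)) k
    rwa [update_eq_self, update_self] at this
  have hGt' : ∀ S, G S t = S t := fun S => by
    have := congrFun (hGt S (S t)) t
    rwa [update_eq_self, update_self] at this
  have hGkm : ∀ m S, (G^[m] S) k = S k := fun m S => by
    induction m generalizing S with
    | zero => rfl
    | succ m ih => rw [iterate_succ_apply, ih, hGk']
  have key : ∀ (m : ℕ) (x : Ctl) (S : N → List Bool), I S → S k = List.replicate m true →
      Run (BitProg.each k (.seq c (BitProg.put t fun _ => true))) x S (m * (T + 2) + 1)
        { x with top := none }
        (update (update (G^[m] S) k []) t (List.replicate m true ++ S t)) := by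
    intro m
    induction m with
    | zero =>
      intro x S _ hk
      have h := Run.each_nil (c := .seq c (BitProg.put t fun _ => true)) (x := x) hk
      have e : update S k [] = S := by rw [← List.replicate_zero (a := true), ← hk, update_eq_self]
      simpa [e] using h
    | succ m ih =>
      intro x S hS hk
      obtain ⟨o, ho⟩ := hc { x with top := some true } (update S k (List.replicate m true))
        (hIk _ _ hS)
      have h := Run.each_cons hk (ho.seq (Run.put (k := t) (f := fun _ => true)))
        (ih _ _ (hIt _ _ (hIG _ (hIk _ _ hS)))
        (by rw [update_of_ne hkt, hGk', update_self]))
      convert h.mono (t' := (m + 1) * (T + 2) + 1) (by linarith) using 1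
      -- The iterates of `G` also commute with changes of `t` and `k`, so the bookkeeping of the
      -- first round can be pulled out of the remaining `m` rounds.
      have e1 : ∀ m S l, G^[m] (update S t l) = update (G^[m] S) t l := fun m S l => by
        induction m generalizing S with
        | zero => rfl
        | succ m ih => rw [iterate_succ_apply, hGt, ih, iterate_succ_apply]
      have e2 : ∀ m S l, G^[m] (update S k l) = update (G^[m] S) k l := fun m S l => by
        induction m generalizing S with
        | zero => rfl
        | succ m ih => rw [iterate_succ_apply, hGk, ih, iterate_succ_apply]
      rw [e1, ← iterate_succ_apply, e2, update_self, hGt', update_of_ne hkt.symm]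
      funext k'
      by_cases hb : k' = t
      · subst hb
        simp only [update_self]
        rw [List.append_cons, ← List.replicate_succ']
      · by_cases ha : k' = k
        · subst ha; simp [hb]
        · simp [ha, hb]
  have h := (key m x S hS hk).seq (Run.each_put hkt.symm m _ _
    (by rw [update_self, ht, List.append_nil]))
  refine ⟨none, ?_⟩
  rw [BitProg.rep]
  convert h.mono (t' := m * (T + 4) + 2) (by linarith) using 1
  funext k'
  have hGtm : ∀ m S, (G^[m] S) t = S t := fun m S => by
    induction m generalizing S with
    | zero => rfl
    | succ m ih => rw [iterate_succ_apply, ih, hGt']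
  by_cases hb : k' = t
  · subst hb
    rw [update_of_ne hkt.symm, update_self, hGtm, ht]
  · by_cases ha : k' = k
    · subst ha; simp [hb, hGkm, hk]
    · simp [ha, hb]

end rep

/-- The stacks after moving `m` bits from `a` to `b`. -/
def shift (a b : N) (m : ℕ) (S : N → List Bool) : N → List Bool :=
  update (update S a ((S a).drop m)) b (((S a).take m).reverse ++ S b)

theorem shift_zero (a b : N) (S : N → List Bool) : shift a b 0 S = S := by
  simp [shift]

/-- The buffer receives bits in reverse order, so consecutive moves concatenate. This remains true
when the source runs empty. -/
theorem shift_shift {a b : N} (hab : a ≠ b) (m m' : ℕ) (S : N → List Bool) :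
    shift a b m' (shift a b m S) = shift a b (m + m') S := by
  funext k
  by_cases hb : k = b
  · subst hb
    simp [shift, hab, List.take_add]
  · by_cases ha : k = a
    · subst ha; simp [shift, hb]
    · simp [shift, ha, hb]

theorem shift_iterate {a b : N} (hab : a ≠ b) (m i : ℕ) (S : N → List Bool) :
    (shift a b m)^[i] S = shift a b (i * m) S := by
  induction i generalizing S with
  | zero => simp [shift_zero]
  | succ i ih => rw [iterate_succ_apply, ih, shift_shift hab, Nat.succ_mul, Nat.add_comm]

theorem shift_update {a b k : N} (ha : k ≠ a) (hb : k ≠ b) (m : ℕ) (S : N → List Bool)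
    (l : List Bool) : shift a b m (update S k l) = update (shift a b m S) k l := by
  funext k'
  by_cases h : k' = k
  · subst h; simp [shift, ha, hb]
  · by_cases hb' : k' = b
    · subst hb'; simp [shift, ha.symm, hb.symm]
    · by_cases ha' : k' = a
      · subst ha'; simp [shift, hb', ha.symm]
      · simp [shift, ha', hb', h]

theorem shift_apply {a b k : N} (ha : k ≠ a) (hb : k ≠ b) (m : ℕ) (S : N → List Bool) :
    shift a b m S k = S k := by
  simp [shift, ha, hb]

theorem Run.move {a b : N} (hab : a ≠ b) (x : Ctl) (S : N → List Bool) :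
    ∃ o, Run (move a b : BitProg Γ₀ N) x S 3 { x with top := o } (shift a b 1 S) := by
  rcases h : S a with _ | ⟨c, l⟩
  · refine ⟨none, ?_⟩
    have h1 : Run (BitProg.take a : BitProg Γ₀ N) x S 1 { x with top := none } S := by
      have := Run.take (Γ₀ := Γ₀) (k := a) (x := x) (S := S)
      rw [h] at this
      have e : update S a [] = S := by rw [← h, update_eq_self]
      simpa [e] using this
    have e : shift a b 1 S = S := by
      have e : update S a [] = S := by rw [← h, update_eq_self]
      simp [shift, h, e]
    rw [e]
    exact h1.seq (Run.ite_false rfl Run.skip)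
  · refine ⟨some c, ?_⟩
    have h1 := Run.take (Γ₀ := Γ₀) (k := a) (x := x) (S := S)
    have h2 := h1.seq (Run.ite_true (p := fun x => x.top.isSome) (d := BitProg.skip)
      (by simp [h]) (Run.put (k := b) (f := fun x => x.top.getD false)))
    convert h2 using 1
    · rfl
    · rw [h, List.head?_cons]
    · simp [shift, h, hab.symm]

end BitProg

/-! ### Programs with index variables and arrays -/

/-- The stacks used by programs with index variables in `V` and `r`-dimensional arrays in `J`: the
input stream, two stacks per variable whose heights are its value and its distance to `n`, the
arrays, the powers of `n` and `n` itself in unary, and auxiliary stacks. -/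
inductive StackName (V J : Type) (r : ℕ) : Type
  | inp
  | lo (v : V)
  | hi (v : V)
  | arr (j : J)
  | pow (i : Fin (r + 1))
  | cnt
  | tmp
  | tmp'
  | buf
  deriving DecidableEq

instance {V J : Type} {r : ℕ} [Finite V] [Finite J] : Finite (StackName V J r) := by
  let f : V ⊕ V ⊕ J ⊕ Fin (r + 1) ⊕ Fin 5 → StackName V J r
    | .inl v => .lo v
    | .inr (.inl v) => .hi v
    | .inr (.inr (.inl j)) => .arr j
    | .inr (.inr (.inr (.inl i))) => .pow i
    | .inr (.inr (.inr (.inr 0))) => .inp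
    | .inr (.inr (.inr (.inr 1))) => .cnt
    | .inr (.inr (.inr (.inr 2))) => .tmp
    | .inr (.inr (.inr (.inr 3))) => .tmp'
    | .inr (.inr (.inr (.inr 4))) => .buf
  refine Finite.of_surjective f fun k => ?_
  cases k with
  | lo v => exact ⟨.inl v, rfl⟩
  | hi v => exact ⟨.inr (.inl v), rfl⟩
  | arr j => exact ⟨.inr (.inr (.inl j)), rfl⟩
  | pow i => exact ⟨.inr (.inr (.inr (.inl i))), rfl⟩
  | inp => exact ⟨.inr (.inr (.inr (.inr 0))), rfl⟩
  | cnt => exact ⟨.inr (.inr (.inr (.inr 1))), rfl⟩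
  | tmp => exact ⟨.inr (.inr (.inr (.inr 2))), rfl⟩
  | tmp' => exact ⟨.inr (.inr (.inr (.inr 3))), rfl⟩
  | buf => exact ⟨.inr (.inr (.inr (.inr 4))), rfl⟩

/-- The contents of the arrays over `{0, …, n - 1}` and of the input stream. -/
structure Store (J : Type) (r n : ℕ) where
  arr : J → (Fin r → Fin n) → Bool
  inp : List Bool

open Function

namespace Store

variable {V J : Type} {r n : ℕ}

/-- The list of the entries of an array. -/
def entries (R : (Fin r → Fin n) → Bool) : List Bool :=
  List.ofFn fun p : Fin (n ^ r) => R (finFunctionFinEquiv.symm p)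

/-- The stacks that represent a store, with values `e` of the index variables. -/
def toStacks (e : V → ℕ) (D : Store J r n) : StackName V J r → List Bool
  | .inp => D.inp
  | .lo v => List.replicate (e v) true
  | .hi v => List.replicate (n - e v) true
  | .arr j => entries (D.arr j)
  | .pow i => List.replicate (n ^ (i : ℕ)) true
  | .cnt => List.replicate n true
  | .tmp => []
  | .tmp' => []
  | .buf => []

variable [DecidableEq J]

/-- Write a bit to an array. -/
def write (D : Store J r n) (j : J) (t : Fin r → Fin n) (b : Bool) : Store J r n :=
  { D with arr := update D.arr j (update (D.arr j) t b) }

theorem length_entries (R : (Fin r → Fin n) → Bool) : (entries R).length = n ^ r := by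
  simp [entries]

theorem entries_getElem (R : (Fin r → Fin n) → Bool) (t : Fin r → Fin n) :
    (entries R)[(finFunctionFinEquiv t : ℕ)]'((finFunctionFinEquiv t).2.trans_eq
      (length_entries R).symm) = R t := by
  simp only [entries, List.getElem_ofFn, Fin.eta, Equiv.symm_apply_apply]

theorem entries_update (R : (Fin r → Fin n) → Bool) (t : Fin r → Fin n) (b : Bool) :
    entries (update R t b) = (entries R).set (finFunctionFinEquiv t : ℕ) b := by
  apply List.ext_getElem
  · simp [entries]
  · intro i h₁ h₂
    rw [List.getElem_set]
    split_ifs with h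
    · subst h
      rw [entries_getElem, update_self]
    · simp only [entries, List.getElem_ofFn]
      rw [update_of_ne]
      intro h'
      rw [← h', Equiv.apply_symm_apply] at h
      exact h rfl

end Store

namespace BitProg

open StackProg

variable {Γ₀ V J : Type} {r : ℕ}

/-- Run `c` for all values of the index variable `v`. -/
def forLoop (v : V) (c : BitProg Γ₀ (StackName V J r)) : BitProg Γ₀ (StackName V J r) :=
  .seq (each (.hi v) (.seq (put (.hi v) fun _ => true) (.seq c (.seq (take (.hi v))
    (put (.lo v) fun _ => true))))) (moveAll (.lo v) (.hi v))

/-- Move the entries before the position `a` from the array `j` to the buffer. -/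
def walk (j : J) (a : Fin r → V) : BitProg Γ₀ (StackName V J r) :=
  (List.finRange r).foldr (fun i c => .seq
    (rep (.lo (a i)) .tmp (rep (.pow i.castSucc) .tmp' (move (.arr j) .buf))) c) skip

/-- Read the entry of the array `j` at the position `a` into the result bit. -/
def readArr (j : J) (a : Fin r → V) : BitProg Γ₀ (StackName V J r) :=
  .seq (walk j a) (.seq (take (.arr j)) (.seq (.load fun x => { x with res := x.top.getD false })
    (.seq (put (.arr j) Ctl.res) (moveAll .buf (.arr j)))))

/-- Write the result bit to the array `j` at the position `a`. -/
def writeArr (j : J) (a : Fin r → V) : BitProg Γ₀ (StackName V J r) :=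
  .seq (walk j a) (.seq (take (.arr j)) (.seq (put (.arr j) Ctl.res) (moveAll .buf (.arr j))))

variable [DecidableEq V] [DecidableEq J] {n : ℕ}

/-- The value `i` of `v` is the pair of heights `i` and `n - i` of its two stacks, and one symbol
crosses over in each round. The final move resets `v` to `0`, which is why it has to be `0` at the
start. The loop control overwrites `top`, so the invariant must ignore it (`htop`). -/
theorem Run.forLoop {v : V} {c : BitProg Γ₀ (StackName V J r)} {e : V → ℕ} {T : ℕ}
    (I : ℕ → Ctl → Store J r n → Prop)
    (htop : ∀ i x D o, I i x D → I i { x with top := o } D)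
    (h : ∀ i < n, ∀ x D, I i x D → ∃ x' D',
      Run c x (D.toStacks (update e v i)) T x' (D'.toStacks (update e v i)) ∧ I (i + 1) x' D')
    (hv : e v = 0) (x : Ctl) (D : Store J r n) (hI : I 0 x D) :
    ∃ x' D', Run (BitProg.forLoop v c) x (D.toStacks e) (n * (T + 6) + 2) x'
      (D'.toStacks e) ∧ I n x' D' := by
  have key : ∀ m i, i + m = n → ∀ x D, I i x D → ∃ x' D',
      Run (BitProg.each (.hi v) (.seq (BitProg.put (.hi v) fun _ => true) (.seq c
        (.seq (BitProg.take (.hi v)) (BitProg.put (.lo v) fun _ => true))))) x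
        (D.toStacks (update e v i)) (m * (T + 4) + 1) x'
          (D'.toStacks (update e v n)) ∧ I n x' D' := by
    intro m
    induction m with
    | zero =>
      rintro i rfl x D hI
      exact ⟨_, D, (Run.each_nil (by simp [Store.toStacks])).mono (by omega), htop _ _ _ none hI⟩
    | succ m ih =>
      intro i hi x D hI
      obtain ⟨x₁, D₁, h₁, hI₁⟩ := h i (by omega) _ _ (htop _ _ _ (some true) hI)
      obtain ⟨x₂, D₂, h₂, hI₂⟩ := ih (i + 1) (by omega) _ _
        (htop _ _ _ (some true) hI₁)
      refine ⟨x₂, D₂, ?_, hI₂⟩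
      have e₀ : n - i = m + 1 := by omega
      have e₁ : n - (i + 1) = m := by omega
      have h₃ := Run.take (Γ₀ := Γ₀) (k := StackName.hi v) (x := x₁)
        (S := D₁.toStacks (update e v i))
      have h₄ := h₁.seq (h₃.seq (Run.put (k := StackName.lo v) (f := fun _ => true)))
      -- The symbol popped by the loop test is put back, so that the body sees exactly the stacks
      -- for the value `i`.
      have h₅ : Run (BitProg.put (.hi v) fun _ => true : BitProg Γ₀ (StackName V J r))
          { x with top := some true }
          (update (D.toStacks (update e v i)) (.hi v) (List.replicate m true)) 1
          { x with top := some true } (D.toStacks (update e v i)) := by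
        have := Run.put (Γ₀ := Γ₀) (k := StackName.hi v) (f := fun _ => true)
          (x := { x with top := some true })
          (S := (update (D.toStacks (update e v i)) (.hi v) (List.replicate m true)))
        convert this using 1
        have e₂ : true :: List.replicate m true = D.toStacks (update e v i) (.hi v) := by
          simp [Store.toStacks, e₀, List.replicate_succ]
        rw [update_self, update_idem, e₂, update_eq_self]
      refine (Run.each_cons (a := true) (l := List.replicate m true) ?_ (h₅.seq h₄)
        (x'' := x₂) (S'' := D₂.toStacks (update e v n)) (t₂ := m * (T + 4) + 1) ?_).mono
        (by linarith)
      · simp [Store.toStacks, e₀, List.replicate_succ]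
      · convert h₂ using 1
        · simp [Store.toStacks, e₀, List.replicate_succ]
        · funext k
          cases k with
          | lo v' =>
            by_cases hv' : v' = v
            · subst hv'; simp [Store.toStacks, List.replicate_succ]
            · simp [Store.toStacks, hv']
          | hi v' =>
            by_cases hv' : v' = v
            · subst hv'; simp [Store.toStacks, e₁, e₀]
            · simp [Store.toStacks, hv']
          | _ => simp [Store.toStacks]
  obtain ⟨x', D', h', hI'⟩ := key n 0 (by omega) x D hI
  refine ⟨{ x' with top := none }, D', ?_, htop _ _ _ _ hI'⟩
  have h₆ := h'.seq (Run.moveAll (a := .lo v) (b := .hi v) (by simp) x'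
    (List.replicate n true) _ (by simp [Store.toStacks]))
  have e₀ : update e v 0 = e := by rw [← hv, update_eq_self]
  rw [e₀] at h₆
  rw [BitProg.forLoop]
  convert h₆.mono (t' := n * (T + 6) + 2) (by simp; linarith) using 1
  funext k
  cases k with
  | lo v' =>
    by_cases hv' : v' = v
    · subst hv'; simp [Store.toStacks, hv]
    · simp [Store.toStacks, hv']
  | hi v' =>
    by_cases hv' : v' = v
    · subst hv'; simp [Store.toStacks, hv]
    · simp [Store.toStacks, hv']
  | _ => simp [Store.toStacks]

/-- The address of a tuple is a number in base `n`: for the coordinate `i`, two nested repetitions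
move one bit `e (a i) * n ^ i` times, using the stored unary power. A move takes 3 steps and a
repetition adds 4 per round, whence the factor 7. -/
theorem Run.walk_list {j : J} {a : Fin r → V} (hn : 0 < n) (e : V → ℕ) (he : ∀ v, e v ≤ n)
    (l : List (Fin r)) (x : Ctl) (S : StackName V J r → List Bool)
    (hlo : ∀ v, S (.lo v) = List.replicate (e v) true)
    (hpow : ∀ i, S (.pow i) = List.replicate (n ^ (i : ℕ)) true)
    (ht : S .tmp = []) (ht' : S .tmp' = []) :
    ∃ o, Run (l.foldr (fun i c => .seq
        (BitProg.rep (.lo (a i)) .tmp (BitProg.rep (.pow i.castSucc) .tmp'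
          (BitProg.move (.arr j) .buf))) c) BitProg.skip : BitProg Γ₀ (StackName V J r)) x S
      (l.length * (n * (n ^ r * 7 + 6) + 2) + 1) { x with top := o }
      (shift (.arr j) .buf (l.map fun i => e (a i) * n ^ (i : ℕ)).sum S) := by
  have hab : (StackName.arr j : StackName V J r) ≠ .buf := by simp
  induction l generalizing x S with
  | nil => exact ⟨x.top, by simpa [shift_zero] using Run.skip⟩
  | cons i l ih =>
    have h₁ := Run.rep (Γ₀ := Γ₀) (T := n ^ (i : ℕ) * 7 + 2)
      (c := BitProg.rep (.pow i.castSucc) .tmp' (BitProg.move (.arr j) .buf))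
      (k := .lo (a i)) (t := .tmp)
      (I := fun S : StackName V J r → List Bool =>
        S (.pow i.castSucc) = List.replicate (n ^ (i : ℕ)) true ∧ S .tmp' = [])
      (G := shift (.arr j) .buf (n ^ (i : ℕ))) (by simp)
      (fun x S hS => by
        have := Run.rep (Γ₀ := Γ₀) (T := 3) (c := BitProg.move (.arr j) .buf)
          (k := .pow i.castSucc) (t := .tmp') (I := fun _ => True)
          (G := shift (.arr j) .buf 1) (by simp) (fun x S _ => Run.move hab x S)
          (fun _ _ _ => trivial) (fun _ _ _ => trivial) (fun _ _ => trivial)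
          (fun S l => shift_update (by simp) (by simp) _ _ _)
          (fun S l => shift_update (by simp) (by simp) _ _ _)
          (n ^ (i : ℕ)) x S trivial hS.1 hS.2
        rwa [shift_iterate hab, Nat.mul_one] at this)
      (fun S l hS => by simpa using hS) (fun S l hS => by simpa using hS)
      (fun S hS => by simpa [shift] using hS)
      (fun S l => shift_update (by simp) (by simp) _ _ _)
      (fun S l => shift_update (by simp) (by simp) _ _ _)
      (e (a i)) x S ⟨hpow _, ht'⟩ (hlo _) ht
    obtain ⟨o₁, h₁⟩ := h₁
    rw [shift_iterate hab] at h₁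
    obtain ⟨o₂, h₂⟩ := ih { x with top := o₁ } (shift (.arr j) .buf (e (a i) * n ^ (i : ℕ)) S)
      (fun v => by rw [shift_apply (by simp) (by simp), hlo])
      (fun v => by rw [shift_apply (by simp) (by simp), hpow])
      (by rw [shift_apply (by simp) (by simp), ht])
      (by rw [shift_apply (by simp) (by simp), ht'])
    rw [shift_shift hab] at h₂
    refine ⟨o₂, (h₁.seq h₂).mono ?_⟩
    have h₃ : n ^ (i : ℕ) ≤ n ^ r := Nat.pow_le_pow_right hn i.2.le
    have h₄ : e (a i) * (n ^ (i : ℕ) * 7 + 2 + 4) ≤ n * (n ^ r * 7 + 6) :=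
      Nat.mul_le_mul (he _) (by omega)
    rw [List.length_cons, Nat.succ_mul]
    omega

/-- The time for an access to an array. -/
def accessTime (r n : ℕ) : ℕ := r * (n * (n ^ r * 7 + 6) + 2) + 1 + 2 * n ^ r + 10

theorem Run.walk {j : J} {a : Fin r → V} (e : V → Fin n) (x : Ctl) (D : Store J r n) :
    ∃ o, Run (BitProg.walk j a : BitProg Γ₀ (StackName V J r)) x (D.toStacks fun v => e v)
      (r * (n * (n ^ r * 7 + 6) + 2) + 1) { x with top := o }
      (shift (.arr j) .buf (finFunctionFinEquiv fun i => e (a i) : ℕ)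
        (D.toStacks fun v => e v)) := by
  -- In dimension 0 no bit is moved and `n` may be `0`; otherwise an index value in `Fin n` shows
  -- that `n` is positive.
  rcases Nat.eq_zero_or_pos r with rfl | hr
  · refine ⟨x.top, ?_⟩
    have : (finFunctionFinEquiv (fun i => e (a i)) : ℕ) = 0 := by simp
    rw [this, shift_zero]
    exact Run.skip.mono (by omega)
  have hn : 0 < n := (Nat.zero_le _).trans_lt (e (a ⟨0, hr⟩)).2
  have := Run.walk_list (Γ₀ := Γ₀) (j := j) (a := a) hn (fun v => (e v : ℕ))
    (fun v => (e v).2.le) (List.finRange r) x (D.toStacks fun v => e v)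
    (fun v => rfl) (fun i => rfl) rfl rfl
  rw [finFunctionFinEquiv_apply, ← List.sum_ofFn, List.ofFn_eq_map]
  rwa [List.length_finRange] at this

/-- After the walk the wanted entry is on top of the array and the earlier entries are in the buffer
in reverse order; putting the entry back and emptying the buffer restores the array. -/
theorem Run.readArr {j : J} {a : Fin r → V} (e : V → Fin n) (x : Ctl) (D : Store J r n) :
    ∃ o, Run (BitProg.readArr j a : BitProg Γ₀ (StackName V J r)) x (D.toStacks fun v => e v)
      (accessTime r n) { x with res := D.arr j fun i => e (a i), top := o }
      (D.toStacks fun v => e v) := by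
  obtain ⟨o, h⟩ := Run.walk (Γ₀ := Γ₀) (j := j) (a := a) e x D
  set p := finFunctionFinEquiv fun i => e (a i) with hp
  have hlen : (Store.entries (D.arr j)).length = n ^ r := Store.length_entries _
  have hget : (Store.entries (D.arr j))[(p : ℕ)]? = some (D.arr j fun i => e (a i)) := by
    rw [List.getElem?_eq_getElem (by rw [hlen]; exact p.2), Store.entries_getElem]
  have hdrop : (Store.entries (D.arr j)).drop p =
      (D.arr j fun i => e (a i)) :: (Store.entries (D.arr j)).drop (p + 1) := by
    rw [List.drop_eq_getElem_cons (by rw [hlen]; exact p.2), Store.entries_getElem]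
  have ha : ∀ m, shift (.arr j) .buf m (D.toStacks fun v => (e v : ℕ)) (.arr j) =
      (Store.entries (D.arr j)).drop m := fun m => by simp [shift, Store.toStacks]
  have h₂ := h.seq ((Run.take (k := .arr j)).seq ((Run.load
    (f := fun x => { x with res := x.top.getD false })).seq ((Run.put (k := .arr j)
    (f := Ctl.res)).seq (Run.moveAll (a := .buf) (b := .arr j) (by simp) _
    ((Store.entries (D.arr j)).take p).reverse _ (by simp [shift, Store.toStacks])))))
  refine ⟨none, ?_⟩
  rw [BitProg.readArr]
  convert h₂.mono (t' := accessTime r n) ?_ using 1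
  · rw [ha, hdrop]
    rfl
  · funext k
    by_cases hk : k = .arr j
    · subst hk
      simp only [update_self, ha, hdrop, List.reverse_reverse]
      simp [Store.toStacks, hget, ← hdrop]
    · by_cases hk' : k = .buf
      · subst hk'
        simp [Store.toStacks]
      · simp [hk, hk', shift]
  · have := p.2
    simp only [accessTime, List.length_reverse, List.length_take]
    omega

theorem Run.writeArr {j : J} {a : Fin r → V} (e : V → Fin n) (x : Ctl) (D : Store J r n) :
    ∃ o, Run (BitProg.writeArr j a : BitProg Γ₀ (StackName V J r)) x (D.toStacks fun v => e v)
      (accessTime r n) { x with top := o }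
      ((D.write j (fun i => e (a i)) x.res).toStacks fun v => e v) := by
  obtain ⟨o, h⟩ := Run.walk (Γ₀ := Γ₀) (j := j) (a := a) e x D
  set p := finFunctionFinEquiv fun i => e (a i) with hp
  have hlen : (Store.entries (D.arr j)).length = n ^ r := Store.length_entries _
  have ha : ∀ m, shift (.arr j) .buf m (D.toStacks fun v => (e v : ℕ)) (.arr j) =
      (Store.entries (D.arr j)).drop m := fun m => by simp [shift, Store.toStacks]
  have h₂ := h.seq ((Run.take (k := .arr j)).seq ((Run.put (k := .arr j)
    (f := Ctl.res)).seq (Run.moveAll (a := .buf) (b := .arr j) (by simp) _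
    ((Store.entries (D.arr j)).take p).reverse _ (by simp [shift, Store.toStacks]))))
  refine ⟨none, ?_⟩
  rw [BitProg.writeArr]
  convert h₂.mono (t' := accessTime r n) ?_ using 1
  · funext k
    by_cases hk : k = .arr j
    · subst hk
      simp only [update_self, ha, List.reverse_reverse]
      have hlt : (p : ℕ) < (Store.entries (D.arr j)).length := by rw [hlen]; exact p.2
      simp [Store.toStacks, Store.write, Store.entries_update, ← hp,
        List.set_eq_take_append_cons_drop,
        hlt]
    · by_cases hk' : k = .buf
      · subst hk'
        simp [Store.toStacks]
      · simp only [update_of_ne hk, update_of_ne hk', shift]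
        cases k with
        | arr j' =>
          have : j' ≠ j := fun h => hk (by rw [h])
          simp [Store.toStacks, Store.write, this]
        | _ => rfl
  · have := p.2
    simp only [accessTime, List.length_reverse, List.length_take]
    omega

end BitProg

/-! ### A loop language over Boolean arrays and its compilation to stack programs -/

/-- Boolean expressions over index variables in `V` and `r`-dimensional arrays in `J`. -/
inductive BExp (V J : Type) (r : ℕ) : Type
  | tt
  | eof
  | arr (j : J) (a : Fin r → V)
  | not (e : BExp V J r)
  | and (e e' : BExp V J r)
  | ex (v : V) (e : BExp V J r)

/-- Commands over index variables in `V` and `r`-dimensional arrays in `J`. -/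
inductive Cmd (V J : Type) (r : ℕ) : Type
  | skip
  | assign (j : J) (a : Fin r → V) (e : BExp V J r)
  | read (j : J) (a : Fin r → V)
  | seq (c d : Cmd V J r)
  | iter (v : V) (c : Cmd V J r)

/-- The iterated application of `f 0`, …, `f (m - 1)`. -/
def iterFor {α : Type*} (f : ℕ → α → α) : ℕ → α → α
  | 0, a => a
  | m + 1, a => f m (iterFor f m a)

namespace BExp

variable {V J : Type} {r n : ℕ} [DecidableEq V]

/-- The value of an expression. -/
def eval : BExp V J r → (V → Fin n) → Store J r n → Bool
  | tt, _, _ => true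
  | eof, _, D => D.inp.isEmpty
  | arr j a, E, D => D.arr j fun i => E (a i)
  | not e, E, D => !e.eval E D
  | and e e', E, D => e.eval E D && e'.eval E D
  | ex v e, E, D => decide (∃ i, e.eval (update E v i) D = true)

/-- The bound variables are new: different from those in `A` and not reused inside. -/
def Fresh : BExp V J r → Set V → Prop
  | tt, _ => True
  | eof, _ => True
  | arr _ _, _ => True
  | not e, A => e.Fresh A
  | and e e', A => e.Fresh A ∧ e'.Fresh A
  | ex v e, A => v ∉ A ∧ e.Fresh (insert v A)

/-- The program that evaluates an expression into the result bit. -/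
def prog {Γ₀ : Type} : BExp V J r → BitProg Γ₀ (StackName V J r)
  | tt => .load fun x => { x with res := true }
  | eof => .seq (BitProg.take .inp) (.ite (fun x => x.top.isSome)
      (.seq (BitProg.put .inp fun x => x.top.getD false) (.load fun x => { x with res := false }))
      (.load fun x => { x with res := true }))
  | arr j a => BitProg.readArr j a
  | not e => .seq e.prog (.load fun x => { x with res := !x.res })
  | and e e' => .seq e.prog (.ite Ctl.res e'.prog BitProg.skip)
  | ex v e => .seq (.load fun x => { x with res := false })
      (BitProg.forLoop v (.ite Ctl.res BitProg.skip e.prog))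

variable [DecidableEq J]

theorem update_val (E : V → Fin n) (v : V) (i : Fin n) :
    update (fun v => (E v : ℕ)) v i = fun v' => ((update E v i v' : Fin n) : ℕ) := by
  funext v'
  by_cases h : v' = v
  · subst h; simp
  · simp [h]

-- A quantifier runs as a loop that starts from index `0`. Freshness guarantees this: `A` contains
-- the indices currently in use, all others are `0`, and a bound variable is outside `A`. The
-- polynomial depends on the expression only, since a quantifier multiplies the time by about `n`.
open BitProg in
theorem run_prog {Γ₀ : Type} (e : BExp V J r) (A : Set V) (he : e.Fresh A) :
    ∃ p : Polynomial ℕ, ∀ (n : ℕ) [NeZero n] (E : V → Fin n) (D : Store J r n) (x : Ctl),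
      (∀ v ∉ A, E v = 0) → ∃ o, Run (e.prog : BitProg Γ₀ (StackName V J r)) x
        (D.toStacks fun v => E v) (p.eval n) { x with res := e.eval E D, top := o }
        (D.toStacks fun v => E v) := by
  induction e generalizing A with
  | tt => exact ⟨1, fun n _ E D x _ => ⟨x.top,
    by simpa [prog, eval] using Run.load (f := fun x => { x with res := true })⟩⟩
  | eof =>
    refine ⟨4, fun n _ E D x _ => ?_⟩
    have h := Run.take (Γ₀ := Γ₀) (k := StackName.inp) (x := x) (S := D.toStacks fun v => (E v : ℕ))
    have hi : (D.toStacks (fun v => (E v : ℕ))) .inp = D.inp := rfl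
    rcases hD : D.inp with _ | ⟨a, l⟩
    · refine ⟨none, ?_⟩
      have h₂ := h.seq (Run.ite_false (p := fun x => x.top.isSome)
        (c := .seq (BitProg.put .inp fun x => x.top.getD false)
          (.load fun x => { x with res := false })) (by simp [hi, hD])
        (Run.load (f := fun x => { x with res := true })))
      convert h₂.mono (t' := 4) (by simp) using 1
      · rfl
      · simp
      · simp [eval, hi, hD]
      · rw [hi, hD, List.tail_nil, ← hD, ← hi, update_eq_self]
    · refine ⟨some a, ?_⟩
      have h₂ := h.seq (Run.ite_true (p := fun x => x.top.isSome)
        (d := .load fun x => { x with res := true }) (by simp [hi, hD])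
        ((Run.put (k := .inp) (f := fun x => x.top.getD false)).seq
          (Run.load (f := fun x => { x with res := false }))))
      convert h₂.mono (t' := 4) (by simp) using 1
      · rfl
      · simp
      · simp [eval, hi, hD]
      · rw [hi, hD, update_self, update_idem, List.head?_cons, List.tail_cons]
        funext k
        cases k <;> simp [Store.toStacks, hD]
  | arr j a =>
    refine ⟨.C r * (.X * (.X ^ r * 7 + 6) + 2) + 1 + 2 * .X ^ r + 10, fun n _ E D x _ => ?_⟩
    simpa [accessTime, prog, eval] using Run.readArr (Γ₀ := Γ₀) (j := j) (a := a) E x D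
  | not e ih =>
    obtain ⟨p, hp⟩ := ih A he
    refine ⟨p + 1, fun n _ E D x hE => ?_⟩
    obtain ⟨o, h⟩ := hp n E D x hE
    refine ⟨o, ?_⟩
    rw [Polynomial.eval_add, Polynomial.eval_one]
    exact h.seq (Run.load (f := fun x => { x with res := !x.res }))
  | and e e' ih ih' =>
    obtain ⟨p, hp⟩ := ih A he.1
    obtain ⟨p', hp'⟩ := ih' A he.2
    refine ⟨p + p' + 2, fun n _ E D x hE => ?_⟩
    obtain ⟨o, h⟩ := hp n E D x hE
    have e₁ : (p + p' + 2).eval n = p.eval n + p'.eval n + 2 := by simp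
    rw [e₁]
    cases hv : e.eval E D with
    | false =>
      refine ⟨o, ?_⟩
      have h₂ := h.seq (Run.ite_false (p := Ctl.res) (c := e'.prog) hv Run.skip)
      simp only [eval, hv, Bool.false_and]
      rw [hv] at h₂
      exact h₂.mono (by omega)
    | true =>
      obtain ⟨o', h'⟩ := hp' n E D { x with res := e.eval E D, top := o } hE
      refine ⟨o', ?_⟩
      have h₂ := h.seq (Run.ite_true (p := Ctl.res) (d := BitProg.skip) hv h')
      simp only [eval, hv, Bool.true_and]
      exact h₂.mono (by omega)
  | ex v e ih =>
    obtain ⟨p, hp⟩ := ih (insert v A) he.2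
    refine ⟨.X * (p + 8) + 3, fun n _ E D x hE => ?_⟩
    have h := Run.forLoop (Γ₀ := Γ₀) (v := v) (c := .ite Ctl.res BitProg.skip e.prog)
      (e := fun v => (E v : ℕ)) (T := p.eval n + 2) (n := n)
      -- The result bit records whether a witness below `i` has been found; once it is set, the body
      -- is skipped.
      (fun i x' D' => D' = D ∧ x'.cat = x.cat ∧
        (x'.res = true ↔ ∃ m : Fin n, (m : ℕ) < i ∧ e.eval (update E v m) D = true))
      (fun i x' D' o h => h)
      (by
        rintro i hi x' D' ⟨rfl, hc, hr⟩
        rw [update_val E v ⟨i, hi⟩]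
        cases hx : x'.res with
        | true =>
          obtain ⟨m, hm, hm'⟩ := hr.1 hx
          exact ⟨x', D', (Run.ite_true hx Run.skip).mono (by omega), rfl, hc,
            fun _ => ⟨m, by omega, hm'⟩, fun _ => hx⟩
        | false =>
          obtain ⟨o, ho⟩ := hp n (update E v ⟨i, hi⟩) D' x' (fun v' hv' => by
            rw [Set.mem_insert_iff, not_or] at hv'
            rw [update_of_ne hv'.1, hE v' hv'.2])
          refine ⟨_, D', (Run.ite_false hx ho).mono (by omega), rfl, hc, ?_⟩
          constructor
          · intro h
            exact ⟨⟨i, hi⟩, Nat.lt_succ_self i, h⟩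
          · rintro ⟨m, hm, hm'⟩
            rcases Nat.lt_succ_iff_lt_or_eq.1 hm with hm | hm
            · have := hr.2 ⟨m, hm, hm'⟩
              rw [hx] at this
              exact absurd this (by simp)
            · have : m = ⟨i, hi⟩ := Fin.ext hm
              rw [← this]
              exact hm')
      (by simp [hE v he.1]) { x with res := false } D ⟨rfl, rfl, by simp⟩
    obtain ⟨x', D', h, rfl, hc, hr⟩ := h
    refine ⟨x'.top, ?_⟩
    have h₂ := (Run.load (f := fun x => { x with res := false }) (x := x)).seq h
    have e₁ : (⟨(ex v e).eval E D', x'.top, x.cat⟩ : Ctl) = x' := by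
      rcases x' with ⟨b, o, c⟩
      simp only [eval, Ctl.mk.injEq, true_and]
      refine ⟨?_, hc.symm⟩
      rw [eq_comm, Bool.eq_iff_iff, hr, decide_eq_true_iff]
      exact exists_congr fun m => by simp
    rw [e₁]
    exact h₂.mono (by simp; linarith)

end BExp

namespace Cmd

variable {V J : Type} {r n : ℕ} [DecidableEq V] [DecidableEq J]

/-- The effect of a command on the store. -/
def eval [NeZero n] : Cmd V J r → (V → Fin n) → Store J r n → Store J r n
  | skip, _, D => D
  | assign j a e, E, D => D.write j (fun i => E (a i)) (e.eval E D)
  | read j a, E, D => { D.write j (fun i => E (a i)) (D.inp.head?.getD false) with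
      inp := D.inp.tail }
  | seq c d, E, D => d.eval E (c.eval E D)
  | .iter v c, E, D => iterFor (fun i D => c.eval (update E v (Fin.ofNat n i)) D) n D

omit [DecidableEq J] in
/-- The bound variables are new: different from those in `A` and not reused inside. -/
def Fresh : Cmd V J r → Set V → Prop
  | skip, _ => True
  | assign _ _ e, A => e.Fresh A
  | read _ _, _ => True
  | seq c d, A => c.Fresh A ∧ d.Fresh A
  | .iter v c, A => v ∉ A ∧ c.Fresh (insert v A)

/-- The program that executes a command. -/
def prog {Γ₀ : Type} : Cmd V J r → BitProg Γ₀ (StackName V J r)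
  | skip => BitProg.skip
  | assign j a e => .seq e.prog (BitProg.writeArr j a)
  | read j a => .seq (BitProg.take .inp) (.seq (.load fun x => { x with res := x.top.getD false })
      (BitProg.writeArr j a))
  | seq c d => .seq c.prog d.prog
  | .iter v c => BitProg.forLoop v c.prog

-- Loops have exactly `n` rounds and their nesting is fixed by the command, so the time is a
-- polynomial in `n` independent of the store. The field `cat` has to survive because it selects the
-- expression evaluated at the end.
open BitProg in
theorem run_prog {Γ₀ : Type} (c : Cmd V J r) (A : Set V) (hc : c.Fresh A) :
    ∃ p : Polynomial ℕ, ∀ (n : ℕ) [NeZero n] (E : V → Fin n) (D : Store J r n) (x : Ctl),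
      (∀ v ∉ A, E v = 0) → ∃ x', x'.cat = x.cat ∧
        Run (c.prog : BitProg Γ₀ (StackName V J r)) x
          (D.toStacks fun v => E v) (p.eval n) x' ((c.eval E D).toStacks fun v => E v) := by
  induction c generalizing A with
  | skip => exact ⟨1, fun n _ E D x _ => ⟨x, rfl, by simpa [prog, eval] using Run.skip⟩⟩
  | assign j a e =>
    obtain ⟨p, hp⟩ := e.run_prog (Γ₀ := Γ₀) A hc
    refine ⟨p + (.C r * (.X * (.X ^ r * 7 + 6) + 2) + 1 + 2 * .X ^ r + 10), fun n _ E D x hE => ?_⟩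
    obtain ⟨o, h⟩ := hp n E D x hE
    obtain ⟨o', h'⟩ := Run.writeArr (Γ₀ := Γ₀) (j := j) (a := a) E
      { x with res := e.eval E D, top := o } D
    exact ⟨{ x with res := e.eval E D, top := o' }, rfl, (h.seq h').mono (by simp [accessTime])⟩
  | read j a =>
    refine ⟨2 + (.C r * (.X * (.X ^ r * 7 + 6) + 2) + 1 + 2 * .X ^ r + 10), fun n _ E D x hE => ?_⟩
    have h := Run.take (Γ₀ := Γ₀) (k := StackName.inp) (x := x) (S := D.toStacks fun v => (E v : ℕ))
    have hi : update (D.toStacks fun v => (E v : ℕ)) .inp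
        ((D.toStacks fun v => (E v : ℕ)) .inp).tail
        = ({ D with inp := D.inp.tail } : Store J r n).toStacks fun v => (E v : ℕ) := by
      funext k
      cases k <;> simp [Store.toStacks]
    rw [hi] at h
    obtain ⟨o', h'⟩ := Run.writeArr (Γ₀ := Γ₀) (j := j) (a := a) E
      { x with res := D.inp.head?.getD false, top := D.inp.head? } { D with inp := D.inp.tail }
    exact ⟨{ x with res := D.inp.head?.getD false, top := o' }, rfl, (h.seq
      ((Run.load (f := fun x => { x with res := x.top.getD false })).seq
      h')).mono (by simp [accessTime]; omega)⟩
  | seq c d ihc ihd =>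
    obtain ⟨p, hp⟩ := ihc A hc.1
    obtain ⟨q, hq⟩ := ihd A hc.2
    refine ⟨p + q, fun n _ E D x hE => ?_⟩
    obtain ⟨x₁, e₁, h₁⟩ := hp n E D x hE
    obtain ⟨x₂, e₂, h₂⟩ := hq n E (c.eval E D) x₁ hE
    exact ⟨x₂, e₂.trans e₁, (h₁.seq h₂).mono (by simp)⟩
  | iter v c ih =>
    obtain ⟨p, hp⟩ := ih (insert v A) hc.2
    refine ⟨.X * (p + 6) + 2, fun n _ E D x hE => ?_⟩
    obtain ⟨x', D', h, e₁, e₂⟩ := Run.forLoop (Γ₀ := Γ₀) (v := v) (c := c.prog)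
      (e := fun v => (E v : ℕ)) (T := p.eval n) (n := n)
      (fun i x' D' => x'.cat = x.cat ∧
        D' = iterFor (fun i D => c.eval (update E v (Fin.ofNat n i)) D) i D)
      (fun i x' D' o h => h)
      (by
        rintro i hi x' D' ⟨e₁, rfl⟩
        have e₃ : Fin.ofNat n i = ⟨i, hi⟩ := Fin.ext (Nat.mod_eq_of_lt hi)
        rw [BExp.update_val E v ⟨i, hi⟩]
        obtain ⟨x'', e₂, h⟩ := hp n (update E v ⟨i, hi⟩)
          (iterFor (fun i D => c.eval (update E v (Fin.ofNat n i)) D) i D) x' (fun v' hv' => by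
            rw [Set.mem_insert_iff, not_or] at hv'
            rw [update_of_ne hv'.1, hE v' hv'.2])
        exact ⟨x'', _, h, e₂.trans e₁, by rw [iterFor, e₃]⟩)
      (by simp [hE v hc.1]) x D ⟨rfl, rfl⟩
    subst e₂
    exact ⟨x', e₁, h.mono (by simp)⟩

end Cmd

theorem Polynomial.eval_le_eval_of_le (p : Polynomial ℕ) {a b : ℕ} (h : a ≤ b) :
    p.eval a ≤ p.eval b := by
  rw [Polynomial.eval_eq_sum, Polynomial.eval_eq_sum]
  exact Finset.sum_le_sum fun i _ => Nat.mul_le_mul_left _ (Nat.pow_le_pow_left h i)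

/-! ### Reading the input and initializing the stacks -/

namespace BitProg

open StackProg

section generic

variable {Γ₀ N : Type} [DecidableEq N]

/-- Push the bit `b` on all stacks in a list. -/
def putAll (b : Bool) (ks : List N) : BitProg Γ₀ N :=
  ks.foldr (fun k c => .seq (put k fun _ => b) c) skip

/-- The stacks after pushing `b` on all stacks in `ks`. -/
def pushOn (b : Bool) (ks : List N) (S : N → List Bool) (k : N) : List Bool :=
  if k ∈ ks then b :: S k else S k

theorem Run.putAll {b : Bool} {ks : List N} (hks : ks.Nodup) (x : Ctl) (S : N → List Bool) :
    Run (BitProg.putAll b ks : BitProg Γ₀ N) x S (ks.length + 1) x (pushOn b ks S) := by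
  induction ks generalizing S with
  | nil =>
    have e : pushOn b [] S = S := by
      funext k
      simp [pushOn]
    rw [e]
    exact Run.skip.mono (by simp)
  | cons k ks ih =>
    rw [List.nodup_cons] at hks
    have h := (Run.put (Γ₀ := Γ₀) (k := k) (f := fun _ => b)).seq (ih hks.2 (update S k (b :: S k)))
    convert h.mono (t' := (k :: ks).length + 1) (by simp; omega) using 1
    · rfl
    · funext k'
      by_cases hk : k' = k
      · subst hk; simp [pushOn, hks.1]
      · simp [pushOn, hk]

theorem pushOn_update {b : Bool} {ks : List N} {k : N} (hk : k ∉ ks) (S : N → List Bool)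
    (l : List Bool) : pushOn b ks (update S k l) = update (pushOn b ks S) k l := by
  funext k'
  by_cases h : k' = k
  · subst h; simp [pushOn, hk]
  · simp [pushOn, h]

theorem pushOn_iterate {b : Bool} {ks : List N} (m : ℕ) (S : N → List Bool) (k : N) :
    (pushOn b ks)^[m] S k = if k ∈ ks then List.replicate m b ++ S k else S k := by
  induction m generalizing S with
  | zero => simp
  | succ m ih =>
    rw [iterate_succ_apply, ih]
    split_ifs with h
    · rw [pushOn, if_pos h, List.append_cons, ← List.replicate_succ']
    · rw [pushOn, if_neg h]

theorem Run.each_skip {k : N} (x : Ctl) (l : List Bool) (S : N → List Bool) (hl : S k = l) :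
    Run (BitProg.each k BitProg.skip : BitProg Γ₀ N) x S (l.length * 2 + 1)
      { x with top := none } (update S k []) := by
  induction l generalizing x S with
  | nil =>
    have e : update S k [] = S := by rw [← hl, update_eq_self]
    rw [e]
    exact (Run.each_nil hl).mono (by simp)
  | cons a l ih =>
    have h := Run.each_cons (Γ₀ := Γ₀) (x := x) hl Run.skip (ih _ _ (by simp))
    rw [update_idem] at h
    exact h.mono (by simp; omega)

/-- Empty all stacks in a list. -/
def clear (ks : List N) : BitProg Γ₀ N := ks.foldr (fun k c => .seq (each k skip) c) skip

theorem Run.clear (ks : List N) (x : Ctl) (S : N → List Bool) :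
    ∃ o, Run (BitProg.clear ks : BitProg Γ₀ N) x S
      ((ks.map fun k => (S k).length * 2 + 1).sum + 1) { x with top := o }
      (fun k => if k ∈ ks then [] else S k) := by
  induction ks generalizing x S with
  | nil => exact ⟨x.top, by simpa [BitProg.clear] using Run.skip⟩
  | cons k ks ih =>
    obtain ⟨o, h⟩ := ih { x with top := none } (update S k [])
    refine ⟨o, ?_⟩
    have h₂ := (Run.each_skip (Γ₀ := Γ₀) x _ S (k := k) rfl).seq h
    convert h₂.mono (t' := ((k :: ks).map fun k => (S k).length * 2 + 1).sum + 1) ?_ using 1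
    · rfl
    · funext k'
      by_cases hk : k' = k
      · subst hk; simp
      · simp [hk]
    · have : (ks.map fun k' => (update S k [] k').length * 2 + 1).sum ≤
          (ks.map fun k' => (S k').length * 2 + 1).sum := by
        refine List.sum_le_sum fun k' _ => ?_
        by_cases hk : k' = k
        · subst hk; simp
        · simp [hk]
      rw [List.map_cons, List.sum_cons]
      omega

/-- Classify the input: the word goes to the stack `k` in reverse order, the rest of the input is
recorded in `cat`. -/
def readInput (cls : Γ₀ → Bool ⊕ Bool) (next : Fin 3 → Bool → Fin 3) (k : N) : BitProg Γ₀ N :=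
  .loop none
    (fun x o =>
      match o.map cls with
      | none => { x with res := false }
      | some (.inl b) => { x with res := true, top := some b }
      | some (.inr b) => { res := true, top := none, cat := next x.cat b })
    Ctl.res (.ite (fun x => x.top.isSome) (put k fun x => x.top.getD false) skip)

/-- The word in an input. -/
def inputWord (cls : Γ₀ → Bool ⊕ Bool) (w : List Γ₀) : List Bool :=
  w.filterMap fun g => (cls g).getLeft?

/-- The value of `cat` after reading an input. -/
def inputCat (cls : Γ₀ → Bool ⊕ Bool) (next : Fin 3 → Bool → Fin 3) (w : List Γ₀) (c : Fin 3) :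
    Fin 3 :=
  w.foldl (fun c g => (cls g).elim (fun _ => c) (next c)) c

/-- The word is copied to a stack, while the remaining symbols only drive a three-state automaton
kept in `cat`. The copy is reversed and has to be moved once more before use. -/
theorem exec_readInput (cls : Γ₀ → Bool ⊕ Bool) (next : Fin 3 → Bool → Fin 3) (k : N)
    (w : List Γ₀) (x : Ctl) (S : N → List Bool) :
    ∃ x', x'.cat = inputCat cls next w x.cat ∧
      Exec (readInput cls next k) x (withRaw w S) (w.length * 3 + 1) x'
        (withRaw [] (update S k ((inputWord cls w).reverse ++ S k))) := by
  induction w generalizing x S with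
  | nil =>
    refine ⟨{ x with res := false }, rfl, ?_⟩
    simp only [inputWord, List.filterMap_nil, List.reverse_nil, List.nil_append, update_eq_self]
    have h : Exec (readInput cls next k) x (withRaw [] S) 1 _ _ := Exec.loop_exit rfl le_rfl
    have e : update (withRaw (Γ₀ := Γ₀) [] S) none [] = withRaw [] S := update_withRaw_none _ _ _
    change Exec (readInput cls next k) x (withRaw [] S) 1 { x with res := false }
      (update (withRaw [] S) none []) at h
    rw [e] at h
    simpa using h
  | cons g w ih =>
    have e : update (withRaw (g :: w) S) none w = withRaw w S := update_withRaw_none _ _ _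
    rcases hg : cls g with b | b
    · obtain ⟨x', hx', h⟩ := ih { x with res := true, top := some b } (update S k (b :: S k))
      refine ⟨x', ?_, ?_⟩
      · rw [hx', inputCat, inputCat, List.foldl_cons, hg]
        rfl
      · refine Exec.loop_step (t₁ := 2) (x' := { x with res := true, top := some b })
          (S' := withRaw w (update S k (b :: S k))) ?_ ?_ ?_ (t₂ := w.length * 3 + 1)
          (by simp; omega)
        · simp [withRaw, hg]
        · simp only [withRaw, List.head?_cons, Option.map_some, hg, List.tail_cons]
          erw [e]
          exact Run.ite_true (p := fun x => x.top.isSome) rfl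
            (Run.put (k := k) (f := fun x => x.top.getD false)) w
        · simpa [inputWord, hg, readInput] using h
    · obtain ⟨x', hx', h⟩ := ih { res := true, top := none, cat := next x.cat b } S
      refine ⟨x', ?_, ?_⟩
      · rw [hx', inputCat, inputCat, List.foldl_cons, hg]
        rfl
      · refine Exec.loop_step (t₁ := 2) (x' := { res := true, top := none, cat := next x.cat b })
          (S' := withRaw w S) ?_ ?_ ?_ (t₂ := w.length * 3 + 1) (by simp; omega)
        · simp [withRaw, hg]
        · simp only [withRaw, List.head?_cons, Option.map_some, hg, List.tail_cons]
          erw [e]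
          exact Run.ite_false (p := fun x => x.top.isSome) rfl Run.skip w
        · simpa [inputWord, hg, readInput] using h

end generic

variable {Γ₀ V J : Type} {r : ℕ} [DecidableEq V] [DecidableEq J]

/-- Count the leading `true`s of the input stream and remove the symbol after them. -/
def count (ks : List (StackName V J r)) : BitProg Γ₀ (StackName V J r) :=
  .loop (some .inp) (fun x o => { x with top := o }) (fun x => x.top == some true) (putAll true ks)

/-- The loop also consumes the first symbol that is not `true` and leaves it in `top`, where the
caller can distinguish the end marker from the end of the word. -/
theorem Run.count {ks : List (StackName V J r)} (hks : ks.Nodup) (hinp : .inp ∉ ks)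
    (rest : List Bool) (hr : rest.head? ≠ some true) (m : ℕ) (x : Ctl)
    (S : StackName V J r → List Bool) (hS : S .inp = List.replicate m true ++ rest) :
    Run (count ks : BitProg Γ₀ (StackName V J r)) x S (m * (ks.length + 2) + 1)
      { x with top := rest.head? } ((pushOn true ks)^[m] (update S .inp rest.tail)) := by
  induction m generalizing x S with
  | zero =>
    intro w
    have h : (withRaw w S (some .inp) : List Bool) = rest := hS
    have h₂ := Exec.loop_exit (Γ := RawAlphabet Γ₀ (N := StackName V J r)) (k := some .inp)
      (f := fun x o => { x with top := o }) (p := fun x => x.top == some true)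
      (c := BitProg.putAll true ks) (x := x) (S := withRaw w S) (t := 1)
      (by simpa [h] using hr) le_rfl
    rw [h] at h₂
    have h₃ := update_withRaw w S .inp rest.tail
    simp only [iterate_zero, id, ← h₃]
    exact h₂.mono (by simp)
  | succ m ih =>
    intro w
    have h : (withRaw w S (some .inp) : List Bool) = true :: (List.replicate m true ++ rest) := by
      rw [← List.cons_append, ← List.replicate_succ]
      exact hS
    have h₂ := ih { x with top := some true }
      (pushOn true ks (update S .inp (List.replicate m true ++ rest))) (by simp [pushOn, hinp]) w
    rw [← pushOn_update hinp, update_idem, ← iterate_succ_apply] at h₂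
    have h₃ := update_withRaw w S .inp (List.replicate m true ++ rest)
    refine Exec.loop_step (t₁ := ks.length + 1) ?_ ?_ h₂ (by linarith)
    · simp [h]
    · rw [h]
      erw [h₃]
      exact Run.putAll hks _ _ w

/-- The name of the stack for the `i`-th power of `n`. -/
def powName (i : ℕ) : StackName V J r := .pow (Fin.ofNat (r + 1) i)

/-- Compute the powers of `n` up to the `i`-th one. -/
def powers : ℕ → BitProg Γ₀ (StackName V J r)
  | 0 => put (powName 0) fun _ => true
  | i + 1 => .seq (powers i) (rep .cnt .tmp (rep (powName i) .tmp' (putAll true [powName (i + 1)])))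

/-- The stacks after computing the powers of `n` below the `i`-th one. -/
def powStacks (n : ℕ) (y : List Bool) (i : ℕ) : StackName V J r → List Bool
  | .inp => y
  | .cnt => List.replicate n true
  | .hi _ => List.replicate n true
  | .pow i' => if (i' : ℕ) < i then List.replicate (n ^ (i' : ℕ)) true else []
  | _ => []

/-- The next power is obtained by pushing one symbol `n ^ i` times, `n` times over. A single push
through `putAll` takes 2 steps and a repetition adds 4 per round, whence the factor 6. -/
theorem Run.powers {n : ℕ} (hn : 0 < n) (y : List Bool) (i : ℕ) (hi : i ≤ r) (x : Ctl) :
    ∃ o, Run (powers i : BitProg Γ₀ (StackName V J r)) x (powStacks n y 0)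
      (i * (n * (n ^ r * 6 + 6) + 2) + 1) { x with top := o } (powStacks n y (i + 1)) := by
  induction i with
  | zero =>
    refine ⟨x.top, ?_⟩
    have h := Run.put (Γ₀ := Γ₀) (k := (powName 0 : StackName V J r)) (f := fun _ => true) (x := x)
      (S := powStacks n y 0)
    convert h.mono (t' := 0 * (n * (n ^ r * 6 + 6) + 2) + 1) (by simp) using 1
    · rfl
    · funext k
      cases k with
      | pow i' =>
        by_cases hi' : i' = 0
        · subst hi'
          simp [powStacks, powName]
        · simp [powStacks, powName, hi']
      | _ => simp [powStacks, powName]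
  | succ i ih =>
    obtain ⟨o, h⟩ := ih (by omega)
    have hval : ∀ i ≤ r, ((Fin.ofNat (r + 1) i : Fin (r + 1)) : ℕ) = i := fun i hi =>
      Nat.mod_eq_of_lt (by omega)
    have hne : (powName i : StackName V J r) ≠ powName (i + 1) := by
      simp only [powName, ne_eq, StackName.pow.injEq, Fin.ext_iff, hval i (by omega),
        hval (i + 1) hi]
      omega
    have hpi : powStacks n y (i + 1) (powName i : StackName V J r) =
        List.replicate (n ^ i) true := by
      simp only [powName, powStacks, hval i (by omega), Nat.lt_succ_self, if_true]
    have h₁ := Run.rep (Γ₀ := Γ₀) (T := n ^ i * 6 + 2)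
      (c := BitProg.rep (powName i) .tmp' (BitProg.putAll true [powName (i + 1)]))
      (k := (.cnt : StackName V J r)) (t := .tmp)
      (I := fun S => S (powName i) = List.replicate (n ^ i) true ∧ S .tmp' = [])
      (G := (pushOn true [powName (i + 1)])^[n ^ i]) (by simp)
      (fun x S hS => Run.rep (Γ₀ := Γ₀) (T := 2) (I := fun _ => True)
        (G := pushOn true [powName (i + 1)]) (by simp [powName])
        (fun x S _ => ⟨x.top, Run.putAll (by simp) x S⟩)
        (fun _ _ _ => trivial) (fun _ _ _ => trivial) (fun _ _ => trivial)
        (fun S l => pushOn_update (by simpa using hne) _ _)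
        (fun S l => pushOn_update (by simp [powName]) _ _) (n ^ i) x S trivial hS.1 hS.2)
      (fun S l hS => by simpa [powName] using hS) (fun S l hS => by simpa [powName] using hS)
      (fun S hS => by simpa [pushOn_iterate, hne] using ⟨hS.1, by simpa [powName] using hS.2⟩)
      (fun S l => by
        funext k
        by_cases hk : k = .cnt
        · subst hk; simp [pushOn_iterate, powName]
        · simp [pushOn_iterate, hk])
      (fun S l => by
        funext k
        by_cases hk : k = .tmp
        · subst hk; simp [pushOn_iterate, powName]
        · simp [pushOn_iterate, hk])
      n { x with top := o } (powStacks n y (i + 1)) ⟨hpi, rfl⟩ rfl rfl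
    obtain ⟨o', h₁⟩ := h₁
    refine ⟨o', ?_⟩
    convert (h.seq h₁).mono (t' := (i + 1) * (n * (n ^ r * 6 + 6) + 2) + 1) ?_ using 1
    · rfl
    · rw [← iterate_mul]
      funext k
      rw [pushOn_iterate]
      cases k with
      | pow i' =>
        by_cases hi' : i' = Fin.ofNat (r + 1) (i + 1)
        · subst hi'
          have h₂ := hval (i + 1) hi
          simp only [powStacks, powName, List.mem_singleton, if_true, h₂]
          simp [pow_succ]
        · have h₂ : (i' : ℕ) ≠ i + 1 := fun h => hi' (Fin.ext (h.trans (hval (i + 1) hi).symm))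
          have h₃ : (i' : ℕ) < i + 1 + 1 ↔ (i' : ℕ) < i + 1 := by omega
          simp only [powStacks, powName, List.mem_singleton, StackName.pow.injEq, hi', if_false, h₃]
      | _ => simp [powStacks, powName]
    · have h₃ : n ^ i ≤ n ^ r := Nat.pow_le_pow_right hn (by omega)
      have h₄ : n * (n ^ i * 6 + 2 + 4) ≤ n * (n ^ r * 6 + 6) := Nat.mul_le_mul_left _ (by omega)
      rw [Nat.succ_mul]
      omega

end BitProg

/-! ### The complete decision program and its machine -/

namespace BitProg

open StackProg

variable {Γ₀ V J : Type} {r : ℕ} [DecidableEq V] [DecidableEq J] [Fintype V] [Fintype J]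

/-- The stacks that hold the size of the universe while the input is read. -/
noncomputable def sizeStacks (V J : Type) (r : ℕ) [Fintype V] : List (StackName V J r) :=
  .cnt :: (Finset.univ.toList : List V).map .hi

/-- The stacks of the arrays. -/
noncomputable def arrStacks (V J : Type) (r : ℕ) [Fintype J] : List (StackName V J r) :=
  (Finset.univ.toList : List J).map .arr

omit [DecidableEq V] [DecidableEq J] [Fintype J] in
theorem nodup_sizeStacks : (sizeStacks V J r).Nodup := by
  rw [sizeStacks, List.nodup_cons]
  refine ⟨by simp, (Finset.nodup_toList _).map fun a b h => ?_⟩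
  simpa using h

omit [DecidableEq V] [DecidableEq J] [Fintype V] in
theorem nodup_arrStacks : (arrStacks V J r).Nodup :=
  (Finset.nodup_toList _).map fun a b h => by simpa using h

/-- Set up the store, execute `c` and evaluate the expression selected by `cat`. -/
noncomputable def mainProg (c : Cmd V J r) (e : Fin 3 → BExp V J r) :
    BitProg Γ₀ (StackName V J r) :=
  .seq (powers r) (.seq (rep (powName r) .tmp (putAll false (arrStacks V J r)))
    (.seq c.prog (.ite (fun x => x.cat == 0) (e 0).prog
      (.ite (fun x => x.cat == 1) (e 1).prog (e 2).prog))))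

omit [Fintype V] in
theorem Run.mainProg (c : Cmd V J r) (hc : c.Fresh ∅) (e : Fin 3 → BExp V J r)
    (he : ∀ i, (e i).Fresh ∅) :
    ∃ p : Polynomial ℕ, ∀ (n : ℕ) [NeZero n] (y : List Bool) (x : Ctl),
      ∃ x' S', x'.res = (e x.cat).eval (fun _ => (0 : Fin n))
          (c.eval (fun _ => 0) ⟨fun _ _ => false, y⟩) ∧
        Run (BitProg.mainProg c e : BitProg Γ₀ (StackName V J r)) x (powStacks n y 0)
          (p.eval n) x' S' := by
  obtain ⟨p, hp⟩ := c.run_prog (Γ₀ := Γ₀) ∅ hc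
  choose q hq using fun i => (e i).run_prog (Γ₀ := Γ₀) ∅ (he i)
  -- The times of all three final expressions are added, so that one bound serves for every value of
  -- `cat`.
  refine ⟨(.C r * (.X * (.X ^ r * 6 + 6) + 2) + 1) + (.X ^ r * .C (Fintype.card J + 1 + 4) + 2) +
    p + q 0 + q 1 + q 2 + 2, fun n _ y x => ?_⟩
  have hr : ((Fin.ofNat (r + 1) r : Fin (r + 1)) : ℕ) = r := Nat.mod_eq_of_lt (Nat.lt_succ_self r)
  have hlen : (arrStacks V J r).length = Fintype.card J := by
    simp [arrStacks]
  obtain ⟨o, h₁⟩ := Run.powers (Γ₀ := Γ₀) (V := V) (J := J) (Nat.pos_of_neZero n) y r le_rfl x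
  obtain ⟨o', h₂⟩ := Run.rep (Γ₀ := Γ₀) (T := Fintype.card J + 1) (I := fun _ => True)
    (k := (powName r : StackName V J r)) (t := .tmp) (G := pushOn false (arrStacks V J r))
    (by simp [powName])
    (fun x S _ => ⟨x.top, by simpa [hlen] using Run.putAll nodup_arrStacks x S⟩)
    (fun _ _ _ => trivial) (fun _ _ _ => trivial) (fun _ _ => trivial)
    (fun S l => pushOn_update (by simp [powName, arrStacks]) _ _)
    (fun S l => pushOn_update (by simp [arrStacks]) _ _) (n ^ r) { x with top := o }
    (powStacks n y (r + 1)) trivial (by simp only [powName, powStacks, hr]; simp) rfl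
  -- Filling each array with `n ^ r` entries `false` completes the representation of a store. The
  -- `hi` stacks were already filled while counting, so all index variables have the value `0`.
  have hS : (pushOn false (arrStacks V J r))^[n ^ r] (powStacks n y (r + 1)) =
      (⟨fun _ _ => false, y⟩ : Store J r n).toStacks fun _ => ((0 : Fin n) : ℕ) := by
    funext k
    rw [pushOn_iterate]
    cases k with
    | arr j => simp [arrStacks, powStacks, Store.toStacks, Store.entries, List.ofFn_const]
    | pow i => simp [arrStacks, powStacks, Store.toStacks, i.2]
    | _ => simp [arrStacks, powStacks, Store.toStacks]
  rw [hS] at h₂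
  obtain ⟨x₃, hx₃, h₃⟩ := hp n (fun _ => 0) ⟨fun _ _ => false, y⟩ { x with top := o' } (by simp)
  set D := c.eval (fun _ => (0 : Fin n)) ⟨fun _ _ => false, y⟩
  have hcat : x₃.cat = x.cat := hx₃
  have h₄ : ∀ i, x.cat = i → ∃ x' S', x'.res = (e x.cat).eval (fun _ => (0 : Fin n)) D ∧
      Run ((e i).prog : BitProg Γ₀ (StackName V J r)) x₃ (D.toStacks fun _ => ((0 : Fin n) : ℕ))
        ((q i).eval n) x' S' := by
    rintro i rfl
    obtain ⟨o, h⟩ := hq x.cat n (fun _ => 0) D x₃ (by simp)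
    exact ⟨_, _, rfl, h⟩
  have h₅ : ∃ x' S', x'.res = (e x.cat).eval (fun _ => (0 : Fin n)) D ∧
      Run (.ite (fun x => x.cat == 0) (e 0).prog
        (.ite (fun x => x.cat == 1) (e 1).prog (e 2).prog) : BitProg Γ₀ (StackName V J r)) x₃
        (D.toStacks fun _ => ((0 : Fin n) : ℕ))
        ((q 0).eval n + (q 1).eval n + (q 2).eval n + 2) x' S' := by
    rcases hx : x.cat with ⟨i, hi⟩
    interval_cases i
    · obtain ⟨x', S', h, h'⟩ := h₄ 0 hx
      rw [hx] at h
      exact ⟨x', S', h, (Run.ite_true (by simp [hcat, hx]) h').mono (by omega)⟩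
    · obtain ⟨x', S', h, h'⟩ := h₄ 1 hx
      rw [hx] at h
      exact ⟨x', S', h, (Run.ite_false (by simp [hcat, hx])
        (Run.ite_true (by simp [hcat, hx]) h')).mono (by omega)⟩
    · obtain ⟨x', S', h, h'⟩ := h₄ 2 hx
      rw [hx] at h
      exact ⟨x', S', h, (Run.ite_false (by simp [hcat, hx])
        (Run.ite_false (by simp [hcat, hx]) h')).mono (by omega)⟩
  obtain ⟨x', S', h, h'⟩ := h₅
  refine ⟨x', S', h, (h₁.seq (h₂.seq (h₃.seq h'))).mono ?_⟩
  simp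
  omega

/-- Read the input, run the main program if the input starts with `1 … 1 0` and reject otherwise. -/
noncomputable def decideProg (cls : Γ₀ → Bool ⊕ Bool) (next : Fin 3 → Bool → Fin 3)
    (c : Cmd V J r) (e : Fin 3 → BExp V J r) : BitProg Γ₀ (StackName V J r) :=
  .seq (readInput cls next .tmp) (.seq (moveAll .tmp .inp) (.seq (count (sizeStacks V J r))
    (.ite (fun x => x.top == some false)
      (.seq (take .cnt) (.ite (fun x => x.top.isSome)
        (.seq (put .cnt fun _ => true) (mainProg c e))
        (.load fun x => { x with res := false })))
      (.load fun x => { x with res := false }))))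

theorem exists_replicate_append (x : List Bool) :
    ∃ m rest, x = List.replicate m true ++ rest ∧ rest.head? ≠ some true := by
  induction x with
  | nil => exact ⟨0, [], by simp⟩
  | cons b x ih =>
    obtain ⟨m, rest, h, h'⟩ := ih
    cases b with
    | false => exact ⟨0, false :: x, by simp⟩
    | true => exact ⟨m + 1, rest, by rw [h, List.replicate_succ, List.cons_append], h'⟩

/-- The two hypotheses on `b` cover all inputs: a word of the form `1 … 1 0 y` with at least one `1`
is answered by the program, every other word is rejected. In the first case `n` is at most the input
length, which turns bounds in `n` into bounds in the length. -/
theorem exec_decideProg (cls : Γ₀ → Bool ⊕ Bool) (next : Fin 3 → Bool → Fin 3) (c : Cmd V J r)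
    (hc : c.Fresh ∅) (e : Fin 3 → BExp V J r) (he : ∀ i, (e i).Fresh ∅) :
    ∃ p : Polynomial ℕ, ∀ (w : List Γ₀) (b : Bool),
      (∀ (n : ℕ) [NeZero n] (y : List Bool),
        inputWord cls w = List.replicate n true ++ false :: y →
        b = (e (inputCat cls next w 0)).eval (fun _ => (0 : Fin n))
          (c.eval (fun _ => 0) ⟨fun _ _ => false, y⟩)) →
      ((¬∃ n y, 0 < n ∧ inputWord cls w = List.replicate n true ++ false :: y) → b = false) →
      ∃ x' S', x'.res = b ∧ Exec (decideProg cls next c e) ⟨false, none, 0⟩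
        (withRaw w fun _ => []) (p.eval w.length) x' (withRaw [] S') := by
  obtain ⟨p, hp⟩ := Run.mainProg (Γ₀ := Γ₀) c hc e he
  refine ⟨.X * .C (3 + 2 + ((sizeStacks V J r).length + 2)) + p + 20, fun w b hb hb' => ?_⟩
  have hlen : (inputWord cls w).length ≤ w.length := List.length_filterMap_le _ _
  obtain ⟨x₁, hx₁, h₁⟩ := exec_readInput cls next (.tmp : StackName V J r) w ⟨false, none, 0⟩
    fun _ => []
  obtain ⟨m, rest, hw, hrest⟩ := exists_replicate_append (inputWord cls w)
  have hm : m ≤ w.length := by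
    have := congrArg List.length hw
    simp at this
    omega
  have h₂ := Run.moveAll (Γ₀ := Γ₀) (a := (.tmp : StackName V J r)) (b := .inp) (by simp) x₁
    (inputWord cls w).reverse (update (fun _ => []) .tmp ((inputWord cls w).reverse ++ []))
    (by simp)
  set S₂ : StackName V J r → List Bool := update (update
    (update (fun _ => []) .tmp ((inputWord cls w).reverse ++ [])) .tmp []) .inp
      ((inputWord cls w).reverse.reverse ++ (update (fun _ : StackName V J r => ([] : List Bool))
        .tmp ((inputWord cls w).reverse ++ [])) .inp) with hS₂
  have h₃ := Run.count (Γ₀ := Γ₀) (ks := sizeStacks V J r) nodup_sizeStacks (by simp [sizeStacks])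
    rest hrest m { x₁ with top := none } S₂ (by simp [S₂, hw])
  set S₃ : StackName V J r → List Bool :=
    (pushOn true (sizeStacks V J r))^[m] (update S₂ .inp rest.tail) with hS₃
  have hS₃' : S₃ = powStacks m rest.tail 0 := by
    funext k
    rw [hS₃, pushOn_iterate]
    cases k <;> simp [sizeStacks, powStacks, S₂]
  suffices h : ∃ x' S', x'.res = b ∧ Run
      (.ite (fun x => x.top == some false)
        (.seq (BitProg.take .cnt) (.ite (fun x => x.top.isSome)
          (.seq (BitProg.put .cnt fun _ => true) (BitProg.mainProg c e))
          (.load fun x => { x with res := false })))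
        (.load fun x => { x with res := false }) : BitProg Γ₀ (StackName V J r))
      { x₁ with top := rest.head? } S₃ (p.eval m + 10) x' S' by
    obtain ⟨x', S', hres, h₄⟩ := h
    refine ⟨x', S', hres, ?_⟩
    refine (Exec.seq h₁ ((h₂.seq (h₃.seq h₄)) []) le_rfl).mono ?_
    have h₅ := p.eval_le_eval_of_le hm
    have h₆ : m * ((sizeStacks V J r).length + 2) ≤ w.length * ((sizeStacks V J r).length + 2) :=
      Nat.mul_le_mul_right _ hm
    simp only [Polynomial.eval_add, Polynomial.eval_mul, Polynomial.eval_X, Polynomial.eval_C,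
      Polynomial.eval_ofNat, List.length_reverse]
    rw [Nat.mul_add w.length (3 + 2)]
    omega
  -- The word has the required form exactly if a `false` follows the leading `true`s and `m` is
  -- positive. In the remaining cases `hb'` gives `b = false`.
  by_cases hf : rest.head? = some false
  · obtain ⟨y, rfl⟩ : ∃ y, rest = false :: y := by
      cases rest with
      | nil => simp at hf
      | cons a y => exact ⟨y, by simpa using hf⟩
    rcases Nat.eq_zero_or_pos m with rfl | hmpos
    · have hb₀ : b = false := by
        refine hb' ?_
        rintro ⟨n, y', hn, hw'⟩
        rw [hw] at hw'
        obtain ⟨n', rfl⟩ := Nat.exists_eq_succ_of_ne_zero hn.ne'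
        simp [List.replicate_succ] at hw'
      have h₄ := Run.take (Γ₀ := Γ₀) (k := (.cnt : StackName V J r))
        (x := { x₁ with top := (false :: y).head? }) (S := S₃)
      have hcnt : S₃ .cnt = [] := by rw [hS₃']; rfl
      rw [hcnt] at h₄
      exact ⟨_, _, hb₀.symm, (Run.ite_true (by simp) (h₄.seq (Run.ite_false (by simp)
        (Run.load (f := fun x => { x with res := false }))))).mono (by omega)⟩
    · have : NeZero m := ⟨hmpos.ne'⟩
      have h₄ := Run.take (Γ₀ := Γ₀) (k := (.cnt : StackName V J r))
        (x := { x₁ with top := (false :: y).head? }) (S := S₃)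
      obtain ⟨m', hm'⟩ := Nat.exists_eq_succ_of_ne_zero hmpos.ne'
      have hcnt : S₃ .cnt = true :: List.replicate m' true := by
        rw [hS₃', ← List.replicate_succ, ← Nat.succ_eq_add_one, ← hm']; rfl
      have h₅ := Run.put (Γ₀ := Γ₀) (k := (.cnt : StackName V J r)) (f := fun _ => true)
        (x := { x₁ with top := (S₃ .cnt).head? }) (S := update S₃ .cnt (S₃ .cnt).tail)
      have e₁ : update (update S₃ .cnt (S₃ .cnt).tail) .cnt
          (true :: update S₃ .cnt (S₃ .cnt).tail .cnt) = powStacks m y 0 := by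
        rw [update_self, update_idem, hcnt, List.tail_cons, ← hcnt, update_eq_self, hS₃']
        rfl
      rw [e₁] at h₅
      obtain ⟨x', S', hres, h₆⟩ := hp m y { x₁ with top := (S₃ .cnt).head? }
      refine ⟨x', S', ?_, (Run.ite_true (by simp) (h₄.seq (Run.ite_true (by simp [hcnt])
        (h₅.seq h₆)))).mono (by omega)⟩
      rw [hres, hb m y hw]
      simp only [hx₁]
  · have hb₀ : b = false := by
      refine hb' ?_
      rintro ⟨n, y, hn, hw'⟩
      rw [hw] at hw'
      rcases Nat.lt_trichotomy m n with h | h | h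
      · obtain ⟨d, rfl⟩ := Nat.exists_eq_add_of_lt h
        rw [Nat.add_assoc, List.replicate_add, List.append_assoc, List.append_cancel_left_eq,
          List.replicate_succ] at hw'
        exact hrest (by rw [hw']; rfl)
      · subst h
        rw [List.append_cancel_left_eq] at hw'
        exact hf (by rw [hw']; rfl)
      · obtain ⟨d, rfl⟩ := Nat.exists_eq_add_of_lt h
        rw [Nat.add_assoc, List.replicate_add, List.append_assoc, List.append_cancel_left_eq,
          List.replicate_succ] at hw'
        simp at hw'
    exact ⟨_, _, hb₀.symm, (Run.ite_false (by simpa using hf)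
      (Run.load (f := fun x => { x with res := false }))).mono (by omega)⟩

/-- Decide, empty all stacks, and output the result bit. -/
noncomputable def outputProg (cls : Γ₀ → Bool ⊕ Bool) (next : Fin 3 → Bool → Fin 3)
    (c : Cmd V J r) (e : Fin 3 → BExp V J r) (ks : List (StackName V J r)) :
    BitProg Γ₀ (StackName V J r) :=
  .seq (decideProg cls next c e) (.seq (clear ks)
    (.seq (put .tmp Ctl.res) (.load fun _ => ⟨false, none, 0⟩)))

/-- A halting configuration counts as an output only if all stacks other than the output stack are
empty and the control state is the initial one. The cleanup time is linear in the total stack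
height, which is at most the input length plus the time used so far. -/
theorem exec_outputProg [Fintype (StackName V J r)] (cls : Γ₀ → Bool ⊕ Bool)
    (next : Fin 3 → Bool → Fin 3) (c : Cmd V J r)
    (hc : c.Fresh ∅) (e : Fin 3 → BExp V J r) (he : ∀ i, (e i).Fresh ∅) :
    ∃ p : Polynomial ℕ, ∀ (w : List Γ₀) (b : Bool),
      (∀ (n : ℕ) [NeZero n] (y : List Bool),
        inputWord cls w = List.replicate n true ++ false :: y →
        b = (e (inputCat cls next w 0)).eval (fun _ => (0 : Fin n))
          (c.eval (fun _ => 0) ⟨fun _ _ => false, y⟩)) →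
      ((¬∃ n y, 0 < n ∧ inputWord cls w = List.replicate n true ++ false :: y) → b = false) →
      Exec (outputProg cls next c e Finset.univ.toList) ⟨false, none, 0⟩
        (withRaw w fun _ => []) (p.eval w.length) ⟨false, none, 0⟩
        (withRaw [] (update (fun _ => []) .tmp [b])) := by
  obtain ⟨p, hp⟩ := exec_decideProg cls next c hc e he
  refine ⟨p + 2 * (.X + p) + .C (Fintype.card (StackName V J r) + 4), fun w b hb hb' => ?_⟩
  obtain ⟨x', S', hres, h⟩ := hp w b hb hb'
  obtain ⟨o, h₂⟩ := Run.clear (Γ₀ := Γ₀) (Finset.univ.toList : List (StackName V J r)) x' S'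
  have h₃ := h₂.seq ((Run.put (k := (.tmp : StackName V J r)) (f := Ctl.res)).seq
    (Run.load (f := fun _ => ⟨false, none, 0⟩)))
  have hS : update (fun k => if k ∈ (Finset.univ.toList : List (StackName V J r)) then []
      else S' k) .tmp (x'.res :: if (.tmp : StackName V J r) ∈
        (Finset.univ.toList : List (StackName V J r)) then [] else S' .tmp) =
      update (fun _ => []) .tmp [b] := by
    simp [hres]
  have h₄ := Exec.seq h (h₃ []) le_rfl
  rw [outputProg, ← hS]
  refine h₄.mono ?_
  have hh := h.height_le
  have hs : ∀ (w : List Γ₀) (S : StackName V J r → List Bool), height (withRaw w S) =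
      w.length + ∑ k, (S k).length := fun w S => by
    rw [height, Fintype.sum_option]
    rfl
  rw [hs, hs] at hh
  rw [Finset.sum_map_toList, Finset.sum_add_distrib, ← Finset.sum_mul]
  simp at hh ⊢
  omega

end BitProg

open BitProg StackProg in
/-- Machines for programs: whether the word in the input is `1 … 1 0 y`, and the expression selected
by the rest of the input holds after the execution of `c` on the input stream `y`, is decided in
polynomial time. -/
theorem exists_machine {Γ₀ V J : Type} {r : ℕ} [Finite Γ₀] [DecidableEq V] [DecidableEq J]
    [Finite V] [Finite J] (cls : Γ₀ → Bool ⊕ Bool) (next : Fin 3 → Bool → Fin 3) (c : Cmd V J r)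
    (hc : c.Fresh ∅) (e : Fin 3 → BExp V J r) (he : ∀ i, (e i).Fresh ∅) :
    ∃ (M : Turing.TM2ComputableAux Γ₀ Bool) (p : Polynomial ℕ), ∀ (w : List Γ₀) (b : Bool),
      (∀ (n : ℕ) [NeZero n] (y : List Bool),
        inputWord cls w = List.replicate n true ++ false :: y →
        b = (e (inputCat cls next w 0)).eval (fun _ => (0 : Fin n))
          (c.eval (fun _ => 0) ⟨fun _ _ => false, y⟩)) →
      ((¬∃ n y, 0 < n ∧ inputWord cls w = List.replicate n true ++ false :: y) → b = false) →
      Nonempty (Turing.TM2OutputsInTime M.tm (w.map M.inputAlphabet.symm)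
        (some ([b].map M.outputAlphabet.symm)) (p.eval w.length)) := by
  have := Fintype.ofFinite V
  have := Fintype.ofFinite J
  have := Fintype.ofFinite Γ₀
  have := Fintype.ofFinite (StackName V J r)
  have := Fintype.ofFinite Ctl
  obtain ⟨p, hp⟩ := exec_outputProg cls next c hc e he
  set P := outputProg cls next c e Finset.univ.toList
  have := P.finite_label
  have := Fintype.ofFinite (Option (Label P))
  let M : Turing.FinTM2 :=
    { K := Option (StackName V J r), k₀ := none, k₁ := some .tmp,
      Γ := RawAlphabet Γ₀, Λ := Option (Label P), main := some P.entry, σ := Ctl,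
      initialState := ⟨false, none, 0⟩, m := P.machineCode,
      Γk₀Fin := (inferInstance : Fintype Γ₀) }
  refine ⟨⟨M, Equiv.refl _, Equiv.refl _⟩, p + 1, fun w b hb hb' => ?_⟩
  obtain ⟨m, hm, h⟩ := (hp w b hb hb').reachesIn_halt
  have e₁ : Turing.initList M (w.map (Equiv.refl Γ₀).symm) =
      ⟨some (some P.entry), ⟨false, none, 0⟩, withRaw w fun _ => []⟩ := by
    simp only [Turing.initList]
    refine congrArg (Turing.TM2.Cfg.mk _ _) ?_
    funext k
    cases k with
    | none => simp [withRaw, M]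
    | some k => simp [withRaw, M]
  have e₂ : Turing.haltList M ([b].map (Equiv.refl Bool).symm) =
      ⟨none, ⟨false, none, 0⟩, withRaw [] (update (fun _ => []) .tmp [b])⟩ := by
    simp only [Turing.haltList]
    refine congrArg (Turing.TM2.Cfg.mk _ _) ?_
    funext k
    cases k with
    | none => simp [withRaw, M]
    | some k =>
      by_cases hk : k = .tmp
      · subst hk; simp [withRaw, M]
      · simp [withRaw, M, hk]
  exact ⟨⟨⟨m, (congrArg _ (congrArg some e₁)).trans (h.trans (congrArg some e₂.symm))⟩,
    by simpa using hm⟩⟩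

/-! ### Team semantics: empty teams and locality -/

section semantics

variable {L : FirstOrder.Language.{u, v}} {A : Type w} (S : L.Structure A)

theorem supplement_empty (x : ℕ) (f : Assignment A → Set A) : supplement ∅ x f = ∅ := by
  simp [supplement]

/-- Atoms and literals are universal statements about the assignments of the team, and quantifiers
turn the empty team into itself. This settles weight `0`. -/
theorem sat_empty (φ : IncFormula L) : Sat S ∅ φ := by
  induction φ with
  | and φ ψ h₁ h₂ => exact ⟨h₁, h₂⟩
  | or φ ψ h₁ h₂ => exact ⟨∅, ∅, by simp, h₁, h₂⟩
  | ex x φ h => exact ⟨fun _ => Set.univ, by simp, by rwa [supplement_empty]⟩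
  | all x φ h =>
    rw [Sat, supplement_empty]
    exact h
  | _ => simp [Sat]

theorem termValue_congr {s s' : Assignment A} :
    ∀ t : L.Term ℕ, (∀ x ∈ t.varFinset, s x = s' x) → termValue S s t = termValue S s' t
  | .var x, h => by
    rw [termValue, termValue]
    exact h x (by simp [FirstOrder.Language.Term.varFinset])
  | .func f ts, h => by
    have ih : ∀ i, termValue S s (ts i) = termValue S s' (ts i) := fun i =>
      termValue_congr (ts i) fun x hx => h x (by
        rw [FirstOrder.Language.Term.varFinset, Finset.mem_biUnion]
        exact ⟨i, Finset.mem_univ _, hx⟩)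
    simp only [termValue, ih]

/-- Two teams have the same restrictions to `V`. -/
def Agree (V : Finset ℕ) (T T' : Set (Assignment A)) : Prop :=
  (∀ s ∈ T, ∃ s' ∈ T', ∀ x ∈ V, s x = s' x) ∧ ∀ s' ∈ T', ∃ s ∈ T, ∀ x ∈ V, s x = s' x

theorem Agree.supplement {V : Finset ℕ} {T T' : Set (Assignment A)} (h : Agree V T T') (x : ℕ)
    {f f' : Assignment A → Set A}
    (hf : ∀ s ∈ T, ∀ s' ∈ T', (∀ y ∈ V, s y = s' y) → f s ⊆ f' s')
    (hf' : ∀ s' ∈ T', ∀ a ∈ f' s', ∃ s ∈ T, (∀ y ∈ V, s y = s' y) ∧ a ∈ f s) :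
    Agree (insert x V) (supplement T x f) (supplement T' x f') := by
  have key : ∀ (s s' : Assignment A) (a : A), (∀ y ∈ V, s y = s' y) →
      ∀ y ∈ insert x V, s.modify x a y = s'.modify x a y := by
    intro s s' a hs y hy
    by_cases hxy : y = x
    · subst hxy; simp [Assignment.modify]
    · simp [Assignment.modify, hxy, hs y ((Finset.mem_insert.1 hy).resolve_left hxy)]
  constructor
  · rintro _ ⟨s, hs, a, ha, rfl⟩
    obtain ⟨s', hs', e⟩ := h.1 s hs
    exact ⟨_, ⟨s', hs', a, hf s hs s' hs' e ha, rfl⟩, key s s' a e⟩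
  · rintro _ ⟨s', hs', a, ha, rfl⟩
    obtain ⟨s, hs, e, ha'⟩ := hf' s' hs' a ha
    exact ⟨_, ⟨s, hs, a, ha', rfl⟩, key s s' a e⟩

/-- Locality, by induction on the formula with `V` growing at quantifiers. For a sentence it is
applied with `V = ∅`, where any two non-empty teams agree. -/
theorem Sat.of_agree (φ : IncFormula L) {V : Finset ℕ} {T T' : Set (Assignment A)}
    (hV : φ.freeVars ⊆ V) (h : Agree V T T') (hT : Sat S T φ) : Sat S T' φ := by
  induction φ generalizing V T T' with
  | eq t t' =>
    rw [IncFormula.freeVars, Finset.union_subset_iff] at hV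
    intro s' hs'
    obtain ⟨s, hs, e⟩ := h.2 s' hs'
    rw [← termValue_congr S t fun x hx => e x (hV.1 hx),
      ← termValue_congr S t' fun x hx => e x (hV.2 hx)]
    exact hT s hs
  | neq t t' =>
    rw [IncFormula.freeVars, Finset.union_subset_iff] at hV
    intro s' hs'
    obtain ⟨s, hs, e⟩ := h.2 s' hs'
    rw [← termValue_congr S t fun x hx => e x (hV.1 hx),
      ← termValue_congr S t' fun x hx => e x (hV.2 hx)]
    exact hT s hs
  | rel R ts =>
    rw [IncFormula.freeVars, Finset.biUnion_subset] at hV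
    intro s' hs'
    obtain ⟨s, hs, e⟩ := h.2 s' hs'
    obtain ⟨a, ha, hR⟩ := hT s hs
    refine ⟨a, fun i => ?_, hR⟩
    rw [← termValue_congr S (ts i) fun x hx => e x (hV i (Finset.mem_univ i) hx)]
    exact ha i
  | nrel R ts =>
    rw [IncFormula.freeVars, Finset.biUnion_subset] at hV
    intro s' hs'
    obtain ⟨s, hs, e⟩ := h.2 s' hs'
    obtain ⟨a, ha, hR⟩ := hT s hs
    refine ⟨a, fun i => ?_, hR⟩
    rw [← termValue_congr S (ts i) fun x hx => e x (hV i (Finset.mem_univ i) hx)]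
    exact ha i
  | incl ts us =>
    rw [IncFormula.freeVars, Finset.biUnion_subset] at hV
    intro s' hs'
    obtain ⟨s, hs, e⟩ := h.2 s' hs'
    obtain ⟨q, hq, hqs⟩ := hT s hs
    obtain ⟨q', hq', e'⟩ := h.1 q hq
    refine ⟨q', hq', fun i => ?_⟩
    have hVi := Finset.union_subset_iff.1 (hV i (Finset.mem_univ i))
    rw [← termValue_congr S (ts i) fun x hx => e x (hVi.1 hx),
      ← termValue_congr S (us i) fun x hx => e' x (hVi.2 hx)]
    exact hqs i
  | and φ ψ ih₁ ih₂ =>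
    rw [IncFormula.freeVars, Finset.union_subset_iff] at hV
    exact ⟨ih₁ hV.1 h hT.1, ih₂ hV.2 h hT.2⟩
  | or φ ψ ih₁ ih₂ =>
    rw [IncFormula.freeVars, Finset.union_subset_iff] at hV
    obtain ⟨T₀, T₁, rfl, h₀, h₁⟩ := hT
    -- The cover of `T` is transferred to `T'`: an assignment of `T'` goes to each part that
    -- contains an assignment with the same restriction.
    have key : ∀ T₂ ⊆ T₀ ∪ T₁,
        Agree V T₂ {s' | s' ∈ T' ∧ ∃ s ∈ T₂, ∀ x ∈ V, s x = s' x} := fun T₂ hT₂ => by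
      refine ⟨fun s hs => ?_, fun s' hs' => hs'.2⟩
      obtain ⟨s', hs', e⟩ := h.1 s (hT₂ hs)
      exact ⟨s', ⟨hs', s, hs, e⟩, e⟩
    refine ⟨_, _, ?_, ih₁ hV.1 (key T₀ Set.subset_union_left) h₀,
      ih₂ hV.2 (key T₁ Set.subset_union_right) h₁⟩
    ext s'
    constructor
    · rintro (hs' | hs')
      · exact hs'.1
      · exact hs'.1
    · intro hs'
      obtain ⟨s, hs | hs, e⟩ := h.2 s' hs'
      · exact .inl ⟨hs', s, hs, e⟩
      · exact .inr ⟨hs', s, hs, e⟩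
  | ex x φ ih =>
    obtain ⟨f, hf, hφ⟩ := hT
    -- Different assignments of `T` may have the same restriction as `s'`, so the choices at all of
    -- them are united. The lax semantics permits such sets of values.
    refine ⟨fun s' => {a | ∃ s ∈ T, (∀ y ∈ V, s y = s' y) ∧ a ∈ f s}, fun s' hs' => ?_,
      ih (V := insert x V) ?_ (h.supplement x (f := f) ?_ ?_) hφ⟩
    · obtain ⟨s, hs, e⟩ := h.2 s' hs'
      obtain ⟨a, ha⟩ := hf s hs
      exact ⟨a, s, hs, e, ha⟩
    · exact Finset.subset_insert_iff.2 hV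
    · exact fun s hs s' _ e a ha => ⟨s, hs, e, ha⟩
    · exact fun s' _ a ha => ha
  | all x φ ih =>
    refine ih (V := insert x V) ?_ (h.supplement x ?_ ?_) hT
    · exact Finset.subset_insert_iff.2 hV
    · exact fun s hs s' _ e => subset_rfl
    · intro s' hs' a ha
      obtain ⟨s, hs, e⟩ := h.2 s' hs'
      exact ⟨s, hs, e, ha⟩

end semantics

/-! ### Families of teams for subformulas -/

/-- The occurrences of subterms in a term. -/
def TermNode {L : FirstOrder.Language.{u, v}} : L.Term ℕ → Type
  | .var _ => Option Empty
  | .func _ ts => Option (Σ i, TermNode (ts i))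

/-- The term itself. -/
def TermNode.root {L : FirstOrder.Language.{u, v}} : ∀ t : L.Term ℕ, TermNode t
  | .var _ => (none : Option Empty)
  | .func _ ts => (none : Option (Σ i, TermNode (ts i)))

/-- The occurrences of subformulas in a formula and of subterms in its terms. -/
def Node {L : FirstOrder.Language.{u, v}} : IncFormula L → Type
  | .eq t t' => Option (TermNode t ⊕ TermNode t')
  | .neq t t' => Option (TermNode t ⊕ TermNode t')
  | .rel _ ts => Option (Σ i, TermNode (ts i))
  | .nrel _ ts => Option (Σ i, TermNode (ts i))
  | .incl ts us => Option ((Σ i, TermNode (ts i)) ⊕ (Σ i, TermNode (us i)))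
  | .and φ ψ => Option (Node φ ⊕ Node ψ)
  | .or φ ψ => Option (Node φ ⊕ Node ψ)
  | .ex _ φ => Option (Node φ)
  | .all _ φ => Option (Node φ)

/-- The formula itself. -/
def Node.root {L : FirstOrder.Language.{u, v}} : ∀ φ : IncFormula L, Node φ
  | .eq t t' => (none : Option (TermNode t ⊕ TermNode t'))
  | .neq t t' => (none : Option (TermNode t ⊕ TermNode t'))
  | .rel _ ts => (none : Option (Σ i, TermNode (ts i)))
  | .nrel _ ts => (none : Option (Σ i, TermNode (ts i)))
  | .incl ts us => (none : Option ((Σ i, TermNode (ts i)) ⊕ (Σ i, TermNode (us i))))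
  | .and φ ψ => (none : Option (Node φ ⊕ Node ψ))
  | .or φ ψ => (none : Option (Node φ ⊕ Node ψ))
  | .ex _ φ => (none : Option (Node φ))
  | .all _ φ => (none : Option (Node φ))

theorem finite_termNode {L : FirstOrder.Language.{u, v}} : ∀ t : L.Term ℕ, Finite (TermNode t)
  | .var _ => inferInstanceAs (Finite (Option Empty))
  | .func _ ts =>
    have := fun i => finite_termNode (ts i)
    inferInstanceAs (Finite (Option (Σ i, TermNode (ts i))))

theorem finite_node {L : FirstOrder.Language.{u, v}} : ∀ φ : IncFormula L, Finite (Node φ)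
  | .eq t t' | .neq t t' =>
    have := finite_termNode t
    have := finite_termNode t'
    inferInstanceAs (Finite (Option (TermNode t ⊕ TermNode t')))
  | .rel _ ts | .nrel _ ts =>
    have := fun i => finite_termNode (ts i)
    inferInstanceAs (Finite (Option (Σ i, TermNode (ts i))))
  | .incl ts us =>
    have := fun i => finite_termNode (ts i)
    have := fun i => finite_termNode (us i)
    inferInstanceAs (Finite (Option ((Σ i, TermNode (ts i)) ⊕ (Σ i, TermNode (us i)))))
  | .and φ ψ | .or φ ψ =>
    have := finite_node φ
    have := finite_node ψ
    inferInstanceAs (Finite (Option (Node φ ⊕ Node ψ)))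
  | .ex _ φ | .all _ φ =>
    have := finite_node φ
    inferInstanceAs (Finite (Option (Node φ)))

/-- All variables of a term and the arities of its function symbols are below `R`. -/
def TermBelow {L : FirstOrder.Language.{u, v}} (R : ℕ) : L.Term ℕ → Prop
  | .var x => x < R
  | .func (l := k) _ ts => k < R ∧ ∀ i, TermBelow R (ts i)

/-- All variables of a formula and the arities of its symbols are below `R`. -/
def IncFormula.Below {L : FirstOrder.Language.{u, v}} (R : ℕ) : IncFormula L → Prop
  | .eq t t' => TermBelow R t ∧ TermBelow R t'
  | .neq t t' => TermBelow R t ∧ TermBelow R t'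
  | .rel (k := k) _ ts => k < R ∧ ∀ i, TermBelow R (ts i)
  | .nrel (k := k) _ ts => k < R ∧ ∀ i, TermBelow R (ts i)
  | .incl ts us => ∀ i, TermBelow R (ts i) ∧ TermBelow R (us i)
  | .and φ ψ => φ.Below R ∧ ψ.Below R
  | .or φ ψ => φ.Below R ∧ ψ.Below R
  | .ex x φ => x < R ∧ φ.Below R
  | .all x φ => x < R ∧ φ.Below R

open Filter in
theorem eventually_termBelow {L : FirstOrder.Language.{u, v}} :
    ∀ t : L.Term ℕ, ∀ᶠ R in atTop, TermBelow R t
  | .var x => eventually_gt_atTop x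
  | .func (l := k) _ ts =>
    (eventually_gt_atTop k).and (eventually_all.2 fun i => eventually_termBelow (ts i))

open Filter in
theorem IncFormula.eventually_below {L : FirstOrder.Language.{u, v}} :
    ∀ φ : IncFormula L, ∀ᶠ R in atTop, φ.Below R
  | .eq t t' | .neq t t' => (eventually_termBelow t).and (eventually_termBelow t')
  | .rel (k := k) _ ts | .nrel (k := k) _ ts =>
    (eventually_gt_atTop k).and (eventually_all.2 fun i => eventually_termBelow (ts i))
  | .incl ts us =>
    eventually_all.2 fun i => (eventually_termBelow (ts i)).and (eventually_termBelow (us i))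
  | .and φ ψ | .or φ ψ => φ.eventually_below.and ψ.eventually_below
  | .ex x φ | .all x φ => (eventually_gt_atTop x).and φ.eventually_below

section families

variable {L : FirstOrder.Language.{u, v}} {A : Type w} {R : ℕ}

/-- The coordinate of a variable. -/
def coord (R x : ℕ) : Fin (R + 1) := Fin.ofNat (R + 1) x

/-- The last coordinate is reserved for the values of terms and belongs to no variable below `R`. -/
theorem coord_ne_last {x : ℕ} (hx : x < R) : coord R x ≠ Fin.last R := fun h => by
  have := congrArg Fin.val h
  simp only [coord, Fin.val_ofNat, Fin.val_last] at this
  rw [Nat.mod_eq_of_lt (by omega)] at this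
  omega

theorem coord_inj {x y : ℕ} (hx : x < R) (hy : y < R) (h : coord R x = coord R y) : x = y := by
  have := congrArg Fin.val h
  simp only [coord, Fin.val_ofNat] at this
  rwa [Nat.mod_eq_of_lt (by omega), Nat.mod_eq_of_lt (by omega)] at this

/-- The assignment of a tuple to the variables below `R`; the last entry of the tuple is ignored. -/
def tupleAssignment (s : Fin (R + 1) → A) : Assignment A := fun x =>
  if x < R then some (s (coord R x)) else none

theorem tupleAssignment_update (s : Fin (R + 1) → A) {x : ℕ} (hx : x < R) (a : A) :
    tupleAssignment (update s (coord R x) a) = (tupleAssignment s).modify x a := by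
  funext y
  by_cases hy : y < R
  · by_cases hxy : y = x
    · subst hxy; simp [tupleAssignment, Assignment.modify, hx]
    · have : coord R y ≠ coord R x := fun h => hxy (coord_inj hy hx h)
      simp [tupleAssignment, Assignment.modify, hxy, hy, this]
  · have : y ≠ x := by omega
    simp [tupleAssignment, Assignment.modify, hy, this]

theorem tupleAssignment_update_last (s : Fin (R + 1) → A) (a : A) :
    tupleAssignment (update s (Fin.last R) a) = tupleAssignment s := by
  funext y
  by_cases hy : y < R
  · simp [tupleAssignment, hy, coord_ne_last hy]
  · simp [tupleAssignment, hy]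

variable (S : L.Structure A)

/-- The conditions on a family of relations that force the relation of each subterm to hold only
of tuples whose last entry is the value of the subterm. -/
def TermFamily : ∀ t : L.Term ℕ, (TermNode t → Set (Fin (R + 1) → A)) → Prop
  | .var x, D => ∀ s ∈ D (none : Option Empty), s (Fin.last R) = s (coord R x)
  | .func (l := k) f ts, D =>
    (∀ s ∈ D (none : Option (Σ i, TermNode (ts i))), ∃ a : Fin k → A,
      (∀ i, update s (Fin.last R) (a i) ∈ D (some ⟨i, .root (ts i)⟩)) ∧
        S.funMap f a = s (Fin.last R)) ∧
    ∀ i, TermFamily (ts i) fun p => D (some ⟨i, p⟩)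

/-- The conditions on a family of teams that express that it witnesses the satisfaction of a
formula. -/
def Family : ∀ φ : IncFormula L, (Node φ → Set (Fin (R + 1) → A)) → Prop
  | .eq t t', D =>
    (∀ s ∈ D (none : Option (TermNode t ⊕ TermNode t')), ∃ a,
      update s (Fin.last R) a ∈ D (some (.inl (.root t))) ∧
      update s (Fin.last R) a ∈ D (some (.inr (.root t')))) ∧
    (TermFamily S t fun p => D (some (.inl p))) ∧ TermFamily S t' fun p => D (some (.inr p))
  | .neq t t', D =>
    (∀ s ∈ D (none : Option (TermNode t ⊕ TermNode t')), ∃ a b,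
      update s (Fin.last R) a ∈ D (some (.inl (.root t))) ∧
      update s (Fin.last R) b ∈ D (some (.inr (.root t'))) ∧ a ≠ b) ∧
    (TermFamily S t fun p => D (some (.inl p))) ∧ TermFamily S t' fun p => D (some (.inr p))
  | .rel (k := k) R' ts, D =>
    (∀ s ∈ D (none : Option (Σ i, TermNode (ts i))), ∃ a : Fin k → A,
      (∀ i, update s (Fin.last R) (a i) ∈ D (some ⟨i, .root (ts i)⟩)) ∧ S.RelMap R' a) ∧
    ∀ i, TermFamily S (ts i) fun p => D (some ⟨i, p⟩)
  | .nrel (k := k) R' ts, D =>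
    (∀ s ∈ D (none : Option (Σ i, TermNode (ts i))), ∃ a : Fin k → A,
      (∀ i, update s (Fin.last R) (a i) ∈ D (some ⟨i, .root (ts i)⟩)) ∧ ¬S.RelMap R' a) ∧
    ∀ i, TermFamily S (ts i) fun p => D (some ⟨i, p⟩)
  | .incl ts us, D =>
    (∀ s ∈ D (none : Option ((Σ i, TermNode (ts i)) ⊕ (Σ i, TermNode (us i)))),
      ∃ s' ∈ D (none : Option ((Σ i, TermNode (ts i)) ⊕ (Σ i, TermNode (us i)))), ∀ i, ∃ a,
        update s (Fin.last R) a ∈ D (some (.inl ⟨i, .root (ts i)⟩)) ∧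
        update s' (Fin.last R) a ∈ D (some (.inr ⟨i, .root (us i)⟩))) ∧
    (∀ i, TermFamily S (ts i) fun p => D (some (.inl ⟨i, p⟩))) ∧
    ∀ i, TermFamily S (us i) fun p => D (some (.inr ⟨i, p⟩))
  | .and φ ψ, D =>
    (∀ s ∈ D (none : Option (Node φ ⊕ Node ψ)), s ∈ D (some (.inl (.root φ))) ∧
      s ∈ D (some (.inr (.root ψ)))) ∧
    (∀ s ∈ D (some (.inl (.root φ))), s ∈ D (none : Option (Node φ ⊕ Node ψ))) ∧
    (∀ s ∈ D (some (.inr (.root ψ))), s ∈ D (none : Option (Node φ ⊕ Node ψ))) ∧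
    (Family φ fun p => D (some (.inl p))) ∧ Family ψ fun p => D (some (.inr p))
  | .or φ ψ, D =>
    (∀ s ∈ D (none : Option (Node φ ⊕ Node ψ)), s ∈ D (some (.inl (.root φ))) ∨
      s ∈ D (some (.inr (.root ψ)))) ∧
    (∀ s ∈ D (some (.inl (.root φ))), s ∈ D (none : Option (Node φ ⊕ Node ψ))) ∧
    (∀ s ∈ D (some (.inr (.root ψ))), s ∈ D (none : Option (Node φ ⊕ Node ψ))) ∧
    (Family φ fun p => D (some (.inl p))) ∧ Family ψ fun p => D (some (.inr p))
  | .ex x φ, D =>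
    (∀ s ∈ D (none : Option (Node φ)), ∃ a, update s (coord R x) a ∈ D (some (.root φ))) ∧
    (∀ s ∈ D (some (.root φ)), ∃ a, update s (coord R x) a ∈ D (none : Option (Node φ))) ∧
    Family φ fun p => D (some p)
  | .all x φ, D =>
    (∀ s ∈ D (none : Option (Node φ)), ∀ a, update s (coord R x) a ∈ D (some (.root φ))) ∧
    (∀ s ∈ D (some (.root φ)), ∃ a, update s (coord R x) a ∈ D (none : Option (Node φ))) ∧
    Family φ fun p => D (some p)

variable {S}

/-- The conditions bound the relations of subterms only from above: each tuple that is present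
carries the correct value, while tuples may be missing. Soundness of the atoms needs no more,
because they demand the presence of suitable tuples. -/
theorem TermFamily.sound {t : L.Term ℕ} (ht : TermBelow R t)
    {D : TermNode t → Set (Fin (R + 1) → A)} (hD : TermFamily S t D) {s : Fin (R + 1) → A}
    (hs : s ∈ D (.root t)) : termValue S (tupleAssignment s) t = some (s (Fin.last R)) := by
  induction t generalizing s with
  | var x =>
    have hx : x < R := ht
    rw [termValue, hD s hs]
    simp [tupleAssignment, hx]
  | func f ts ih =>
    obtain ⟨a, ha, hf⟩ := hD.1 s hs
    have h : ∀ i, termValue S (tupleAssignment s) (ts i) = some (a i) := fun i => by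
      have := ih i (ht.2 i) (hD.2 i) (ha i)
      rwa [tupleAssignment_update_last, update_self] at this
    rw [termValue, dif_pos fun i => by rw [h i]; rfl, ← hf]
    simp [h]

/-- Giving every subterm the full relation between assignments and values satisfies the conditions,
so the positive demands of atoms can always be met. -/
theorem exists_termFamily (t : L.Term ℕ) (ht : TermBelow R t) :
    ∃ D : TermNode t → Set (Fin (R + 1) → A), TermFamily S t D ∧
      ∀ s, s ∈ D (.root t) ↔ termValue S (tupleAssignment s) t = some (s (Fin.last R)) := by
  induction t with
  | var x =>
    have hx : x < R := ht
    have h : ∀ s : Fin (R + 1) → A, s (Fin.last R) = s (coord R x) ↔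
        termValue S (tupleAssignment s) (.var x) = some (s (Fin.last R)) := fun s => by
      simp [termValue, tupleAssignment, hx, eq_comm]
    exact ⟨fun _ => {s | s (Fin.last R) = s (coord R x)}, fun s hs => hs, h⟩
  | func f ts ih =>
    choose D hD hD' using fun i => ih i (ht.2 i)
    refine ⟨fun p => match p with
      | none => {s | termValue S (tupleAssignment s) (.func f ts) = some (s (Fin.last R))}
      | some ⟨i, p⟩ => D i p, ⟨fun s hs => ?_, hD⟩, fun s => Iff.rfl⟩
    change termValue S (tupleAssignment s) (.func f ts) = some (s (Fin.last R)) at hs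
    rw [termValue] at hs
    split_ifs at hs with h
    refine ⟨fun i => (termValue S (tupleAssignment s) (ts i)).get (h i), fun i => ?_, by
      simpa using hs⟩
    change _ ∈ D i (.root (ts i))
    rw [hD', tupleAssignment_update_last, update_self, Option.some_get]

theorem isSome_termValue [Nonempty A] (t : L.Term ℕ) (ht : TermBelow R t) (s : Fin (R + 1) → A) :
    ∃ a, termValue S (tupleAssignment s) t = some a := by
  induction t with
  | var x =>
    have hx : x < R := ht
    exact ⟨s (coord R x), by simp [termValue, tupleAssignment, hx]⟩
  | func f ts ih =>
    choose a ha using fun i => ih i (ht.2 i)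
    refine ⟨S.funMap f a, ?_⟩
    rw [termValue, dif_pos fun i => by rw [ha i]; rfl]
    simp [ha]

theorem supplement_tupleAssignment (D : Set (Fin (R + 1) → A)) {x : ℕ} (hx : x < R)
    (f : Assignment A → Set A) :
    supplement (tupleAssignment '' D) x f = tupleAssignment ''
      {s' | ∃ s ∈ D, ∃ a ∈ f (tupleAssignment s), s' = update s (coord R x) a} := by
  ext q
  constructor
  · rintro ⟨_, ⟨s, hs, rfl⟩, a, ha, rfl⟩
    exact ⟨_, ⟨s, hs, a, ha, rfl⟩, tupleAssignment_update s hx a⟩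
  · rintro ⟨_, ⟨s, hs, a, ha, rfl⟩, rfl⟩
    exact ⟨_, ⟨s, hs, rfl⟩, a, ha, tupleAssignment_update s hx a⟩

/-- Each set of a family, read as a team, satisfies its own subformula. The backward inclusions in
`Family` matter here: subteams must not contain additional tuples, since satisfaction in inclusion
logic is not inherited by larger or smaller teams. -/
theorem Family.sound (φ : IncFormula L) (hφ : φ.Below R)
    {D : Node φ → Set (Fin (R + 1) → A)} (hD : Family S φ D) :
    Sat S (tupleAssignment '' D (.root φ)) φ := by
  have tv : ∀ {t : L.Term ℕ} (ht : TermBelow R t) {D : TermNode t → Set (Fin (R + 1) → A)}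
      (hD : TermFamily S t D) {s : Fin (R + 1) → A} {a : A}
      (hs : update s (Fin.last R) a ∈ D (.root t)),
      termValue S (tupleAssignment s) t = some a := fun ht D hD s a hs => by
    have := hD.sound ht hs
    rwa [tupleAssignment_update_last, update_self] at this
  induction φ with
  | eq t t' =>
    rintro _ ⟨s, hs, rfl⟩
    obtain ⟨a, h, h'⟩ := hD.1 s hs
    rw [tv hφ.1 hD.2.1 h, tv hφ.2 hD.2.2 h']
  | neq t t' =>
    rintro _ ⟨s, hs, rfl⟩
    obtain ⟨a, b, h, h', hab⟩ := hD.1 s hs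
    rw [tv hφ.1 hD.2.1 h, tv hφ.2 hD.2.2 h']
    simpa using hab
  | rel R' ts =>
    rintro _ ⟨s, hs, rfl⟩
    obtain ⟨a, h, h'⟩ := hD.1 s hs
    exact ⟨a, fun i => tv (hφ.2 i) (hD.2 i) (h i), h'⟩
  | nrel R' ts =>
    rintro _ ⟨s, hs, rfl⟩
    obtain ⟨a, h, h'⟩ := hD.1 s hs
    exact ⟨a, fun i => tv (hφ.2 i) (hD.2 i) (h i), h'⟩
  | incl ts us =>
    rintro _ ⟨s, hs, rfl⟩
    obtain ⟨s', hs', h⟩ := hD.1 s hs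
    refine ⟨_, ⟨s', hs', rfl⟩, fun i => ?_⟩
    obtain ⟨a, h₁, h₂⟩ := h i
    rw [tv (hφ i).1 (hD.2.1 i) h₁, tv (hφ i).2 (hD.2.2 i) h₂]
  | and φ ψ ih₁ ih₂ =>
    have h₁ := ih₁ hφ.1 hD.2.2.2.1
    have h₂ := ih₂ hφ.2 hD.2.2.2.2
    have e₁ : D (some (.inl (.root φ))) = D (.root (.and φ ψ)) :=
      Set.Subset.antisymm hD.2.1 fun s hs => (hD.1 s hs).1
    have e₂ : D (some (.inr (.root ψ))) = D (.root (.and φ ψ)) :=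
      Set.Subset.antisymm hD.2.2.1 fun s hs => (hD.1 s hs).2
    rw [e₁] at h₁
    rw [e₂] at h₂
    exact ⟨h₁, h₂⟩
  | or φ ψ ih₁ ih₂ =>
    refine ⟨_, _, ?_, ih₁ hφ.1 hD.2.2.2.1, ih₂ hφ.2 hD.2.2.2.2⟩
    rw [← Set.image_union]
    congr 1
    exact Set.Subset.antisymm (Set.union_subset hD.2.1 hD.2.2.1) hD.1
  | ex x φ ih =>
    have h := ih hφ.2 hD.2.2
    -- Tuples that differ only in the last coordinate give the same assignment, so the values are
    -- collected over all tuples that give `q`.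
    refine ⟨fun q => {a | ∃ s ∈ D (.root (.ex x φ)), q = tupleAssignment s ∧
      update s (coord R x) a ∈ D (some (.root φ))}, ?_, ?_⟩
    · rintro _ ⟨s, hs, rfl⟩
      obtain ⟨a, ha⟩ := hD.1 s hs
      exact ⟨a, s, hs, rfl, ha⟩
    · convert h using 1
      ext q
      constructor
      · rintro ⟨_, _, a, ⟨s, hs, rfl, ha⟩, rfl⟩
        exact ⟨_, ha, tupleAssignment_update s hφ.1 a⟩
      · rintro ⟨s, hs, rfl⟩
        obtain ⟨b, hb⟩ := hD.2.1 s hs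
        -- Overwriting the coordinate of `x` with its old value recovers `s`; hence `s` arises from
        -- the tuple with `b`, which is in the team of the quantified formula.
        have e : update (update s (coord R x) b) (coord R x) (s (coord R x)) = s := by
          rw [update_idem, update_eq_self]
        exact ⟨_, ⟨_, hb, rfl⟩, s (coord R x), ⟨_, hb, rfl, by rwa [e]⟩, by
          rw [← tupleAssignment_update _ hφ.1, e]⟩
  | all x φ ih =>
    have h := ih hφ.2 hD.2.2
    rw [Sat, supplement_tupleAssignment _ hφ.1]
    convert h using 2
    ext s'
    constructor
    · rintro ⟨s, hs, a, _, rfl⟩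
      exact hD.1 s hs a
    · intro hs'
      obtain ⟨b, hb⟩ := hD.2.1 s' hs'
      exact ⟨_, hb, s' (coord R x), trivial, by rw [update_idem, update_eq_self]⟩

/-- The sets are the teams that occur in a witness of satisfaction, pulled back to tuples.
Prescribing the root set `D₀` exactly lets the induction glue the families of the subformulas
together. -/
theorem exists_family [Nonempty A] (φ : IncFormula L) (hφ : φ.Below R) (D₀ : Set (Fin (R + 1) → A))
    (h : Sat S (tupleAssignment '' D₀) φ) :
    ∃ D : Node φ → Set (Fin (R + 1) → A), D (.root φ) = D₀ ∧ Family S φ D := by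
  have tv : ∀ {t : L.Term ℕ} {D : TermNode t → Set (Fin (R + 1) → A)}
      (hD : ∀ s, s ∈ D (.root t) ↔ termValue S (tupleAssignment s) t = some (s (Fin.last R)))
      {s : Fin (R + 1) → A} {a : A} (hs : termValue S (tupleAssignment s) t = some a),
      update s (Fin.last R) a ∈ D (.root t) := fun hD s a hs => by
    rwa [hD, tupleAssignment_update_last, update_self]
  induction φ generalizing D₀ with
  | eq t t' =>
    obtain ⟨E, hE, hE'⟩ := exists_termFamily (S := S) t hφ.1
    obtain ⟨F, hF, hF'⟩ := exists_termFamily (S := S) t' hφ.2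
    refine ⟨fun p => match p with
      | none => D₀
      | some (.inl p) => E p
      | some (.inr p) => F p, rfl, fun s hs => ?_, hE, hF⟩
    obtain ⟨a, ha⟩ := isSome_termValue (S := S) t hφ.1 s
    have h' := h _ ⟨s, hs, rfl⟩
    rw [ha] at h'
    exact ⟨a, tv hE' ha, tv hF' h'.symm⟩
  | neq t t' =>
    obtain ⟨E, hE, hE'⟩ := exists_termFamily (S := S) t hφ.1
    obtain ⟨F, hF, hF'⟩ := exists_termFamily (S := S) t' hφ.2
    refine ⟨fun p => match p with
      | none => D₀
      | some (.inl p) => E p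
      | some (.inr p) => F p, rfl, fun s hs => ?_, hE, hF⟩
    obtain ⟨a, ha⟩ := isSome_termValue (S := S) t hφ.1 s
    obtain ⟨b, hb⟩ := isSome_termValue (S := S) t' hφ.2 s
    have h' := h _ ⟨s, hs, rfl⟩
    rw [ha, hb] at h'
    exact ⟨a, b, tv hE' ha, tv hF' hb, by simpa using h'⟩
  | rel R' ts =>
    choose E hE hE' using fun i => exists_termFamily (S := S) (ts i) (hφ.2 i)
    refine ⟨fun p => match p with
      | none => D₀
      | some ⟨i, p⟩ => E i p, rfl, fun s hs => ?_, hE⟩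
    obtain ⟨a, ha, hR⟩ := h _ ⟨s, hs, rfl⟩
    exact ⟨a, fun i => tv (hE' i) (ha i), hR⟩
  | nrel R' ts =>
    choose E hE hE' using fun i => exists_termFamily (S := S) (ts i) (hφ.2 i)
    refine ⟨fun p => match p with
      | none => D₀
      | some ⟨i, p⟩ => E i p, rfl, fun s hs => ?_, hE⟩
    obtain ⟨a, ha, hR⟩ := h _ ⟨s, hs, rfl⟩
    exact ⟨a, fun i => tv (hE' i) (ha i), hR⟩
  | incl ts us =>
    choose E hE hE' using fun i => exists_termFamily (S := S) (ts i) (hφ i).1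
    choose F hF hF' using fun i => exists_termFamily (S := S) (us i) (hφ i).2
    refine ⟨fun p => match p with
      | none => D₀
      | some (.inl ⟨i, p⟩) => E i p
      | some (.inr ⟨i, p⟩) => F i p, rfl, fun s hs => ?_, hE, hF⟩
    obtain ⟨_, ⟨s', hs', rfl⟩, h'⟩ := h _ ⟨s, hs, rfl⟩
    refine ⟨s', hs', fun i => ?_⟩
    obtain ⟨a, ha⟩ := isSome_termValue (S := S) (ts i) (hφ i).1 s
    exact ⟨a, tv (hE' i) ha, tv (hF' i) ((h' i).symm.trans ha)⟩
  | and φ ψ ih₁ ih₂ =>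
    obtain ⟨E, hE, hE'⟩ := ih₁ hφ.1 D₀ h.1
    obtain ⟨F, hF, hF'⟩ := ih₂ hφ.2 D₀ h.2
    refine ⟨fun p => match p with
      | none => D₀
      | some (.inl p) => E p
      | some (.inr p) => F p, rfl, fun s hs => ⟨?_, ?_⟩, fun s hs => ?_, fun s hs => ?_, hE', hF'⟩
    · exact hE.symm ▸ hs
    · exact hF.symm ▸ hs
    · exact hE ▸ hs
    · exact hF ▸ hs
  | or φ ψ ih₁ ih₂ =>
    obtain ⟨T₀, T₁, hT, h₀, h₁⟩ := h
    -- The map from tuples to assignments is not injective, so a subteam is represented by all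
    -- tuples of `D₀` that are mapped into it.
    have e : ∀ T ⊆ tupleAssignment '' D₀,
        tupleAssignment '' {s | s ∈ D₀ ∧ tupleAssignment s ∈ T} = T := fun T hT => by
      ext q
      constructor
      · rintro ⟨s, hs, rfl⟩
        exact hs.2
      · intro hq
        obtain ⟨s, hs, rfl⟩ := hT hq
        exact ⟨s, ⟨hs, hq⟩, rfl⟩
    rw [← e T₀ (hT ▸ Set.subset_union_left)] at h₀
    rw [← e T₁ (hT ▸ Set.subset_union_right)] at h₁
    obtain ⟨E, hE, hE'⟩ := ih₁ hφ.1 _ h₀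
    obtain ⟨F, hF, hF'⟩ := ih₂ hφ.2 _ h₁
    refine ⟨fun p => match p with
      | none => D₀
      | some (.inl p) => E p
      | some (.inr p) => F p, rfl, fun s hs => ?_, fun s hs => ?_, fun s hs => ?_, hE', hF'⟩
    · have : tupleAssignment s ∈ T₀ ∪ T₁ := hT ▸ ⟨s, hs, rfl⟩
      rcases this with h | h
      · left
        change s ∈ E _
        rw [hE]
        exact ⟨hs, h⟩
      · right
        change s ∈ F _
        rw [hF]
        exact ⟨hs, h⟩
    · change s ∈ E _ at hs
      rw [hE] at hs
      exact hs.1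
    · change s ∈ F _ at hs
      rw [hF] at hs
      exact hs.1
  | ex x φ ih =>
    obtain ⟨f, hf, h⟩ := h
    rw [supplement_tupleAssignment _ hφ.1] at h
    obtain ⟨E, hE, hE'⟩ := ih hφ.2 _ h
    refine ⟨fun p => match p with
      | none => D₀
      | some p => E p, rfl, fun s hs => ?_, fun s hs => ?_, hE'⟩
    · obtain ⟨a, ha⟩ := hf _ ⟨s, hs, rfl⟩
      refine ⟨a, ?_⟩
      change _ ∈ E _
      rw [hE]
      exact ⟨s, hs, a, ha, rfl⟩
    · change s ∈ E _ at hs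
      rw [hE] at hs
      obtain ⟨s, hs, a, ha, rfl⟩ := hs
      refine ⟨s (coord R x), ?_⟩
      rw [update_idem, update_eq_self]
      exact hs
  | all x φ ih =>
    rw [Sat, supplement_tupleAssignment _ hφ.1] at h
    obtain ⟨E, hE, hE'⟩ := ih hφ.2 _ h
    refine ⟨fun p => match p with
      | none => D₀
      | some p => E p, rfl, fun s hs a => ?_, fun s hs => ?_, hE'⟩
    · change _ ∈ E _
      rw [hE]
      exact ⟨s, hs, a, trivial, rfl⟩
    · change s ∈ E _ at hs
      rw [hE] at hs
      obtain ⟨s, hs, a, ha, rfl⟩ := hs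
      refine ⟨s (coord R x), ?_⟩
      rw [update_idem, update_eq_self]
      exact hs

/-- A sentence is satisfied by the team of the empty assignment if and only if there is a family
for it with a non-empty team for the sentence itself. -/
theorem sat_emptyAssignment_iff [Nonempty A] (φ : IncFormula L) (hφ : φ.IsSentence)
    (hR : φ.Below R) : Sat S {emptyAssignment A} φ ↔
      ∃ D : Node φ → Set (Fin (R + 1) → A), (D (.root φ)).Nonempty ∧ Family S φ D := by
  have hV : φ.freeVars ⊆ ∅ := (show φ.freeVars = ∅ from hφ).subset
  constructor
  · intro h
    -- By locality the team of the empty assignment may be exchanged for the one of all tuples,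
    -- which is total on the variables below `R`.
    obtain ⟨D, hD, hD'⟩ := exists_family φ hR Set.univ (h.of_agree S φ hV
      ⟨fun s _ => ⟨tupleAssignment fun _ => Classical.arbitrary A, ⟨_, trivial, rfl⟩, by simp⟩,
        fun s' _ => ⟨_, Set.mem_singleton _, by simp⟩⟩)
    exact ⟨D, hD ▸ Set.univ_nonempty, hD'⟩
  · rintro ⟨D, ⟨s, hs⟩, hD⟩
    exact (Family.sound φ hR hD).of_agree S φ hV
      ⟨fun s _ => ⟨_, Set.mem_singleton _, by simp⟩,
        fun s' _ => ⟨_, Set.mem_image_of_mem _ hs, by simp⟩⟩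

/-- Both directions compare non-empty teams on the empty set of variables, where they agree
trivially. -/
theorem exists_team_iff (φ : IncFormula L) (hφ : φ.IsSentence) :
    (∃ T : Set (Assignment A), IsTeamOver φ.freeVars T ∧ T.Nonempty ∧ Sat S T φ) ↔
      Sat S {emptyAssignment A} φ := by
  have e : φ.freeVars = ∅ := hφ
  constructor
  · rintro ⟨T, hT, ⟨s, hs⟩, h⟩
    exact h.of_agree S φ e.subset
      ⟨fun s _ => ⟨_, Set.mem_singleton _, by simp⟩, fun s' _ => ⟨s, hs, by simp⟩⟩
  · refine fun h => ⟨_, ?_, Set.singleton_nonempty _, h⟩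
    rintro s rfl x
    simp [e, emptyAssignment]

end families

/-! ### Derived expressions and commands -/

namespace BExp

variable {V J : Type} {r n : ℕ} [DecidableEq V]

/-- Disjunction. -/
def or (e e' : BExp V J r) : BExp V J r := .not (.and (.not e) (.not e'))

/-- Universal quantification. -/
def all (v : V) (e : BExp V J r) : BExp V J r := .not (.ex v (.not e))

/-- Conjunction of a list. -/
def conj (l : List (BExp V J r)) : BExp V J r := l.foldr .and .tt

/-- Existential quantification over a list of variables. -/
def exs (vs : List V) (e : BExp V J r) : BExp V J r := vs.foldr .ex e

variable {E : V → Fin n} {D : Store J r n}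

theorem eval_arr {j : J} {a : Fin r → V} : (arr j a).eval E D = D.arr j (E ∘ a) := rfl

theorem eval_not {e : BExp V J r} : (not e).eval E D = true ↔ ¬e.eval E D = true := by
  simp [eval]

theorem eval_and {e e' : BExp V J r} :
    (and e e').eval E D = true ↔ e.eval E D = true ∧ e'.eval E D = true := by
  simp [eval]

theorem eval_or {e e' : BExp V J r} :
    (or e e').eval E D = true ↔ e.eval E D = true ∨ e'.eval E D = true := by
  simp [or, eval]

theorem eval_ex {v : V} {e : BExp V J r} :
    (ex v e).eval E D = true ↔ ∃ i, e.eval (update E v i) D = true := by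
  simp [eval]

theorem eval_all {v : V} {e : BExp V J r} :
    (all v e).eval E D = true ↔ ∀ i, e.eval (update E v i) D = true := by
  simp [all, eval]

theorem eval_conj {l : List (BExp V J r)} :
    (conj l).eval E D = true ↔ ∀ e ∈ l, e.eval E D = true := by
  induction l with
  | nil => simp [conj, eval]
  | cons e l ih =>
    rw [List.forall_mem_cons, ← ih, ← eval_and]
    rfl

theorem eval_exs {vs : List V} {e : BExp V J r} :
    (exs vs e).eval E D = true ↔ ∃ F, (∀ v ∉ vs, F v = E v) ∧ e.eval F D = true := by
  induction vs generalizing E with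
  | nil =>
    constructor
    · exact fun h => ⟨E, fun _ _ => rfl, h⟩
    · rintro ⟨F, hF, h⟩
      obtain rfl : F = E := funext fun v => hF v (by simp)
      exact h
  | cons v vs ih =>
    rw [show exs (v :: vs) e = ex v (exs vs e) from rfl, eval_ex]
    constructor
    · rintro ⟨i, hi⟩
      obtain ⟨F, hF, h⟩ := ih.1 hi
      refine ⟨F, fun v' hv' => ?_, h⟩
      rw [List.mem_cons, not_or] at hv'
      rw [hF v' hv'.2, update_of_ne hv'.1]
    · rintro ⟨F, hF, h⟩
      refine ⟨F v, ih.2 ⟨F, fun v' hv' => ?_, h⟩⟩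
      by_cases e : v' = v
      · subst e; simp
      · rw [update_of_ne e, hF v' (by simp [e, hv'])]

omit [DecidableEq V] in
theorem Fresh.anti {e : BExp V J r} {A B : Set V} (h : e.Fresh B) (hAB : A ⊆ B) : e.Fresh A := by
  induction e generalizing A B with
  | tt => trivial
  | eof => trivial
  | arr j a => trivial
  | not e ih => exact ih h hAB
  | and e e' ih ih' => exact ⟨ih h.1 hAB, ih' h.2 hAB⟩
  | ex v e ih => exact ⟨fun hv => h.1 (hAB hv), ih h.2 (Set.insert_subset_insert hAB)⟩

omit [DecidableEq V] in
theorem fresh_conj {l : List (BExp V J r)} {A : Set V} :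
    (conj l).Fresh A ↔ ∀ e ∈ l, e.Fresh A := by
  induction l with
  | nil => simp [conj, Fresh]
  | cons e l ih =>
    rw [List.forall_mem_cons, ← ih]
    rfl

omit [DecidableEq V] in
theorem fresh_exs {vs : List V} {e : BExp V J r} {A : Set V} (hvs : vs.Nodup)
    (hA : ∀ v ∈ vs, v ∉ A) (he : e.Fresh (A ∪ {v | v ∈ vs})) : (exs vs e).Fresh A := by
  induction vs generalizing A with
  | nil => exact he.anti Set.subset_union_left
  | cons v vs ih =>
    rw [List.nodup_cons] at hvs
    refine ⟨hA v (by simp), ih hvs.2 (fun v' hv' => ?_) (he.anti ?_)⟩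
    · rintro (rfl | h)
      · exact hvs.1 hv'
      · exact hA v' (by simp [hv']) h
    · rintro v' ((rfl | h) | h)
      · exact .inr (by simp)
      · exact .inl h
      · exact .inr (List.mem_cons_of_mem _ h)

/-- The arrays in the right summand occur only under an even number of negations (for `true`) or
only under an odd number of negations (for `false`). -/
def Polar {C N : Type} : BExp V (C ⊕ N) r → Bool → Prop
  | tt, _ => True
  | eof, _ => True
  | arr (.inl _) _, _ => True
  | arr (.inr _) _, b => b = true
  | not e, b => e.Polar !b
  | and e e', b => e.Polar b ∧ e'.Polar b
  | ex _ e, b => e.Polar b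

/-- Negation exchanges the two polarities, so monotonicity and antitonicity are proved together. The
base arrays in the left summand are equal in both stores and may occur in any polarity. -/
theorem Polar.mono {C N : Type} {e : BExp V (C ⊕ N) r} {D D' : Store (C ⊕ N) r n}
    (hi : D.inp = D'.inp) (hC : ∀ c, D.arr (.inl c) = D'.arr (.inl c))
    (hN : ∀ p s, D.arr (.inr p) s = true → D'.arr (.inr p) s = true) :
    (e.Polar true → ∀ E, e.eval E D = true → e.eval E D' = true) ∧
      (e.Polar false → ∀ E, e.eval E D' = true → e.eval E D = true) := by
  induction e with
  | tt => exact ⟨fun _ _ h => h, fun _ _ h => h⟩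
  | eof => simp [eval, hi]
  | arr j a =>
    rcases j with c | p
    · simp [eval, hC]
    · exact ⟨fun _ E h => hN p _ h, fun h => absurd h (by simp [Polar])⟩
  | not e ih =>
    refine ⟨fun h E => ?_, fun h E => ?_⟩
    · rw [eval_not, eval_not]
      exact mt (ih.2 h E)
    · rw [eval_not, eval_not]
      exact mt (ih.1 h E)
  | and e e' ih ih' =>
    refine ⟨fun h E => ?_, fun h E => ?_⟩
    · rw [eval_and, eval_and]
      exact And.imp (ih.1 h.1 E) (ih'.1 h.2 E)
    · rw [eval_and, eval_and]
      exact And.imp (ih.2 h.1 E) (ih'.2 h.2 E)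
  | ex v e ih =>
    refine ⟨fun h E => ?_, fun h E => ?_⟩
    · rw [eval_ex, eval_ex]
      exact Exists.imp fun i => ih.1 h _
    · rw [eval_ex, eval_ex]
      exact Exists.imp fun i => ih.2 h _

omit [DecidableEq V] in
theorem polar_conj {C N : Type} {l : List (BExp V (C ⊕ N) r)} {b : Bool} :
    (conj l).Polar b ↔ ∀ e ∈ l, e.Polar b := by
  induction l with
  | nil => simp [conj, Polar]
  | cons e l ih =>
    rw [List.forall_mem_cons, ← ih]
    rfl

omit [DecidableEq V] in
theorem polar_exs {C N : Type} {vs : List V} {e : BExp V (C ⊕ N) r} {b : Bool} :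
    (exs vs e).Polar b ↔ e.Polar b := by
  induction vs with
  | nil => rfl
  | cons v vs ih => exact ih

end BExp

namespace Cmd

variable {V J : Type} {r n : ℕ}

/-- Execute the commands of a list. -/
def seqs (l : List (Cmd V J r)) : Cmd V J r := l.foldr .seq .skip

/-- Nested loops over a list of variables. -/
def loops (vs : List V) (c : Cmd V J r) : Cmd V J r := vs.foldr .iter c

theorem Fresh.anti {c : Cmd V J r} {A B : Set V} (h : c.Fresh B) (hAB : A ⊆ B) : c.Fresh A := by
  induction c generalizing A B with
  | skip => trivial
  | assign j a e => exact BExp.Fresh.anti h hAB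
  | read j a => trivial
  | seq c d ih ih' => exact ⟨ih h.1 hAB, ih' h.2 hAB⟩
  | iter v e ih => exact ⟨fun hv => h.1 (hAB hv), ih h.2 (Set.insert_subset_insert hAB)⟩

theorem fresh_seqs {l : List (Cmd V J r)} {A : Set V} :
    (seqs l).Fresh A ↔ ∀ c ∈ l, c.Fresh A := by
  induction l with
  | nil => simp [seqs, Fresh]
  | cons c l ih =>
    rw [List.forall_mem_cons, ← ih]
    rfl

theorem fresh_loops {vs : List V} {c : Cmd V J r} {A : Set V} (hvs : vs.Nodup)
    (hA : ∀ v ∈ vs, v ∉ A) (hc : c.Fresh (A ∪ {v | v ∈ vs})) : (loops vs c).Fresh A := by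
  induction vs generalizing A with
  | nil => exact hc.anti Set.subset_union_left
  | cons v vs ih =>
    rw [List.nodup_cons] at hvs
    refine ⟨hA v (by simp), ih hvs.2 (fun v' hv' => ?_) (hc.anti ?_)⟩
    · rintro (rfl | h)
      · exact hvs.1 hv'
      · exact hA v' (by simp [hv']) h
    · rintro v' ((rfl | h) | h)
      · exact .inr (by simp)
      · exact .inl h
      · exact .inr (List.mem_cons_of_mem _ h)

/-- The array `j` is not written. -/
def Avoids (j : J) : Cmd V J r → Prop
  | skip => True
  | assign j' _ _ => j ≠ j'
  | read j' _ => j ≠ j'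
  | seq c d => c.Avoids j ∧ d.Avoids j
  | iter _ c => c.Avoids j

/-- The input is not read. -/
def NoRead : Cmd V J r → Prop
  | skip => True
  | assign _ _ _ => True
  | read _ _ => False
  | seq c d => c.NoRead ∧ d.NoRead
  | iter _ c => c.NoRead

theorem avoids_seqs {l : List (Cmd V J r)} {j : J} :
    (seqs l).Avoids j ↔ ∀ c ∈ l, c.Avoids j := by
  induction l with
  | nil => simp [seqs, Avoids]
  | cons c l ih =>
    rw [List.forall_mem_cons, ← ih]
    rfl

theorem avoids_loops {vs : List V} {c : Cmd V J r} {j : J} :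
    (loops vs c).Avoids j ↔ c.Avoids j := by
  induction vs with
  | nil => rfl
  | cons v vs ih => exact ih

theorem iterFor_invariant {α : Type*} {f : ℕ → α → α} (P : α → Prop) (hf : ∀ i a, P a → P (f i a))
    (m : ℕ) {a : α} (ha : P a) : P (iterFor f m a) := by
  induction m with
  | zero => exact ha
  | succ m ih => exact hf m _ ih

variable [DecidableEq V] [DecidableEq J] [NeZero n]

theorem Avoids.eval_arr {c : Cmd V J r} {j : J} (h : c.Avoids j) (E : V → Fin n)
    (D : Store J r n) : (c.eval E D).arr j = D.arr j := by
  induction c generalizing E D with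
  | skip => rfl
  | assign j' a e => exact update_of_ne h _ _
  | read j' a => exact update_of_ne h _ _
  | seq c d ih ih' => rw [eval, ih' h.2, ih h.1]
  | iter v c ih =>
    exact iterFor_invariant (fun D' : Store J r n => D'.arr j = D.arr j)
      (fun i D' h' => (ih h _ _).trans h') n rfl

theorem NoRead.eval_inp {c : Cmd V J r} (h : c.NoRead) (E : V → Fin n)
    (D : Store J r n) : (c.eval E D).inp = D.inp := by
  induction c generalizing E D with
  | skip => rfl
  | assign j' a e => rfl
  | read j' a => exact h.elim
  | seq c d ih ih' => rw [eval, ih' h.2, ih h.1]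
  | iter v c ih =>
    exact iterFor_invariant (fun D' : Store J r n => D'.inp = D.inp)
      (fun i D' h' => (ih h _ _).trans h') n rfl

theorem eval_seqs (l : List (Cmd V J r)) (E : V → Fin n) (D : Store J r n) :
    (seqs l).eval E D = l.foldl (fun D c => c.eval E D) D := by
  induction l generalizing D with
  | nil => rfl
  | cons c l ih => exact ih _

theorem eval_iter (v : V) (c : Cmd V J r) (E : V → Fin n) (D : Store J r n) :
    (iter v c).eval E D = (List.finRange n).foldl (fun D i => c.eval (update E v i) D) D := by
  have h : ∀ m (hm : m ≤ n), iterFor (fun i D => c.eval (update E v (Fin.ofNat n i)) D) m D =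
      (List.ofFn fun i : Fin m => Fin.castLE hm i).foldl
        (fun D i => c.eval (update E v i) D) D := by
    intro m
    induction m with
    | zero => intro hm; rfl
    | succ m ih =>
      intro hm
      rw [iterFor, ih (by omega), List.ofFn_succ', List.concat_eq_append, List.foldl_append,
        List.foldl_cons, List.foldl_nil]
      congr 2
      exact Fin.ext (Nat.mod_eq_of_lt hm)
  rw [eval, h n le_rfl]
  rfl

/-- Nested loops flatten to one fold over index assignments. Membership in the list shows that every
tuple is visited, and its length counts rounds when loops serve as a clock. -/
theorem eval_loops (vs : List V) (c : Cmd V J r) (E : V → Fin n) :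
    ∃ l : List (V → Fin n), l.length = n ^ vs.length ∧ (∀ F, F ∈ l ↔ ∀ v ∉ vs, F v = E v) ∧
      ∀ D, (loops vs c).eval E D = l.foldl (fun D F => c.eval F D) D := by
  induction vs generalizing E with
  | nil => exact ⟨[E], by simp, fun F => by simp [funext_iff], fun D => rfl⟩
  | cons v vs ih =>
    choose l hl hl' hl'' using fun i => ih (update E v i)
    refine ⟨(List.finRange n).flatMap l, by simp [hl, pow_succ'], fun F => ?_, fun D => ?_⟩
    · rw [List.mem_flatMap]
      constructor
      · rintro ⟨i, -, hi⟩ v' hv'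
        rw [List.mem_cons, not_or] at hv'
        rw [(hl' i F).1 hi v' hv'.2, update_of_ne hv'.1]
      · intro h
        refine ⟨F v, List.mem_finRange _, (hl' _ _).2 fun v' hv' => ?_⟩
        by_cases e : v' = v
        · subst e; simp
        · rw [update_of_ne e, h v' (by simp [e, hv'])]
    · rw [show loops (v :: vs) c = iter v (loops vs c) from rfl, eval_iter, List.foldl_flatMap]
      simp only [hl'']

end Cmd

/-! ### Rules for the model checking of inclusion logic -/

/-- The index variables: three tuples of variables, two single variables and a constant `0`. -/
inductive Var (R : ℕ) : Type
  | w (i : Fin (R + 1))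
  | u (i : Fin (R + 1))
  | it (i : Fin (R + 1))
  | x
  | y
  | zero
  deriving DecidableEq

namespace Var

variable {R n : ℕ}

instance : Finite (Var R) :=
  .of_injective (β := Fin 3 × Option (Fin (R + 1)) ) (fun
    | w i => (0, some i)
    | u i => (1, some i)
    | it i => (2, some i)
    | x => (0, none)
    | y => (1, none)
    | zero => (2, none)) (by
    intro a b h
    cases a <;> cases b <;> simp at h ⊢ <;> exact h)

/-- The first tuple of variables. -/
def ws (R : ℕ) : List (Var R) := (List.finRange (R + 1)).map w

/-- The second tuple of variables. -/
def us (R : ℕ) : List (Var R) := (List.finRange (R + 1)).map u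

/-- The third tuple of variables. -/
def its (R : ℕ) : List (Var R) := (List.finRange (R + 1)).map it

theorem ws_nodup : (ws R).Nodup :=
  (List.nodup_finRange _).map fun i j h => by injection h

theorem us_nodup : (us R).Nodup :=
  (List.nodup_finRange _).map fun i j h => by injection h

theorem its_nodup : (its R).Nodup :=
  (List.nodup_finRange _).map fun i j h => by injection h

/-- Set the first tuple of variables. -/
def setW (E : Var R → Fin n) (s : Fin (R + 1) → Fin n) : Var R → Fin n
  | w i => s i
  | v => E v

/-- Set the second tuple of variables. -/
def setU (E : Var R → Fin n) (s : Fin (R + 1) → Fin n) : Var R → Fin n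
  | u i => s i
  | v => E v

theorem agree_ws {E F : Var R → Fin n} : (∀ v ∉ ws R, F v = E v) ↔ ∃ s, F = setW E s := by
  constructor
  · intro h
    refine ⟨fun i => F (w i), funext fun v => ?_⟩
    cases v <;> first | rfl | exact h _ (by simp [ws])
  · rintro ⟨s, rfl⟩ v hv
    cases v <;> first | rfl | exact absurd (by simp [ws]) hv

theorem agree_us {E F : Var R → Fin n} : (∀ v ∉ us R, F v = E v) ↔ ∃ s, F = setU E s := by
  constructor
  · intro h
    refine ⟨fun i => F (u i), funext fun v => ?_⟩
    cases v <;> first | rfl | exact h _ (by simp [us])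
  · rintro ⟨s, rfl⟩ v hv
    cases v <;> first | rfl | exact absurd (by simp [us]) hv

end Var

/-- Extend a tuple to length `r`. -/
def padTuple {α : Type*} {r k : ℕ} (z : α) (a : Fin k → α) (i : Fin r) : α :=
  if h : (i : ℕ) < k then a ⟨i, h⟩ else z

theorem padTuple_injective {α : Type*} {r k : ℕ} (hk : k ≤ r) (z : α) :
    Injective (padTuple (r := r) (k := k) z) := by
  intro a b h
  funext i
  have := congrFun h ⟨i, by omega⟩
  simpa [padTuple] using this

theorem comp_padTuple {α β : Type*} {r k : ℕ} (f : α → β) (z : α) (a : Fin k → α) :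
    f ∘ padTuple (r := r) z a = padTuple (f z) (f ∘ a) := by
  funext i
  simp only [comp_apply, padTuple]
  split_ifs <;> rfl

/-- Expressions always quantify over a full tuple of `R + 1` variables. Only its first `k`
coordinates are read, so this is the same as quantifying over `k` arguments. -/
theorem exists_coord {α : Type*} {R k : ℕ} (hk : k ≤ R + 1) (z : α) (P : (Fin k → α) → Prop) :
    (∃ s : Fin (R + 1) → α, P fun i => s (coord R i)) ↔ ∃ a, P a := by
  constructor
  · exact fun ⟨s, hs⟩ => ⟨_, hs⟩
  · rintro ⟨a, ha⟩
    refine ⟨padTuple z a, ?_⟩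
    convert ha with i
    have : ((coord R i : Fin (R + 1)) : ℕ) = i := Nat.mod_eq_of_lt (by omega)
    simp [padTuple, this]

/-- The arrays other than those of the subformulas: an error flag, equality, and the arrays of
the symbols in `Y`. -/
inductive Base (Y : Type) : Type
  | fail
  | eq
  | sym (y : Y)

theorem finite_base (Y : Type) [Finite Y] : Finite (Base Y) :=
  .of_injective (β := Option (Option Y)) (fun
    | .fail => none
    | .eq => some none
    | .sym y => some (some y)) (by
    intro a b h
    cases a <;> cases b <;> simp at h ⊢; exact h)

section symbols

variable {L : FirstOrder.Language.{u, v}} (τ : FiniteVocabulary L)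

/-- The positions of the function and relation symbols. -/
abbrev Symb : Type := Fin τ.funs.length ⊕ Fin τ.rels.length

/-- The arity of the relation for a symbol. -/
def symbArity : Symb τ → ℕ
  | .inl i => (τ.funs.get i).1 + 1
  | .inr i => (τ.rels.get i).1

/-- The relation for a symbol: for function symbols it is the graph. -/
def symbRel {A : Type w} (S : L.Structure A) : ∀ y : Symb τ, (Fin (symbArity τ y) → A) → Prop
  | .inl i, a => S.funMap (τ.funs.get i).2 (Fin.tail a) = a (0 : Fin ((τ.funs.get i).1 + 1))
  | .inr i, a => S.RelMap (τ.rels.get i).2 a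

open Classical in
/-- The position of a function symbol. -/
noncomputable def funEquiv : Fin τ.funs.length ≃ Σ k, L.Functions k :=
  τ.funs_nodup.getEquivOfForallMemList _ τ.mem_funs

open Classical in
/-- The position of a relation symbol. -/
noncomputable def relEquiv : Fin τ.rels.length ≃ Σ k, L.Relations k :=
  τ.rels_nodup.getEquivOfForallMemList _ τ.mem_rels

/-- Relations stored by position in the vocabulary come from a structure as soon as those of
function symbols are graphs. They are carried over to the symbols along the bijections `funEquiv`
and `relEquiv`. -/
theorem exists_symbRel {A : Type w} (P : ∀ y : Symb τ, (Fin (symbArity τ y) → A) → Prop)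
    (hP : ∀ i (a : Fin (τ.funs.get i).1 → A), ∃! x, P (.inl i) (Fin.cons (α := fun _ => A) x a)) :
    ∃ S : L.Structure A, symbRel τ S = P := by
  choose G hG hG' using hP
  let F := Equiv.piCongrLeft (fun g : Σ k, L.Functions k => (Fin g.1 → A) → A) (funEquiv τ) G
  let Q := Equiv.piCongrLeft (fun g : Σ k, L.Relations k => (Fin g.1 → A) → Prop) (relEquiv τ)
    fun i => P (.inr i)
  refine ⟨⟨fun f => F ⟨_, f⟩, fun R => Q ⟨_, R⟩⟩, funext fun y => funext fun a => propext ?_⟩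
  rcases y with i | i
  · have : F (τ.funs.get i) = G i := Equiv.piCongrLeft_apply_apply _ _ _ i
    change F (τ.funs.get i) _ = _ ↔ _
    have e : P (.inl i) (Fin.cons (α := fun _ => A) (a (0 : Fin ((τ.funs.get i).1 + 1)))
        (Fin.tail a)) ↔ P (.inl i) a := iff_of_eq (congrArg (P (.inl i)) (Fin.cons_self_tail a))
    rw [this, ← e]
    refine ⟨fun h => ?_, fun h => (hG' i (Fin.tail a) _ h).symm⟩
    have h' := hG i (Fin.tail a)
    rwa [h] at h'
  · have : Q (τ.rels.get i) = P (.inr i) := Equiv.piCongrLeft_apply_apply _ _ _ i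
    change Q (τ.rels.get i) a ↔ _
    rw [this]

variable {τ}

/-- The arrays of the symbols and of equality contain the relations of a structure. -/
structure Represents {N : Type} {R n : ℕ} [NeZero n] (S : L.Structure (Fin n))
    (D : Store (Base (Symb τ) ⊕ N) (R + 1) n) : Prop where
  eq : ∀ x y : Fin n, D.arr (.inl .eq) (padTuple 0 ![x, y]) = true ↔ x = y
  sym : ∀ y a, D.arr (.inl (.sym y)) (padTuple 0 a) = true ↔ symbRel τ S y a

theorem Represents.fun_iff {N : Type} {R n : ℕ} [NeZero n] {S : L.Structure (Fin n)}
    {D : Store (Base (Symb τ) ⊕ N) (R + 1) n} (h : Represents S D) {k : ℕ} (f : L.Functions k)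
    (a : Fin k → Fin n) (x : Fin n) :
    D.arr (.inl (.sym (.inl ((funEquiv τ).symm ⟨k, f⟩))))
      (padTuple 0 (Fin.cons (α := fun _ => Fin n) x a)) = true ↔ S.funMap f a = x := by
  -- The symbol at position `i` is a variable `g` here, so the equation can be substituted and no
  -- casts between arities appear.
  have key : ∀ i (g : Σ k, L.Functions k) (hg : τ.funs.get i = g) (a : Fin g.1 → Fin n) (x : Fin n),
      D.arr (.inl (.sym (.inl i))) (padTuple 0 (Fin.cons (α := fun _ => Fin n) x a)) = true ↔
        S.funMap g.2 a = x := by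
    rintro i _ rfl a x
    have := h.sym (.inl i) (Fin.cons (α := fun _ => Fin n) x a)
    exact this.trans Iff.rfl
  exact key _ ⟨k, f⟩ ((funEquiv τ).apply_symm_apply _) a x

theorem Represents.rel_iff {N : Type} {R n : ℕ} [NeZero n] {S : L.Structure (Fin n)}
    {D : Store (Base (Symb τ) ⊕ N) (R + 1) n} (h : Represents S D) {k : ℕ} (Q : L.Relations k)
    (a : Fin k → Fin n) :
    D.arr (.inl (.sym (.inr ((relEquiv τ).symm ⟨k, Q⟩)))) (padTuple 0 a) = true ↔
      S.RelMap Q a := by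
  have key : ∀ i (g : Σ k, L.Relations k) (hg : τ.rels.get i = g) (a : Fin g.1 → Fin n),
      D.arr (.inl (.sym (.inr i))) (padTuple 0 a) = true ↔ S.RelMap g.2 a := by
    rintro i _ rfl a
    exact h.sym (.inr i) a
  exact key _ ⟨k, Q⟩ ((relEquiv τ).apply_symm_apply _) a

end symbols

section rules

variable {L : FirstOrder.Language.{u, v}} (τ : FiniteVocabulary L) {N : Type} (R : ℕ)

/-- Expressions over the arrays for the symbols and for the subformulas. -/
abbrev RuleExp (N : Type) : Type := BExp (Var R) (Base (Symb τ) ⊕ N) (R + 1)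

variable {R}

open BExp Var

/-- The array of `p` holds of a tuple. -/
abbrev nodeAt (p : N) (a : Fin (R + 1) → Var R) : RuleExp τ R N := .arr (.inr p) a

/-- The relation for a symbol holds of a tuple. -/
abbrev symAt (y : Symb τ) {k : ℕ} (a : Fin k → Var R) : RuleExp τ R N :=
  .arr (.inl (.sym y)) (padTuple zero a)

/-- Two variables are equal. -/
abbrev eqAt (a b : Var R) : RuleExp τ R N := .arr (.inl .eq) (padTuple zero ![a, b])

/-- The conditions of `TermFamily` as rules: a tuple has to be removed from an array if the
expression is false. -/
noncomputable def termRules : ∀ t : L.Term ℕ, (TermNode t → N) → List (N × RuleExp τ R N)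
  | .var z, emb => [(emb (none : Option Empty), eqAt τ (w (Fin.last R)) (w (coord R z)))]
  | .func (l := k) f ts, emb =>
    (emb (none : Option (Σ i, TermNode (ts i))), exs (us R)
      (and (conj ((List.finRange k).map fun i =>
          nodeAt τ (emb (some ⟨i, .root (ts i)⟩)) (update w (Fin.last R) (u (coord R i)))))
        (symAt τ (.inl ((funEquiv τ).symm ⟨k, f⟩))
          (Fin.cons (α := fun _ => Var R) (w (Fin.last R)) fun i : Fin k => u (coord R i))))) ::
    (List.finRange k).flatMap fun i => termRules (ts i) fun p => emb (some ⟨i, p⟩)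

/-- The conditions of `Family` as rules. -/
noncomputable def rules : ∀ φ : IncFormula L, (Node φ → N) → List (N × RuleExp τ R N)
  | .eq t t', emb =>
    (emb (none : Option (TermNode t ⊕ TermNode t')), ex x
      (and (nodeAt τ (emb (some (.inl (.root t)))) (update w (Fin.last R) x))
        (nodeAt τ (emb (some (.inr (.root t')))) (update w (Fin.last R) x)))) ::
    (termRules τ t (fun p => emb (some (.inl p))) ++ termRules τ t' fun p => emb (some (.inr p)))
  | .neq t t', emb =>
    (emb (none : Option (TermNode t ⊕ TermNode t')), ex x (ex y
      (and (nodeAt τ (emb (some (.inl (.root t)))) (update w (Fin.last R) x))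
        (and (nodeAt τ (emb (some (.inr (.root t')))) (update w (Fin.last R) y))
          (not (eqAt τ x y)))))) ::
    (termRules τ t (fun p => emb (some (.inl p))) ++ termRules τ t' fun p => emb (some (.inr p)))
  | .rel (k := k) Q ts, emb =>
    (emb (none : Option (Σ i, TermNode (ts i))), exs (us R)
      (and (conj ((List.finRange k).map fun i =>
          nodeAt τ (emb (some ⟨i, .root (ts i)⟩)) (update w (Fin.last R) (u (coord R i)))))
        (symAt τ (.inr ((relEquiv τ).symm ⟨k, Q⟩)) fun i : Fin k => u (coord R i)))) ::
    (List.finRange k).flatMap fun i => termRules τ (ts i) fun p => emb (some ⟨i, p⟩)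
  | .nrel (k := k) Q ts, emb =>
    (emb (none : Option (Σ i, TermNode (ts i))), exs (us R)
      (and (conj ((List.finRange k).map fun i =>
          nodeAt τ (emb (some ⟨i, .root (ts i)⟩)) (update w (Fin.last R) (u (coord R i)))))
        (not (symAt τ (.inr ((relEquiv τ).symm ⟨k, Q⟩)) fun i : Fin k => u (coord R i))))) ::
    (List.finRange k).flatMap fun i => termRules τ (ts i) fun p => emb (some ⟨i, p⟩)
  | .incl (k := k) ts us', emb =>
    (emb (none : Option ((Σ i, TermNode (ts i)) ⊕ (Σ i, TermNode (us' i)))), exs (us R)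
      (and (nodeAt τ (emb (none : Option ((Σ i, TermNode (ts i)) ⊕ (Σ i, TermNode (us' i))))) u)
        (conj ((List.finRange k).map fun i => ex x
          (and (nodeAt τ (emb (some (.inl ⟨i, .root (ts i)⟩))) (update w (Fin.last R) x))
            (nodeAt τ (emb (some (.inr ⟨i, .root (us' i)⟩))) (update u (Fin.last R) x))))))) ::
    (((List.finRange k).flatMap fun i => termRules τ (ts i) fun p => emb (some (.inl ⟨i, p⟩))) ++
      (List.finRange k).flatMap fun i => termRules τ (us' i) fun p => emb (some (.inr ⟨i, p⟩)))
  | .and φ ψ, emb =>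
    (emb (none : Option (Node φ ⊕ Node ψ)), and (nodeAt τ (emb (some (.inl (.root φ)))) w)
      (nodeAt τ (emb (some (.inr (.root ψ)))) w)) ::
    (emb (some (.inl (.root φ))), nodeAt τ (emb (none : Option (Node φ ⊕ Node ψ))) w) ::
    (emb (some (.inr (.root ψ))), nodeAt τ (emb (none : Option (Node φ ⊕ Node ψ))) w) ::
    (rules φ (fun p => emb (some (.inl p))) ++ rules ψ fun p => emb (some (.inr p)))
  | .or φ ψ, emb =>
    (emb (none : Option (Node φ ⊕ Node ψ)), or (nodeAt τ (emb (some (.inl (.root φ)))) w)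
      (nodeAt τ (emb (some (.inr (.root ψ)))) w)) ::
    (emb (some (.inl (.root φ))), nodeAt τ (emb (none : Option (Node φ ⊕ Node ψ))) w) ::
    (emb (some (.inr (.root ψ))), nodeAt τ (emb (none : Option (Node φ ⊕ Node ψ))) w) ::
    (rules φ (fun p => emb (some (.inl p))) ++ rules ψ fun p => emb (some (.inr p)))
  | .ex z φ, emb =>
    (emb (none : Option (Node φ)),
      ex x (nodeAt τ (emb (some (.root φ))) (update w (coord R z) x))) ::
    (emb (some (.root φ)),
      ex x (nodeAt τ (emb (none : Option (Node φ))) (update w (coord R z) x))) ::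
    rules φ fun p => emb (some p)
  | .all z φ, emb =>
    (emb (none : Option (Node φ)),
      all x (nodeAt τ (emb (some (.root φ))) (update w (coord R z) x))) ::
    (emb (some (.root φ)),
      ex x (nodeAt τ (emb (none : Option (Node φ))) (update w (coord R z) x))) ::
    rules φ fun p => emb (some p)

/-- The properties of rules that make the elimination algorithm work. -/
def GoodRule (ρ : N × RuleExp τ R N) : Prop :=
  ρ.2.Polar true ∧ ρ.2.Fresh {v | ∃ i, v = w i ∨ v = it i}

variable {τ}

theorem fresh_exs_us {e : RuleExp τ R N}
    (he : e.Fresh {v | ∃ i, v = w i ∨ v = it i ∨ v = u i}) :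
    (exs (us R) e).Fresh {v | ∃ i, v = w i ∨ v = it i} := by
  refine fresh_exs us_nodup (by simp [us]) (he.anti ?_)
  rintro v (⟨i, h | h⟩ | h)
  · exact ⟨i, .inl h⟩
  · exact ⟨i, .inr (.inl h)⟩
  · obtain ⟨i, -, rfl⟩ := List.mem_map.1 h
    exact ⟨i, .inr (.inr rfl)⟩

theorem goodRule_termRules (t : L.Term ℕ) (emb : TermNode t → N) :
    ∀ ρ ∈ termRules (R := R) τ t emb, GoodRule τ ρ := by
  induction t with
  | var z => simp [termRules, GoodRule, Polar, Fresh]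
  | func f ts ih =>
    rw [termRules, List.forall_mem_cons]
    refine ⟨⟨?_, fresh_exs_us ?_⟩, fun ρ h => ?_⟩
    · simp [polar_exs, Polar, polar_conj]
    · simp [Fresh, fresh_conj]
    · obtain ⟨i, -, h⟩ := List.mem_flatMap.1 h
      exact ih i _ _ h

/-- Explicit negations only meet equality and relation symbols; those hidden in disjunctions and
universal quantifiers come in pairs. The quantified variables `u`, `x`, `y` differ from the loop
variables `w` and `it`. -/
theorem goodRule_rules (φ : IncFormula L) (emb : Node φ → N) :
    ∀ ρ ∈ rules (R := R) τ φ emb, GoodRule τ ρ := by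
  induction φ with
  | eq t t' | neq t t' =>
    rw [rules, List.forall_mem_cons, List.forall_mem_append]
    exact ⟨by simp [GoodRule, Polar, Fresh], goodRule_termRules t _, goodRule_termRules t' _⟩
  | rel Q ts | nrel Q ts =>
    rw [rules, List.forall_mem_cons]
    refine ⟨⟨?_, fresh_exs_us ?_⟩, fun ρ h => ?_⟩
    · simp [polar_exs, Polar, polar_conj]
    · simp [Fresh, fresh_conj]
    · obtain ⟨i, -, h⟩ := List.mem_flatMap.1 h
      exact goodRule_termRules (ts i) _ _ h
  | incl ts us' =>
    rw [rules, List.forall_mem_cons, List.forall_mem_append]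
    refine ⟨⟨?_, fresh_exs_us ?_⟩, fun ρ h => ?_, fun ρ h => ?_⟩
    · simp [polar_exs, Polar, polar_conj]
    · simp [Fresh, fresh_conj]
    · obtain ⟨i, -, h⟩ := List.mem_flatMap.1 h
      exact goodRule_termRules (ts i) _ _ h
    · obtain ⟨i, -, h⟩ := List.mem_flatMap.1 h
      exact goodRule_termRules (us' i) _ _ h
  | and φ ψ ih₁ ih₂ | or φ ψ ih₁ ih₂ =>
    rw [rules, List.forall_mem_cons, List.forall_mem_cons, List.forall_mem_cons,
      List.forall_mem_append]
    exact ⟨by simp [GoodRule, BExp.or, Polar, Fresh], by simp [GoodRule, Polar, Fresh],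
      by simp [GoodRule, Polar, Fresh], ih₁ _, ih₂ _⟩
  | ex z φ ih | all z φ ih =>
    rw [rules, List.forall_mem_cons, List.forall_mem_cons]
    exact ⟨by simp [GoodRule, BExp.all, Polar, Fresh], by simp [GoodRule, Polar, Fresh], ih _⟩

variable {n : ℕ}

section

variable {D : Store (Base (Symb τ) ⊕ N) (R + 1) n} {E : Var R → Fin n}

theorem eval_nodeAt {p : N} {a : Fin (R + 1) → Var R} :
    (nodeAt τ p a).eval E D = true ↔ D.arr (.inr p) (E ∘ a) = true := Iff.rfl

theorem setW_comp_w (s : Fin (R + 1) → Fin n) : setW E s ∘ w = s := rfl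
theorem setU_comp_w (s : Fin (R + 1) → Fin n) : setU E s ∘ w = E ∘ w := rfl
theorem setU_comp_u (s : Fin (R + 1) → Fin n) : setU E s ∘ u = s := rfl

theorem update_x_comp_w (i : Fin n) : update E x i ∘ w = E ∘ w := by
  funext j; simp

theorem update_x_comp_u (i : Fin n) : update E x i ∘ u = E ∘ u := by
  funext j; simp

theorem update_y_comp_w (i : Fin n) : update E y i ∘ w = E ∘ w := by
  funext j; simp

theorem eval_exs_us {e : RuleExp τ R N} :
    (exs (us R) e).eval E D = true ↔ ∃ s, e.eval (setU E s) D = true := by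
  rw [eval_exs]
  constructor
  · rintro ⟨F, hF, h⟩
    obtain ⟨s, rfl⟩ := agree_us.1 hF
    exact ⟨s, h⟩
  · rintro ⟨s, h⟩
    exact ⟨_, agree_us.2 ⟨s, rfl⟩, h⟩

end

variable [NeZero n] {S : L.Structure (Fin n)}
  {D : Store (Base (Symb τ) ⊕ N) (R + 1) n} {E : Var R → Fin n}

theorem eval_eqAt (hD : ∀ a b : Fin n, D.arr (.inl .eq) (padTuple 0 ![a, b]) = true ↔ a = b)
    (hE : E zero = 0) {a b : Var R} :
    (eqAt τ a b : RuleExp τ R N).eval E D = true ↔ E a = E b := by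
  rw [← hD, BExp.eval_arr, comp_padTuple, hE]
  congr! 2
  congr 1
  funext i
  fin_cases i <;> rfl

theorem eval_symAt (hE : E zero = 0) {y : Symb τ} {k : ℕ} {a : Fin k → Var R} :
    (symAt τ y a : RuleExp τ R N).eval E D = true ↔
      D.arr (.inl (.sym y)) (padTuple 0 (E ∘ a)) = true := by
  rw [BExp.eval_arr, comp_padTuple, hE]

theorem Represents.eval_fun (hD : Represents S D) (hE : E zero = 0) {k : ℕ} {f : L.Functions k}
    {a : Fin k → Var R} {v : Var R} :
    (symAt τ (.inl ((funEquiv τ).symm ⟨k, f⟩)) (Fin.cons (α := fun _ => Var R) v a) :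
      RuleExp τ R N).eval E D = true ↔ S.funMap f (E ∘ a) = E v := by
  rw [eval_symAt hE, ← hD.fun_iff]
  congr! 2
  congr 1
  funext i
  cases i using Fin.cases <;> rfl

theorem Represents.eval_rel (hD : Represents S D) (hE : E zero = 0) {k : ℕ} {Q : L.Relations k}
    {a : Fin k → Var R} :
    (symAt τ (.inr ((relEquiv τ).symm ⟨k, Q⟩)) a : RuleExp τ R N).eval E D = true ↔
      S.RelMap Q (E ∘ a) := by
  rw [eval_symAt hE, ← hD.rel_iff]

/-- The rules for `φ` do not apply to any tuple if and only if the arrays form a family. -/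
theorem termRules_iff (hD : Represents S D) (hE : E zero = 0) (t : L.Term ℕ) (ht : TermBelow R t)
    (emb : TermNode t → N) :
    (∀ ρ ∈ termRules (R := R) τ t emb, ∀ s, D.arr (.inr ρ.1) s = true →
      ρ.2.eval (setW E s) D = true) ↔
    TermFamily S t fun p => {s | D.arr (.inr (emb p)) s = true} := by
  have hW : ∀ s, setW E s zero = 0 := fun s => hE
  have hU : ∀ s s', setU (setW E s) s' zero = 0 := fun s s' => hE
  induction t with
  | var z =>
    rw [termRules, List.forall_mem_singleton]
    refine forall_congr' fun s => imp_congr_right fun _ => ?_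
    rw [eval_eqAt hD.eq (hW s)]
    rfl
  | func f ts ih =>
    rw [termRules, List.forall_mem_cons, TermFamily]
    refine and_congr (forall_congr' fun s => imp_congr_right fun _ => ?_) ?_
    · rw [eval_exs_us, ← exists_coord (Nat.le_succ_of_le ht.1.le) 0]
      refine exists_congr fun s' => ?_
      rw [eval_and, eval_conj, hD.eval_fun (hU s s')]
      refine and_congr ?_ Iff.rfl
      simp only [List.forall_mem_map, List.mem_finRange, forall_const, eval_nodeAt, comp_update,
        setU_comp_w, setW_comp_w]
      rfl
    · rw [← forall_congr' fun i => ih i (ht.2 i) fun p => emb (some ⟨i, p⟩)]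
      simp only [List.mem_flatMap, List.mem_finRange, true_and, forall_exists_index]
      exact forall_comm

/-- The rules transcribe the clauses of `Family` one by one, with `w` holding the tuple under test.
A family is therefore a store in which no rule removes anything. -/
theorem rules_iff (hD : Represents S D) (hE : E zero = 0) (φ : IncFormula L) (hφ : φ.Below R)
    (emb : Node φ → N) :
    (∀ ρ ∈ rules (R := R) τ φ emb, ∀ s, D.arr (.inr ρ.1) s = true →
      ρ.2.eval (setW E s) D = true) ↔
    Family S φ fun p => {s | D.arr (.inr (emb p)) s = true} := by
  have hW : ∀ s, setW E s zero = 0 := fun s => hE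
  have hU : ∀ s s', setU (setW E s) s' zero = 0 := fun s s' => hE
  have terms : ∀ {k} (ts : Fin k → L.Term ℕ) (hts : ∀ i, TermBelow R (ts i))
      (emb : ∀ i, TermNode (ts i) → N),
      (∀ ρ ∈ (List.finRange k).flatMap fun i => termRules τ (ts i) (emb i), ∀ s,
        D.arr (.inr ρ.1) s = true → ρ.2.eval (setW E s) D = true) ↔
      ∀ i, TermFamily S (ts i) fun p => {s | D.arr (.inr (emb i p)) s = true} := by
    intro k ts hts emb
    rw [← forall_congr' fun i => termRules_iff hD hE (ts i) (hts i) (emb i)]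
    simp only [List.mem_flatMap, List.mem_finRange, true_and, forall_exists_index]
    exact forall_comm
  induction φ with
  | eq t t' =>
    rw [rules, List.forall_mem_cons, List.forall_mem_append, termRules_iff hD hE t hφ.1,
      termRules_iff hD hE t' hφ.2, Family]
    refine and_congr_left' (forall_congr' fun s => imp_congr_right fun _ => ?_)
    simp only [eval_ex, eval_and, eval_nodeAt, comp_update, update_x_comp_w, setW_comp_w,
      update_self]
    rfl
  | neq t t' =>
    rw [rules, List.forall_mem_cons, List.forall_mem_append, termRules_iff hD hE t hφ.1,
      termRules_iff hD hE t' hφ.2, Family]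
    refine and_congr_left' (forall_congr' fun s => imp_congr_right fun _ => ?_)
    simp only [eval_ex, eval_and, eval_nodeAt, comp_update, update_x_comp_w, update_y_comp_w,
      setW_comp_w, update_self, eval_not]
    refine exists_congr fun a => exists_congr fun b => ?_
    rw [eval_eqAt hD.eq (by simp [hW])]
    simp
  | rel Q ts =>
    rw [rules, List.forall_mem_cons, terms ts hφ.2, Family]
    refine and_congr_left' (forall_congr' fun s => imp_congr_right fun _ => ?_)
    rw [eval_exs_us, ← exists_coord (Nat.le_succ_of_le hφ.1.le) 0]
    refine exists_congr fun s' => ?_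
    rw [eval_and, eval_conj, hD.eval_rel (hU s s')]
    refine and_congr ?_ Iff.rfl
    simp only [List.forall_mem_map, List.mem_finRange, forall_const, eval_nodeAt, comp_update,
      setU_comp_w, setW_comp_w]
    rfl
  | nrel Q ts =>
    rw [rules, List.forall_mem_cons, terms ts hφ.2, Family]
    refine and_congr_left' (forall_congr' fun s => imp_congr_right fun _ => ?_)
    rw [eval_exs_us, ← exists_coord (Nat.le_succ_of_le hφ.1.le) 0]
    refine exists_congr fun s' => ?_
    rw [eval_and, eval_conj, eval_not, hD.eval_rel (hU s s')]
    refine and_congr ?_ Iff.rfl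
    simp only [List.forall_mem_map, List.mem_finRange, forall_const, eval_nodeAt, comp_update,
      setU_comp_w, setW_comp_w]
    rfl
  | incl ts us' =>
    rw [rules, List.forall_mem_cons, List.forall_mem_append, terms ts fun i => (hφ i).1,
      terms us' fun i => (hφ i).2, Family]
    refine and_congr_left' (forall_congr' fun s => imp_congr_right fun _ => ?_)
    rw [eval_exs_us]
    refine exists_congr fun s' => ?_
    simp only [eval_and, eval_conj, List.forall_mem_map, List.mem_finRange, forall_const, eval_ex,
      eval_nodeAt, comp_update, update_x_comp_w, update_x_comp_u, setU_comp_w, setU_comp_u,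
      setW_comp_w, update_self]
    rfl
  | and φ ψ ih₁ ih₂ =>
    rw [rules, List.forall_mem_cons, List.forall_mem_cons, List.forall_mem_cons,
      List.forall_mem_append, Family]
    refine and_congr (forall_congr' fun s => imp_congr_right fun _ => ?_)
      (and_congr Iff.rfl (and_congr Iff.rfl (and_congr (ih₁ hφ.1 _) (ih₂ hφ.2 _))))
    rw [eval_and]
    rfl
  | or φ ψ ih₁ ih₂ =>
    rw [rules, List.forall_mem_cons, List.forall_mem_cons, List.forall_mem_cons,
      List.forall_mem_append, Family]
    refine and_congr (forall_congr' fun s => imp_congr_right fun _ => ?_)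
      (and_congr Iff.rfl (and_congr Iff.rfl (and_congr (ih₁ hφ.1 _) (ih₂ hφ.2 _))))
    rw [eval_or]
    rfl
  | ex z φ ih =>
    rw [rules, List.forall_mem_cons, List.forall_mem_cons, Family]
    refine and_congr ?_ (and_congr ?_ (ih hφ.2 _)) <;>
    · refine forall_congr' fun s => imp_congr_right fun _ => ?_
      simp only [eval_ex, eval_nodeAt, comp_update, update_x_comp_w, setW_comp_w, update_self]
      rfl
  | all z φ ih =>
    rw [rules, List.forall_mem_cons, List.forall_mem_cons, Family]
    refine and_congr ?_ (and_congr ?_ (ih hφ.2 _)) <;>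
    · refine forall_congr' fun s => imp_congr_right fun _ => ?_
      simp only [eval_ex, eval_all, eval_nodeAt, comp_update, update_x_comp_w, setW_comp_w,
        update_self]
      rfl

end rules

/-! ### Greatest fixed points by elimination -/

theorem foldl_invariant {α β : Type*} {f : α → β → α} {l : List β} (P : α → Prop)
    (h : ∀ b ∈ l, ∀ a, P a → P (f a b)) {a : α} (ha : P a) : P (l.foldl f a) := by
  induction l generalizing a with
  | nil => exact ha
  | cons b l ih => exact ih (fun b' hb' => h b' (by simp [hb'])) (h b (by simp) a ha)

theorem foldl_establish {α β : Type*} {f : α → β → α} {l : List β} (P : α → Prop)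
    (h : ∀ b ∈ l, ∀ a, P a → P (f a b)) {b : β} (hb : b ∈ l) (hP : ∀ a, P (f a b)) (a : α) :
    P (l.foldl f a) := by
  induction l generalizing a with
  | nil => simp at hb
  | cons b' l ih =>
    rw [List.mem_cons] at hb
    rcases hb with rfl | hb
    · rw [List.foldl_cons]
      exact foldl_invariant P (fun b' hb' => h b' (by simp [hb'])) (hP a)
    · exact ih (fun b' hb' => h b' (by simp [hb'])) hb _

/-- A pass of steps that each do nothing or lower `μ` can fail to lower `μ` only if none of its
steps changed the state. This detects the fixed point. -/
theorem foldl_shrinks {α β : Type*} {f : α → β → α} (μ : α → ℕ) {l : List β}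
    (h : ∀ b ∈ l, ∀ a, f a b = a ∨ μ (f a b) < μ a) (a : α) :
    (l.foldl f a = a ∧ ∀ b ∈ l, f a b = a) ∨ μ (l.foldl f a) < μ a := by
  induction l generalizing a with
  | nil => exact .inl ⟨rfl, by simp⟩
  | cons b l ih =>
    rw [List.foldl_cons]
    have ih' := ih (fun b' hb' => h b' (by simp [hb'])) (f a b)
    rcases h b (by simp) a with e | e
    · rw [e] at ih' ⊢
      rcases ih' with ih' | ih'
      · exact .inl ⟨ih'.1, List.forall_mem_cons.2 ⟨e, ih'.2⟩⟩
      · exact .inr ih'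
    · rcases ih' with ih' | ih'
      · exact .inr (by rwa [ih'.1])
      · exact .inr (ih'.trans e)

/-- As long as `P` fails, each round lowers `μ`, so more rounds than the initial `μ` suffice. Once
`P` holds the state no longer changes, so superfluous rounds are harmless and no termination test is
needed. -/
theorem foldl_reaches {α β : Type*} {f : α → β → α} (μ : α → ℕ) (P I : α → Prop) {l : List β}
    (hI : ∀ b ∈ l, ∀ a, I a → I (f a b)) (h : ∀ b ∈ l, ∀ a, I a → P a ∨ μ (f a b) < μ a)
    (hP : ∀ b ∈ l, ∀ a, I a → P a → f a b = a) {a : α} (ha : I a) (hl : μ a < l.length) :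
    P (l.foldl f a) := by
  induction l generalizing a with
  | nil => simp at hl
  | cons b l ih =>
    rcases h b (by simp) a ha with e | e
    · refine (foldl_invariant (fun a => I a ∧ P a) (fun b' hb' a ha => ?_) ⟨ha, e⟩).2
      rwa [hP b' hb' a ha.1 ha.2]
    · refine ih (fun b' hb' => hI b' (by simp [hb'])) (fun b' hb' => h b' (by simp [hb']))
        (fun b' hb' => hP b' (by simp [hb'])) (hI b (by simp) a ha) ?_
      rw [List.length_cons] at hl
      omega

namespace Store

variable {J : Type} {r n : ℕ} [DecidableEq J]

theorem write_arr (D : Store J r n) (j : J) (t : Fin r → Fin n) (b : Bool) (j' : J)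
    (t' : Fin r → Fin n) :
    (D.write j t b).arr j' t' = if j' = j ∧ t' = t then b else D.arr j' t' := by
  by_cases h : j' = j
  · subst h
    by_cases h' : t' = t
    · subst h'; simp [write]
    · simp [write, h']
  · simp [write, h]

theorem write_arr_self (D : Store J r n) (j : J) (t : Fin r → Fin n) :
    D.write j t (D.arr j t) = D := by
  simp [write]

variable [Fintype J]

/-- The number of entries that are `true`. -/
def weight (D : Store J r n) : ℕ :=
  Finset.card {q : J × (Fin r → Fin n) | D.arr q.1 q.2 = true}

omit [DecidableEq J] in
theorem weight_le (D : Store J r n) : D.weight ≤ Fintype.card J * n ^ r := by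
  refine (Finset.card_le_univ _).trans ?_
  simp

/-- Conjoining an entry with a bit can only turn `true` into `false`. -/
theorem write_shrinks (D : Store J r n) (j : J) (t : Fin r → Fin n) (b : Bool) :
    D.write j t (D.arr j t && b) = D ∨ (D.write j t (D.arr j t && b)).weight < D.weight := by
  by_cases h : (D.arr j t && b) = D.arr j t
  · left
    rw [h, write_arr_self]
  · right
    have hD : D.arr j t = true := by
      by_contra h'
      rw [Bool.not_eq_true] at h'
      simp [h'] at h
    have hb : b = false := by
      by_contra h'
      rw [Bool.not_eq_false] at h'
      simp [h'] at h
    subst hb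
    refine Finset.card_lt_card ((Finset.ssubset_iff_of_subset ?_).2 ⟨(j, t), by simp [hD], ?_⟩)
    · rintro ⟨j', t'⟩ h'
      simp only [Finset.mem_filter, Finset.mem_univ, true_and, write_arr] at h' ⊢
      split_ifs at h' with h''
      · simp at h'
      · exact h'
    · simp [write_arr]

end Store

section elimination

variable {L : FirstOrder.Language.{u, v}} {τ : FiniteVocabulary L} {N : Type} {R : ℕ}

open BExp Var

/-- Remove from the array of a rule the tuples for which the rule is false. -/
def ruleSweep (ρ : N × RuleExp τ R N) : Cmd (Var R) (Base (Symb τ) ⊕ N) (R + 1) :=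
  .loops (ws R) (.assign (.inr ρ.1) w (and (nodeAt τ ρ.1 w) ρ.2))

/-- Apply all rules to all tuples. -/
def sweep (l : List (N × RuleExp τ R N)) : Cmd (Var R) (Base (Symb τ) ⊕ N) (R + 1) :=
  .seqs (l.map ruleSweep)

/-- Apply all rules so often that no tuple is left to which a rule applies. -/
def eliminate (l : List (N × RuleExp τ R N)) (m : ℕ) :
    Cmd (Var R) (Base (Symb τ) ⊕ N) (R + 1) :=
  .seqs (List.replicate m (.loops (its R) (sweep l)))

/-- Make all arrays of subformulas `true`. -/
noncomputable def fill [Fintype N] : Cmd (Var R) (Base (Symb τ) ⊕ N) (R + 1) :=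
  .seqs ((Finset.univ : Finset N).toList.map fun p => .loops (ws R) (.assign (.inr p) w .tt))

theorem fresh_eliminate {l : List (N × RuleExp τ R N)} (hl : ∀ ρ ∈ l, GoodRule τ ρ) (m : ℕ) :
    (eliminate l m).Fresh ∅ := by
  refine Cmd.fresh_seqs.2 fun c hc => ?_
  rw [List.eq_of_mem_replicate hc]
  refine Cmd.fresh_loops its_nodup (by simp) (Cmd.fresh_seqs.2 fun c hc => ?_)
  obtain ⟨ρ, hρ, rfl⟩ := List.mem_map.1 hc
  refine Cmd.fresh_loops ws_nodup (by simp [ws, its]) ⟨trivial, (hl ρ hρ).2.anti ?_⟩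
  rintro v ((h | h) | h)
  · exact h.elim
  · obtain ⟨i, -, rfl⟩ := List.mem_map.1 h
    exact ⟨i, .inr rfl⟩
  · obtain ⟨i, -, rfl⟩ := List.mem_map.1 h
    exact ⟨i, .inl rfl⟩

theorem fresh_fill [Fintype N] : (fill : Cmd (Var R) (Base (Symb τ) ⊕ N) (R + 1)).Fresh ∅ := by
  refine Cmd.fresh_seqs.2 fun c hc => ?_
  obtain ⟨p, -, rfl⟩ := List.mem_map.1 hc
  exact Cmd.fresh_loops ws_nodup (by simp) trivial

theorem avoids_sweep (l : List (N × RuleExp τ R N)) (c : Base (Symb τ)) :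
    (sweep l).Avoids (.inl c) := by
  refine Cmd.avoids_seqs.2 fun d hd => ?_
  obtain ⟨ρ, -, rfl⟩ := List.mem_map.1 hd
  exact Cmd.avoids_loops.2 (by simp [Cmd.Avoids])

theorem avoids_eliminate (l : List (N × RuleExp τ R N)) (m : ℕ) (c : Base (Symb τ)) :
    (eliminate l m).Avoids (.inl c) := by
  refine Cmd.avoids_seqs.2 fun d hd => ?_
  rw [List.eq_of_mem_replicate hd]
  exact Cmd.avoids_loops.2 (avoids_sweep l c)

theorem avoids_fill [Fintype N] (c : Base (Symb τ)) :
    (fill : Cmd (Var R) (Base (Symb τ) ⊕ N) (R + 1)).Avoids (.inl c) := by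
  refine Cmd.avoids_seqs.2 fun d hd => ?_
  obtain ⟨p, -, rfl⟩ := List.mem_map.1 hd
  exact Cmd.avoids_loops.2 (by simp [Cmd.Avoids])

variable {n : ℕ} [NeZero n] [DecidableEq N] [DecidableEq (Base (Symb τ))]

/-- The effect of a rule at one tuple. -/
def ruleStep (E : Var R → Fin n) (D : Store (Base (Symb τ) ⊕ N) (R + 1) n)
    (q : (N × RuleExp τ R N) × (Fin (R + 1) → Fin n)) : Store (Base (Symb τ) ⊕ N) (R + 1) n :=
  D.write (.inr q.1.1) q.2 (D.arr (.inr q.1.1) q.2 && q.1.2.eval (setW E q.2) D)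

/-- A sweep is a fold of single steps over all pairs of a rule and a tuple. Later steps see the
effect of earlier ones; the arguments on elimination are insensitive to the order. -/
theorem eval_sweep (l : List (N × RuleExp τ R N)) (E : Var R → Fin n) :
    ∃ m : List ((N × RuleExp τ R N) × (Fin (R + 1) → Fin n)),
      (∀ q, q ∈ m ↔ q.1 ∈ l) ∧ ∀ D, (sweep l).eval E D = m.foldl (ruleStep E) D := by
  induction l with
  | nil => exact ⟨[], by simp, fun D => rfl⟩
  | cons ρ l ih =>
    obtain ⟨m, hm, hm'⟩ := ih
    obtain ⟨k, -, hk, hk'⟩ := Cmd.eval_loops (ws R)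
      (.assign (.inr ρ.1) w (and (nodeAt τ ρ.1 w) ρ.2)) E
    refine ⟨(k.map fun F => (ρ, F ∘ w)) ++ m, fun q => ?_, fun D => ?_⟩
    · rw [List.mem_append, List.mem_map, hm, List.mem_cons]
      refine or_congr_left ⟨?_, fun h => ⟨setW E q.2, (hk _).2 (agree_ws.2 ⟨_, rfl⟩), ?_⟩⟩
      · rintro ⟨F, -, rfl⟩
        rfl
      · rw [setW_comp_w, ← h]
    · rw [List.foldl_append, ← hm']
      change (sweep l).eval E ((ruleSweep ρ).eval E D) = _
      congr 1
      rw [ruleSweep, hk', List.foldl_map]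
      refine List.foldl_ext _ _ _ fun D F hF => ?_
      obtain ⟨s, rfl⟩ := agree_ws.1 ((hk F).1 hF)
      rfl

/-- The variables `it` are not read by good rules and merely count to `n ^ (R + 1)`; for any rules,
the resulting assignments leave `zero` untouched, as the evaluation of base arrays requires. -/
theorem eval_eliminate (l : List (N × RuleExp τ R N)) (m : ℕ) (E : Var R → Fin n) :
    ∃ k : List (Var R → Fin n), k.length = m * n ^ (R + 1) ∧ (∀ F ∈ k, F zero = E zero) ∧
      ∀ D, (eliminate l m).eval E D = k.foldl (fun D F => (sweep l).eval F D) D := by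
  obtain ⟨k, hk, hk', hk''⟩ := Cmd.eval_loops (its R) (sweep l) E
  refine ⟨(List.replicate m k).flatten, ?_, fun F hF => ?_, fun D => ?_⟩
  · simp [hk, its]
  · obtain ⟨k', h, hF⟩ := List.mem_flatten.1 hF
    rw [List.eq_of_mem_replicate h] at hF
    exact (hk' F).1 hF _ (by simp [its])
  · rw [eliminate, Cmd.eval_seqs, List.foldl_flatten]
    induction m generalizing D with
    | zero => rfl
    | succ m ih =>
      rw [List.replicate_succ, List.replicate_succ, List.foldl_cons, List.foldl_cons, hk'', ih]

theorem eval_fill [Fintype N] (E : Var R → Fin n) (D : Store (Base (Symb τ) ⊕ N) (R + 1) n)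
    (p : N) (s : Fin (R + 1) → Fin n) : (fill.eval E D).arr (.inr p) s = true := by
  have hl : ∀ p', ∃ l : List (Var R → Fin n),
      (∀ s, setW E s ∈ l) ∧ ∀ D : Store (Base (Symb τ) ⊕ N) (R + 1) n,
        (Cmd.loops (ws R) (.assign (.inr p') w .tt)).eval E D =
          l.foldl (fun D F => D.write (.inr p') (F ∘ w) true) D := by
    intro p'
    obtain ⟨l, -, hl, hl'⟩ := Cmd.eval_loops (ws R)
      (.assign (.inr p') w .tt : Cmd (Var R) (Base (Symb τ) ⊕ N) (R + 1)) E
    exact ⟨l, fun s => (hl _).2 (agree_ws.2 ⟨s, rfl⟩), hl'⟩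
  have keep : ∀ p' t (D : Store (Base (Symb τ) ⊕ N) (R + 1) n), D.arr (.inr p) s = true →
      (D.write (.inr p') t true).arr (.inr p) s = true := by
    intro p' t D h
    rw [Store.write_arr]
    split_ifs
    · rfl
    · exact h
  rw [fill, Cmd.eval_seqs, List.foldl_map]
  refine foldl_establish (fun D : Store (Base (Symb τ) ⊕ N) (R + 1) n => D.arr (.inr p) s = true)
    (fun p' _ D h => ?_) (b := p) (by simp) (fun D => ?_) D
  · obtain ⟨l, -, hl⟩ := hl p'
    rw [hl]
    exact foldl_invariant (fun D : Store (Base (Symb τ) ⊕ N) (R + 1) n => D.arr (.inr p) s = true)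
      (fun F _ D => keep _ _ D) h
  · obtain ⟨l, hl, hl'⟩ := hl p
    rw [hl']
    refine foldl_establish (fun D : Store (Base (Symb τ) ⊕ N) (R + 1) n => D.arr (.inr p) s = true)
      (fun F _ D => keep _ _ D) (hl s) (fun D => ?_) D
    rw [Store.write_arr, if_pos ⟨rfl, rfl⟩]

variable {S : L.Structure (Fin n)}

omit [DecidableEq N] [DecidableEq (Base (Symb τ))] in
theorem Represents.congr {D D' : Store (Base (Symb τ) ⊕ N) (R + 1) n} (hD : Represents S D)
    (h : ∀ c, D'.arr (.inl c) = D.arr (.inl c)) : Represents S D' :=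
  ⟨fun x y => by rw [h, hD.eq], fun y a => by rw [h, hD.sym]⟩

/-- The elimination yields a family. -/
theorem family_eliminate [Fintype N] [Fintype (Base (Symb τ))] (φ : IncFormula L)
    (hφ : φ.Below R) (emb : Node φ → N) {E : Var R → Fin n} (hE : E zero = 0)
    {D : Store (Base (Symb τ) ⊕ N) (R + 1) n} (hD : Represents S D) :
    Family S φ fun p => {s | ((eliminate (rules τ φ emb)
      (Fintype.card (Base (Symb τ) ⊕ N) + 1)).eval E D).arr (.inr (emb p)) s = true} := by
  obtain ⟨k, hk, hk', hk''⟩ := eval_eliminate (rules τ φ emb)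
    (Fintype.card (Base (Symb τ) ⊕ N) + 1) E
  rw [hk'']
  refine foldl_reaches Store.weight
    (fun D => Family S φ fun p => {s | D.arr (.inr (emb p)) s = true}) (Represents S)
    (fun F _ D hD => hD.congr fun c => (avoids_sweep _ c).eval_arr F D)
    (fun F hF D hD => ?_) (fun F hF D hD h => ?_) hD ?_
  · obtain ⟨m, hm, hm'⟩ := eval_sweep (rules τ φ emb) F
    rw [hm']
    -- Either the sweep removed something, or every single step was idle; in the latter case each
    -- rule is true at each tuple still present.
    refine (foldl_shrinks Store.weight (fun q _ D => Store.write_shrinks _ _ _ _) D).imp_left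
      fun h => ?_
    rw [← rules_iff hD ((hk' F hF).trans hE) φ hφ emb]
    intro ρ hρ s hs
    have h' := h.2 (ρ, s) ((hm _).2 hρ)
    have h'' : (ruleStep F D (ρ, s)).arr (.inr ρ.1) s = true :=
      (congrArg (fun D' => D'.arr (.inr ρ.1) s) h').trans hs
    rw [ruleStep, Store.write_arr, if_pos ⟨rfl, rfl⟩, Bool.and_eq_true] at h''
    exact h''.2
  · rw [← rules_iff hD ((hk' F hF).trans hE) φ hφ emb] at h
    obtain ⟨m, hm, hm'⟩ := eval_sweep (rules τ φ emb) F
    rw [hm']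
    refine foldl_invariant (fun D' => D' = D) ?_ rfl
    rintro ⟨ρ, s⟩ hq _ rfl
    rw [ruleStep]
    rw [Bool.and_eq_left_iff_imp.2 (h ρ ((hm _).1 hq) s), Store.write_arr_self]
  · rw [hk]
    refine lt_of_le_of_lt (Store.weight_le D) ?_
    have := Nat.pos_of_ne_zero (pow_ne_zero (R + 1) (NeZero.ne n))
    exact Nat.mul_lt_mul_of_pos_right (Nat.lt_succ_self _) this

/-- A family that is contained in the arrays is not affected by the elimination. -/
theorem subset_eliminate (φ : IncFormula L) [DecidableEq (Node φ)]
    (hφ : φ.Below R) {E : Var R → Fin n} (hE : E zero = 0)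
    {D : Store (Base (Symb τ) ⊕ Node φ) (R + 1) n}
    (hD : Represents S D) {T : Node φ → Set (Fin (R + 1) → Fin n)} (hT : Family S φ T) (m : ℕ)
    (h : ∀ p, ∀ s ∈ T p, D.arr (.inr p) s = true) (p : Node φ) (s : Fin (R + 1) → Fin n)
    (hs : s ∈ T p) : ((eliminate (rules τ φ id) m).eval E D).arr (.inr p) s = true := by
  classical
  obtain ⟨k, -, hk', hk''⟩ := eval_eliminate (rules τ φ id) m E
  rw [hk'']
  refine (foldl_invariant (fun D : Store (Base (Symb τ) ⊕ Node φ) (R + 1) n =>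
    Represents S D ∧ ∀ p, ∀ s ∈ T p, D.arr (.inr p) s = true) (fun F hF D hD => ?_)
    ⟨hD, h⟩).2 p s hs
  refine ⟨hD.1.congr fun c => (avoids_sweep _ c).eval_arr F D, ?_⟩
  obtain ⟨l, hl, hl'⟩ := eval_sweep (rules τ φ id) F
  rw [hl']
  refine (foldl_invariant (fun D : Store (Base (Symb τ) ⊕ Node φ) (R + 1) n =>
    Represents S D ∧ ∀ p, ∀ s ∈ T p, D.arr (.inr p) s = true) ?_ hD).2
  rintro ⟨ρ, t⟩ hq D ⟨hD, h⟩
  refine ⟨hD.congr fun c => funext fun s => (Store.write_arr _ _ _ _ _ _).trans (if_neg (by simp)),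
    fun p s hs => ?_⟩
  rw [ruleStep, Store.write_arr]
  split_ifs with e
  · obtain ⟨e₁, rfl⟩ := e
    obtain rfl := Sum.inr_injective e₁
    rw [Bool.and_eq_true]
    refine ⟨h _ _ hs, ?_⟩
    -- In the store `Q` the node arrays are exactly the family, so every rule holds at its tuples.
    -- As `Q` is contained in `D` and rules are positive, they hold there in `D` as well.
    let Q : Store (Base (Symb τ) ⊕ Node φ) (R + 1) n :=
      ⟨Sum.elim (fun c => D.arr (.inl c)) fun p s => decide (s ∈ T p), D.inp⟩
    have hQ : Represents S Q := hD.congr fun c => rfl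
    have hQ' := (rules_iff hQ ((hk' F hF).trans hE) φ hφ id).2 (by simpa [Q] using hT)
    refine (Polar.mono (D := Q) (D' := D) rfl (fun c => rfl) fun p s hs =>
      h p s (by simpa [Q] using hs)).1
      (goodRule_rules φ id ρ ((hl _).1 hq)).1 _ (hQ' ρ ((hl _).1 hq) s (by simpa [Q] using hs))
  · exact h p s hs

end elimination

/-! ### Decoding of structures -/

theorem iterFor_congr {α : Type*} {f g : ℕ → α → α} {m : ℕ} (h : ∀ i < m, ∀ a, f i a = g i a)
    (a : α) : iterFor f m a = iterFor g m a := by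
  induction m with
  | zero => rfl
  | succ m ih => rw [iterFor, iterFor, ih fun i hi => h i (by omega), h m (Nat.lt_succ_self m)]

theorem iterFor_add {α : Type*} (f : ℕ → α → α) (m k : ℕ) (a : α) :
    iterFor f (m + k) a = iterFor (fun i => f (m + i)) k (iterFor f m a) := by
  induction k with
  | zero => rfl
  | succ k ih => rw [← Nat.add_assoc, iterFor, ih, iterFor]

theorem iterFor_mul {α : Type*} (f : ℕ → α → α) (m k : ℕ) (a : α) :
    iterFor f (m * k) a = iterFor (fun d => iterFor (fun p => f (m * d + p)) m) k a := by
  induction k with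
  | zero => rfl
  | succ k ih => rw [Nat.mul_succ, iterFor_add, ih, iterFor]

/-- The digits of `p` to base `n`. -/
def digits (n k : ℕ) [NeZero n] (p : ℕ) (i : Fin k) : Fin n := Fin.ofNat n (p / n ^ (i : ℕ))

theorem finFunctionFinEquiv_symm_eq {n k : ℕ} [NeZero n] (p : Fin (n ^ k)) :
    finFunctionFinEquiv.symm p = digits n k p := rfl

theorem digits_finFunctionFinEquiv {n k : ℕ} [NeZero n] (a : Fin k → Fin n) :
    digits n k (finFunctionFinEquiv a : Fin (n ^ k)) = a := by
  rw [← finFunctionFinEquiv_symm_eq, Equiv.symm_apply_apply]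

theorem digits_injOn {n k : ℕ} [NeZero n] {p q : ℕ} (hp : p < n ^ k) (hq : q < n ^ k)
    (h : digits n k p = digits n k q) : p = q := by
  have := finFunctionFinEquiv.symm.injective (a₁ := (⟨p, hp⟩ : Fin (n ^ k))) (a₂ := ⟨q, hq⟩) h
  exact congrArg Fin.val this

theorem length_charWord {n k : ℕ} (P : (Fin k → Fin n) → Prop) : (charWord P).length = n ^ k := by
  simp [charWord]

theorem getElem?_charWord {n k : ℕ} [NeZero n] (P : (Fin k → Fin n) → Prop)
    [DecidablePred P] {p : ℕ}
    (hp : p < n ^ k) : (charWord P)[p]? = some (decide (P (digits n k p))) := by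
  rw [charWord, List.getElem?_ofFn, dif_pos hp, finFunctionFinEquiv_symm_eq]
  congr

section decoding

variable {L : FirstOrder.Language.{u, v}} (τ : FiniteVocabulary L) (N : Type) {R : ℕ}

open BExp Var

/-- The first `k` variables of the second tuple, in reverse order. -/
def digitVars (R : ℕ) : ℕ → List (Var R)
  | 0 => []
  | k + 1 => u (coord R k) :: digitVars R k

theorem mem_digitVars {k : ℕ} {v : Var R} : v ∈ digitVars R k ↔ ∃ j < k, v = u (coord R j) := by
  induction k with
  | zero => simp [digitVars]
  | succ k ih =>
    rw [digitVars, List.mem_cons, ih]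
    constructor
    · rintro (rfl | ⟨j, hj, rfl⟩)
      · exact ⟨k, by omega, rfl⟩
      · exact ⟨j, by omega, rfl⟩
    · rintro ⟨j, hj, rfl⟩
      rcases Nat.lt_succ_iff_lt_or_eq.1 hj with hj | rfl
      · exact .inr ⟨j, hj, rfl⟩
      · exact .inl rfl

theorem val_coord {k : ℕ} (hk : k ≤ R) : (coord R k : ℕ) = k := Nat.mod_eq_of_lt (by omega)

theorem digitVars_nodup {k : ℕ} (hk : k ≤ R + 1) : (digitVars R k).Nodup := by
  induction k with
  | zero => exact List.nodup_nil
  | succ k ih =>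
    refine List.nodup_cons.2 ⟨fun h => ?_, ih (by omega)⟩
    obtain ⟨j, hj, h⟩ := mem_digitVars.1 h
    injection h with h
    have := congrArg Fin.val h
    rw [val_coord (by omega), val_coord (by omega)] at this
    omega

/-- Set the first `k` variables of the second tuple to the digits of `p`. -/
def setDigits {n : ℕ} [NeZero n] (E : Var R → Fin n) (k p : ℕ) : Var R → Fin n
  | u i => if (i : ℕ) < k then Fin.ofNat n (p / n ^ (i : ℕ)) else E (u i)
  | v => E v

theorem setDigits_update {n : ℕ} [NeZero n] (E : Var R → Fin n) {k d p : ℕ} (hk : k ≤ R)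
    (hp : p < n ^ k) : setDigits (update E (u (coord R k)) (Fin.ofNat n d)) k p =
      setDigits E (k + 1) (n ^ k * d + p) := by
  funext v
  cases v with
  | u i =>
    rw [setDigits, setDigits]
    rcases lt_trichotomy (i : ℕ) k with h | h | h
    · rw [if_pos h, if_pos (by omega)]
      apply Fin.ext
      rw [Fin.val_ofNat, Fin.val_ofNat]
      obtain ⟨m, rfl⟩ := Nat.exists_eq_add_of_lt h
      -- After division by `n ^ i` with `i < k`, the summand `n ^ k * d` is a multiple of `n` and
      -- does not affect the digit.
      have e : n ^ ((i : ℕ) + m + 1) * d + p = p + n ^ (i : ℕ) * (n * (n ^ m * d)) := by ring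
      rw [e, Nat.add_mul_div_left _ _ (Nat.pos_of_ne_zero (pow_ne_zero _ (NeZero.ne n))),
        Nat.add_mul_mod_self_left]
    · have e : i = coord R k := Fin.ext (by rw [val_coord hk, h])
      rw [if_neg (by omega), if_pos (by omega), e, update_self, val_coord hk,
        Nat.mul_add_div (Nat.pos_of_ne_zero (pow_ne_zero _ (NeZero.ne n))), Nat.div_eq_of_lt hp,
        Nat.add_zero]
    · rw [if_neg (by omega), if_neg (by omega), update_of_ne]
      rintro h'
      injection h' with h'
      rw [h', val_coord hk] at h
      omega
  | _ => simp [setDigits]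

/-- The outermost loop runs over the most significant digit. Thus the tuples appear in the order of
their positions in a characteristic word, and a stream can be read sequentially. -/
theorem eval_digit_loops {J : Type} [DecidableEq J] {r n k : ℕ} [NeZero n] (hk : k ≤ R + 1)
    (c : Cmd (Var R) J r) (E : Var R → Fin n) (D : Store J r n) :
    (Cmd.loops (digitVars R k) c).eval E D =
      iterFor (fun p D => c.eval (setDigits E k p) D) (n ^ k) D := by
  induction k generalizing E D with
  | zero =>
    rw [pow_zero]
    change c.eval E D = c.eval (setDigits E 0 0) D
    congr 1
    funext v
    cases v <;> simp [setDigits]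
  | succ k ih =>
    rw [pow_succ, iterFor_mul]
    refine iterFor_congr (fun d _ D => ?_) D
    rw [← Cmd.loops, ih (by omega)]
    refine iterFor_congr (fun p hp D => ?_) D
    rw [setDigits_update E (by omega) hp]

variable {N}

/-- The error flag. -/
abbrev failExp : RuleExp τ R N := .arr (.inl .fail) fun _ => zero

variable {τ}

/-- Read the characteristic word of the relation for a symbol. -/
def readSym (y : Symb τ) : Cmd (Var R) (Base (Symb τ) ⊕ N) (R + 1) :=
  .loops (digitVars R (symbArity τ y)) (.seq
    (.assign (.inl .fail) (fun _ => zero) (or (failExp τ) .eof))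
    (.read (.inl (.sym y)) (padTuple zero fun i : Fin (symbArity τ y) => u (coord R i))))

theorem fresh_readSym {y : Symb τ} (hy : symbArity τ y ≤ R + 1) :
    (readSym y : Cmd (Var R) (Base (Symb τ) ⊕ N) (R + 1)).Fresh ∅ :=
  Cmd.fresh_loops (digitVars_nodup hy) (by simp) (by simp [Cmd.Fresh, BExp.or, Fresh])

theorem avoids_readSym {y : Symb τ} {j : Base (Symb τ) ⊕ N} (hj : j ≠ .inl .fail)
    (hy : j ≠ .inl (.sym y)) :
    (readSym y : Cmd (Var R) (Base (Symb τ) ⊕ N) (R + 1)).Avoids j :=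
  Cmd.avoids_loops.2 ⟨hj, hy⟩

variable {n : ℕ} [NeZero n]

/-- The value of the error flag. -/
def failed (D : Store (Base (Symb τ) ⊕ N) (R + 1) n) : Bool := D.arr (.inl .fail) fun _ => 0

/-- The relation that is stored in the array of a symbol. -/
def storedRel (D : Store (Base (Symb τ) ⊕ N) (R + 1) n) (y : Symb τ)
    (a : Fin (symbArity τ y) → Fin n) : Prop :=
  D.arr (.inl (.sym y)) (padTuple 0 a) = true

instance (D : Store (Base (Symb τ) ⊕ N) (R + 1) n) (y : Symb τ) :
    DecidablePred (storedRel D y) := fun _ => inferInstanceAs (Decidable (_ = _))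

variable [DecidableEq N] [DecidableEq (Base (Symb τ))]

/-- The end of the stream is tested before each read, so the flag is set exactly if fewer than `n ^
k` bits are left, where `k` is the arity. Bits missing at the end are read as `false`. -/
theorem eval_readSym {y : Symb τ} (hy : symbArity τ y ≤ R + 1) {E : Var R → Fin n}
    (hE : E zero = 0) (D : Store (Base (Symb τ) ⊕ N) (R + 1) n) :
    (failed ((readSym y).eval E D) = true ↔
      failed D = true ∨ D.inp.length < n ^ symbArity τ y) ∧
    ((readSym y).eval E D).inp = D.inp.drop (n ^ symbArity τ y) ∧
    ∀ p < n ^ symbArity τ y,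
      ((readSym y).eval E D).arr (.inl (.sym y)) (padTuple 0 (digits n (symbArity τ y) p)) =
        D.inp[p]?.getD false := by
  rw [readSym, eval_digit_loops hy]
  have key : ∀ m ≤ n ^ symbArity τ y, ∀ D', D' = iterFor (fun p D => (Cmd.seq
      (.assign (.inl .fail) (fun _ => zero) (or (failExp τ) .eof))
      (.read (.inl (.sym y)) (padTuple zero fun i : Fin (symbArity τ y) => u (coord R i)))).eval
        (setDigits E (symbArity τ y) p) D) m D →
      (failed D' = true ↔ failed D = true ∨ D.inp.length < m) ∧ D'.inp = D.inp.drop m ∧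
      ∀ p < m, D'.arr (.inl (.sym y)) (padTuple 0 (digits n (symbArity τ y) p)) =
        D.inp[p]?.getD false := by
    intro m
    induction m with
    | zero =>
      rintro _ D' rfl
      simp
    | succ m ih =>
      rintro hm D' rfl
      obtain ⟨h₁, h₂, h₃⟩ := ih (by omega) _ rfl
      rw [iterFor]
      generalize iterFor _ m D = D' at h₁ h₂ h₃
      have e : (setDigits E (symbArity τ y) m) ∘
          (padTuple (r := R + 1) zero fun i : Fin (symbArity τ y) => u (coord R i)) =
          padTuple 0 (digits n (symbArity τ y) m) := by
        rw [comp_padTuple]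
        congr 1
        funext i
        rw [comp_apply, setDigits, val_coord (by omega), if_pos i.2, digits]
      have hz : setDigits E (symbArity τ y) m zero = 0 := hE
      refine ⟨?_, ?_, fun p hp => ?_⟩
      · have : failed ((Cmd.seq
            (.assign (.inl .fail) (fun _ => zero) (or (failExp τ) .eof))
            (.read (.inl (.sym y)) (padTuple zero fun i : Fin (symbArity τ y) =>
              u (coord R i)))).eval (setDigits E (symbArity τ y) m) D') =
            (or (failExp τ) .eof : RuleExp τ R N).eval (setDigits E (symbArity τ y) m) D' := by
          simp [failed, Cmd.eval, Store.write_arr, hz]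
        rw [this, eval_or, BExp.eval_arr]
        simp only [BExp.eval, List.isEmpty_iff, h₂, List.drop_eq_nil_iff]
        rw [show (setDigits E (symbArity τ y) m ∘ fun _ : Fin (R + 1) => zero) = fun _ => 0 from
          funext fun _ => hz]
        change failed D' = true ∨ _ ↔ _
        rw [h₁, or_assoc]
        exact or_congr_right (by omega)
      · simp only [Cmd.eval]
        change D'.inp.tail = _
        rw [h₂, List.tail_drop]
      · simp only [Cmd.eval, Store.write_arr]
        rw [show (fun i => setDigits E (symbArity τ y) m ((padTuple (r := R + 1) zero
          fun i : Fin (symbArity τ y) => u (coord R i)) i)) = _ from e]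
        rcases Nat.lt_succ_iff_lt_or_eq.1 hp with hp | rfl
        · rw [if_neg, if_neg (by simp), h₃ p hp]
          -- Distinct positions below `n ^ k` have distinct digits and padding is injective, so
          -- earlier entries are not overwritten.
          rintro ⟨-, h⟩
          have := digits_injOn (by omega) (by omega) (padTuple_injective hy 0 h)
          omega
        · rw [if_pos ⟨trivial, rfl⟩]
          change D'.inp.head?.getD false = _
          rw [h₂, List.head?_drop]
  exact key _ le_rfl _ rfl

theorem readSym_charWord {y : Symb τ} (hy : symbArity τ y ≤ R + 1) {E : Var R → Fin n}
    (hE : E zero = 0) {D : Store (Base (Symb τ) ⊕ N) (R + 1) n} (hD : failed D = false)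
    {P : (Fin (symbArity τ y) → Fin n) → Prop} {z : List Bool} (hz : D.inp = charWord P ++ z) :
    failed ((readSym y).eval E D) = false ∧ ((readSym y).eval E D).inp = z ∧
      storedRel ((readSym y).eval E D) y = P := by
  classical
  obtain ⟨h₁, h₂, h₃⟩ := eval_readSym hy hE D
  refine ⟨?_, ?_, funext fun a => ?_⟩
  · rw [← Bool.not_eq_true, h₁, hD, hz]
    simp [length_charWord]
  · rw [h₂, hz, ← length_charWord P, List.drop_left]
  · have := h₃ _ (finFunctionFinEquiv a).2
    rw [digits_finFunctionFinEquiv, hz, List.getElem?_append_left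
      (by rw [length_charWord]; exact (finFunctionFinEquiv a).2),
      getElem?_charWord _ (finFunctionFinEquiv a).2, digits_finFunctionFinEquiv] at this
    rw [storedRel, this]
    simp

/-- Every word of length `n ^ k` is the characteristic word of some relation. Hence, without a
failure, the bits consumed are the word of the relation just stored; this is what makes rejection of
invalid codes correct. -/
theorem inp_eq_of_readSym {y : Symb τ} (hy : symbArity τ y ≤ R + 1) {E : Var R → Fin n}
    (hE : E zero = 0)
    {D : Store (Base (Symb τ) ⊕ N) (R + 1) n} (hD : failed ((readSym y).eval E D) = false) :
    failed D = false ∧ D.inp = charWord (storedRel ((readSym y).eval E D) y) ++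
      ((readSym y).eval E D).inp := by
  obtain ⟨h₁, h₂, h₃⟩ := eval_readSym hy hE D
  rw [← Bool.not_eq_true, h₁, not_or, Bool.not_eq_true, not_lt] at hD
  refine ⟨hD.1, ?_⟩
  rw [h₂]
  nth_rw 1 [← List.take_append_drop (n ^ symbArity τ y) D.inp]
  congr 1
  apply List.ext_getElem?
  intro p
  by_cases hp : p < n ^ symbArity τ y
  · rw [getElem?_charWord _ hp, List.getElem?_take_of_lt hp]
    have := h₃ p hp
    rw [List.getElem?_eq_getElem (by omega)] at this ⊢
    simp [storedRel, this]
  · rw [List.getElem?_eq_none (by rw [List.length_take]; omega),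
      List.getElem?_eq_none (by rw [length_charWord]; omega)]

omit [DecidableEq N] [DecidableEq (Base (Symb τ))] in
theorem storedRel_congr {D D' : Store (Base (Symb τ) ⊕ N) (R + 1) n} {y : Symb τ}
    (h : D'.arr (.inl (.sym y)) = D.arr (.inl (.sym y))) : storedRel D' y = storedRel D y := by
  funext a
  rw [storedRel, storedRel, h]

/-- Read the characteristic words of the relations for several symbols. -/
def readSyms (l : List (Symb τ)) : Cmd (Var R) (Base (Symb τ) ⊕ N) (R + 1) :=
  .seqs (l.map readSym)

omit [DecidableEq N] [DecidableEq (Base (Symb τ))] in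
theorem avoids_readSyms {l : List (Symb τ)} {j : Base (Symb τ) ⊕ N} (hj : j ≠ .inl .fail)
    (hl : ∀ y ∈ l, j ≠ .inl (.sym y)) :
    (readSyms l : Cmd (Var R) (Base (Symb τ) ⊕ N) (R + 1)).Avoids j := by
  refine Cmd.avoids_seqs.2 fun c hc => ?_
  obtain ⟨y, hy, rfl⟩ := List.mem_map.1 hc
  exact avoids_readSym hj (hl y hy)

variable (hτ : ∀ y, symbArity τ y ≤ R + 1)

include hτ

/-- Each symbol is read once, so the array filled for it is not touched while the later symbols are
read. -/
theorem readSyms_charWord {l : List (Symb τ)} (hl : l.Nodup) {E : Var R → Fin n}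
    (hE : E zero = 0) {D : Store (Base (Symb τ) ⊕ N) (R + 1) n} (hD : failed D = false)
    {P : ∀ y, (Fin (symbArity τ y) → Fin n) → Prop} {z : List Bool}
    (hz : D.inp = (l.flatMap fun y => charWord (P y)) ++ z) :
    failed ((readSyms l).eval E D) = false ∧ ((readSyms l).eval E D).inp = z ∧
      ∀ y ∈ l, storedRel ((readSyms l).eval E D) y = P y := by
  induction l generalizing D with
  | nil => exact ⟨hD, hz, by simp⟩
  | cons y l ih =>
    rw [List.nodup_cons] at hl
    rw [List.flatMap_cons, List.append_assoc] at hz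
    obtain ⟨h₁, h₂, h₃⟩ := readSym_charWord (hτ y) hE hD hz
    obtain ⟨h₁', h₂', h₃'⟩ := ih hl.2 h₁ h₂
    refine ⟨h₁', h₂', List.forall_mem_cons.2 ⟨?_, h₃'⟩⟩
    rw [← h₃]
    change storedRel ((readSyms l).eval E ((readSym y).eval E D)) y = _
    refine storedRel_congr ((avoids_readSyms (j := .inl (.sym y)) (by simp)
      fun y' hy' h => ?_).eval_arr E _)
    injection h with h
    injection h with h
    exact hl.1 (h ▸ hy')

theorem inp_eq_of_readSyms {l : List (Symb τ)} (hl : l.Nodup) {E : Var R → Fin n}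
    (hE : E zero = 0)
    {D : Store (Base (Symb τ) ⊕ N) (R + 1) n} (hD : failed ((readSyms l).eval E D) = false) :
    failed D = false ∧ D.inp =
      (l.flatMap fun y => charWord (storedRel ((readSyms l).eval E D) y)) ++
        ((readSyms l).eval E D).inp := by
  induction l generalizing D with
  | nil => exact ⟨hD, rfl⟩
  | cons y l ih =>
    rw [List.nodup_cons] at hl
    obtain ⟨h₁, h₂⟩ := ih hl.2 (D := (readSym y).eval E D) hD
    obtain ⟨h₁', h₂'⟩ := inp_eq_of_readSym (hτ y) hE h₁
    refine ⟨h₁', ?_⟩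
    rw [h₂', List.flatMap_cons, List.append_assoc, h₂]
    congr 2
    refine (storedRel_congr ((avoids_readSyms (j := .inl (.sym y)) (by simp)
      fun y' hy' h => ?_).eval_arr E _)).symm
    injection h with h
    injection h with h
    exact hl.1 (h ▸ hy')

end decoding

/-! ### The model checking algorithm -/

section program

variable {L : FirstOrder.Language.{u, v}} (τ : FiniteVocabulary L) {N : Type} {R : ℕ}

open BExp Var

/-- All symbols. -/
def symbols : List (Symb τ) :=
  (List.finRange τ.funs.length).map .inl ++ (List.finRange τ.rels.length).map .inr

theorem mem_symbols (y : Symb τ) : y ∈ symbols τ := by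
  rcases y with i | i <;> simp [symbols]

theorem symbols_nodup : (symbols τ).Nodup :=
  ((List.nodup_finRange _).map Sum.inl_injective).append
    ((List.nodup_finRange _).map Sum.inr_injective) (by simp [List.disjoint_left])

theorem flatMap_eq_flatMap_finRange {α β : Type*} (l : List α) (f : α → List β) :
    l.flatMap f = (List.finRange l.length).flatMap fun i => f (l.get i) := by
  conv_lhs => rw [← List.map_get_finRange l]
  rw [List.flatMap_map]

/-- Functions enter through their graphs, so both kinds of symbols are decoded uniformly as a
sequence of characteristic words. -/
theorem encodeStructure_eq {n : ℕ} (S : L.Structure (Fin n)) :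
    encodeStructure τ S = List.replicate n true ++ false ::
      (symbols τ).flatMap fun y => charWord (symbRel τ S y) := by
  rw [encodeStructure, symbols, List.flatMap_append, List.flatMap_map, List.flatMap_map,
    flatMap_eq_flatMap_finRange τ.funs, flatMap_eq_flatMap_finRange τ.rels]
  simp only [List.append_assoc, List.singleton_append]
  rfl

/-- Initialize the array for equality. -/
def initEq : Cmd (Var R) (Base (Symb τ) ⊕ N) (R + 1) :=
  .iter x (.assign (.inl .eq) (padTuple zero ![x, x]) .tt)

/-- The array for the function symbol at position `i` is the graph of a function. -/
def graphExp (i : Fin τ.funs.length) : RuleExp τ R N :=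
  not (exs (us R) (not (ex x (and
    (symAt τ (.inl i) (Fin.cons (α := fun _ => Var R) x fun j : Fin (τ.funs.get i).1 =>
      u (coord R j)))
    (not (ex y (and
      (symAt τ (.inl i) (Fin.cons (α := fun _ => Var R) y fun j : Fin (τ.funs.get i).1 =>
        u (coord R j)))
      (not (eqAt τ y x)))))))))

/-- Check that the input is used up and that the arrays of the function symbols are graphs. -/
def checkInput : Cmd (Var R) (Base (Symb τ) ⊕ N) (R + 1) :=
  .assign (.inl .fail) (fun _ => zero)
    (not (and (not (failExp τ)) (and .eof (conj ((List.finRange _).map (graphExp τ))))))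

/-- Decode the input. -/
def decodeInput : Cmd (Var R) (Base (Symb τ) ⊕ N) (R + 1) :=
  .seq (initEq τ) (.seq (readSyms (symbols τ)) (checkInput τ))

theorem fresh_decodeInput (hτ : ∀ y, symbArity τ y ≤ R + 1) :
    (decodeInput τ : Cmd (Var R) (Base (Symb τ) ⊕ N) (R + 1)).Fresh ∅ := by
  refine ⟨⟨by simp, trivial⟩, Cmd.fresh_seqs.2 fun c hc => ?_, ?_⟩
  · obtain ⟨y, -, rfl⟩ := List.mem_map.1 hc
    exact fresh_readSym (hτ y)
  · refine ⟨trivial, trivial, fresh_conj.2 fun e he => ?_⟩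
    obtain ⟨i, -, rfl⟩ := List.mem_map.1 he
    exact fresh_exs us_nodup (by simp) (by simp [us, Fresh])

variable {n : ℕ} [NeZero n] {τ}

theorem eval_graphExp [DecidableEq N] [DecidableEq (Base (Symb τ))]
    {D : Store (Base (Symb τ) ⊕ N) (R + 1) n}
    (hD : ∀ a b : Fin n, D.arr (.inl .eq) (padTuple 0 ![a, b]) = true ↔ a = b)
    {E : Var R → Fin n} (hE : E zero = 0) {i : Fin τ.funs.length}
    (hi : symbArity τ (.inl i) ≤ R + 1) :
    (graphExp τ i).eval E D = true ↔ ∀ a : Fin (τ.funs.get i).1 → Fin n,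
      ∃! b, storedRel D (.inl i) (Fin.cons (α := fun _ => Fin n) b a) := by
  have hi' : (τ.funs.get i).1 ≤ R + 1 := (Nat.le_succ _).trans hi
  have e : ∀ (E : Var R → Fin n) (v : Var R), E ∘ (Fin.cons (α := fun _ => Var R) v
      fun j : Fin (τ.funs.get i).1 => u (coord R j)) =
      Fin.cons (α := fun _ => Fin n) (E v) fun j : Fin (τ.funs.get i).1 => E (u (coord R j)) := by
    intro E v
    funext j
    cases j using Fin.cases <;> rfl
  -- Negating both sides exposes an existential quantifier over tuples, to which `exists_coord`
  -- applies.
  rw [graphExp, eval_not, eval_exs_us, ← not_iff_not, not_not, not_forall,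
    ← exists_coord hi' (0 : Fin n)]
  refine exists_congr fun s => ?_
  rw [eval_not, eval_ex]
  refine not_congr (exists_congr fun b => ?_)
  rw [eval_and, eval_symAt (by simpa [setU] using hE), eval_not, eval_ex, e]
  refine and_congr (by rw [update_self]; rfl) ?_
  simp only [not_exists]
  refine forall_congr' fun c => ?_
  rw [eval_and, eval_symAt (by simpa [setU] using hE), eval_not, e,
    eval_eqAt hD (by simpa [setU] using hE), not_and_not_right, update_self, update_of_ne (by simp),
    update_self]
  rfl

variable [DecidableEq N] [DecidableEq (Base (Symb τ))]

/-- Only diagonal pairs are ever written. With `1 ≤ R` an array has at least two coordinates, so a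
pair can be recovered from its padding. -/
theorem eval_initEq (hR : 1 ≤ R) {E : Var R → Fin n} (hE : E zero = 0)
    {D : Store (Base (Symb τ) ⊕ N) (R + 1) n}
    (hD : ∀ s, D.arr (.inl .eq) s = false) (a b : Fin n) :
    ((initEq τ).eval E D).arr (.inl .eq) (padTuple 0 ![a, b]) = true ↔ a = b := by
  rw [initEq, Cmd.eval_iter]
  have e : ∀ c : Fin n, (update E x c) ∘ padTuple (r := R + 1) zero ![x, x] =
      padTuple 0 ![c, c] := fun c => by
    rw [comp_padTuple, update_of_ne (by simp), hE]
    congr 1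
    funext i
    fin_cases i <;> simp
  have step : ∀ (D : Store (Base (Symb τ) ⊕ N) (R + 1) n) (c : Fin n),
      (Cmd.assign (.inl .eq) (padTuple zero ![x, x]) .tt).eval (update E x c) D =
        D.write (.inl .eq) (padTuple 0 ![c, c]) true := fun D c => by
    rw [← e c]
    rfl
  simp only [step]
  constructor
  · intro h
    have := foldl_invariant (f := fun (D : Store (Base (Symb τ) ⊕ N) (R + 1) n) c =>
      D.write (.inl .eq) (padTuple 0 ![c, c]) true) (l := List.finRange n)
      (fun D => ∀ s, D.arr (.inl .eq) s = true → ∃ c, s = padTuple 0 ![c, c])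
      (fun c _ D hD s hs => by
        rw [Store.write_arr] at hs
        split_ifs at hs with h
        · exact ⟨c, h.2⟩
        · exact hD s hs) (fun s hs => by simp [hD] at hs) _ h
    obtain ⟨c, hc⟩ := this
    have hc := padTuple_injective (by omega) 0 hc
    exact (congrFun hc 0).trans (congrFun hc 1).symm
  · rintro rfl
    refine foldl_establish
      (fun D : Store (Base (Symb τ) ⊕ N) (R + 1) n =>
        D.arr (.inl .eq) (padTuple 0 ![a, a]) = true) (fun c _ D hD => ?_)
      (List.mem_finRange a) (fun D => ?_) D
    · rw [Store.write_arr]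
      split_ifs
      · rfl
      · exact hD
    · rw [Store.write_arr, if_pos ⟨rfl, rfl⟩]

/-- The store with the input `z` in which all entries are `false`. -/
def emptyStore (N : Type) (τ : FiniteVocabulary L) (R n : ℕ) (z : List Bool) :
    Store (Base (Symb τ) ⊕ N) (R + 1) n := ⟨fun _ _ => false, z⟩

theorem eval_checkInput {D : Store (Base (Symb τ) ⊕ N) (R + 1) n}
    (hD : ∀ a b : Fin n, D.arr (.inl .eq) (padTuple 0 ![a, b]) = true ↔ a = b)
    (hτ : ∀ y, symbArity τ y ≤ R + 1) {E : Var R → Fin n} (hE : E zero = 0) :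
    failed ((checkInput τ).eval E D) = false ↔ failed D = false ∧ D.inp = [] ∧
      ∀ i (a : Fin (τ.funs.get i).1 → Fin n),
        ∃! b, storedRel D (.inl i) (Fin.cons (α := fun _ => Fin n) b a) := by
  have : failed ((checkInput τ).eval E D) = (not (and (not (failExp τ)) (and .eof
      (conj ((List.finRange _).map (graphExp τ))))) : RuleExp τ R N).eval E D := by
    simp [failed, checkInput, Cmd.eval, Store.write_arr, hE]
  rw [this, ← Bool.not_eq_true, eval_not, not_not, eval_and, eval_and, eval_not, eval_conj,
    Bool.not_eq_true]
  refine and_congr ?_ (and_congr ?_ ?_)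
  · rw [BExp.eval_arr, show (E ∘ fun _ : Fin (R + 1) => zero) = fun _ => 0 from
      funext fun _ => hE]
    rfl
  · simp [BExp.eval]
  · simp only [List.forall_mem_map, List.mem_finRange, forall_const]
    exact forall_congr' fun i => eval_graphExp hD hE (hτ _)

/-- Without failure the stored relations of function symbols are graphs and the whole input has been
used, so they form a structure with this very code. Conversely, reading a code recovers its
relations and passes all checks. -/
theorem decodeInput_spec (hR : 1 ≤ R) (hτ : ∀ y, symbArity τ y ≤ R + 1) {E : Var R → Fin n}
    (hE : E zero = 0) (z : List Bool) :
    (failed ((decodeInput τ).eval E (emptyStore N τ R n z)) = false →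
      ∃ S : L.Structure (Fin n), z = (symbols τ).flatMap fun y => charWord (symbRel τ S y)) ∧
    ∀ S : L.Structure (Fin n), z = ((symbols τ).flatMap fun y => charWord (symbRel τ S y)) →
      failed ((decodeInput τ).eval E (emptyStore N τ R n z)) = false ∧
        Represents S ((decodeInput τ).eval E (emptyStore N τ R n z)) := by
  rw [decodeInput, Cmd.eval, Cmd.eval]
  have h₀ : failed ((initEq τ).eval E (emptyStore N τ R n z)) = false :=
    congrFun (Cmd.Avoids.eval_arr (c := initEq τ) (j := .inl .fail) (by simp [initEq, Cmd.Avoids])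
      E (emptyStore N τ R n z)) _
  have h₁ : ((initEq τ).eval E (emptyStore N τ R n z)).inp = z :=
    Cmd.NoRead.eval_inp (c := initEq τ) trivial E (emptyStore N τ R n z)
  have h₂ : ∀ a b : Fin n, ((initEq τ).eval E (emptyStore N τ R n z)).arr (.inl .eq)
      (padTuple 0 ![a, b]) = true ↔ a = b := eval_initEq hR hE fun s => rfl
  generalize (initEq τ).eval E (emptyStore N τ R n z) = D at h₀ h₁ h₂
  have h₃ : ∀ a b : Fin n, ((readSyms (symbols τ)).eval E D).arr (.inl .eq)
      (padTuple 0 ![a, b]) = true ↔ a = b := fun a b => by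
    rw [(avoids_readSyms (by simp) (by simp)).eval_arr, h₂]
  rw [eval_checkInput h₃ hτ hE]
  constructor
  · rintro ⟨h, h', h''⟩
    obtain ⟨S, hS⟩ := exists_symbRel τ (storedRel ((readSyms (symbols τ)).eval E D)) h''
    obtain ⟨-, e⟩ := inp_eq_of_readSyms hτ (symbols_nodup τ) hE h
    refine ⟨S, ?_⟩
    rw [h₁, h', List.append_nil] at e
    rw [hS]
    exact e
  · rintro S rfl
    obtain ⟨e₁, e₂, e₃⟩ := readSyms_charWord hτ (symbols_nodup τ) hE h₀ (P := symbRel τ S) (z := [])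
      (by rw [h₁, List.append_nil])
    refine ⟨⟨e₁, e₂, fun i a => ?_⟩, fun a b => ?_, fun y a => ?_⟩
    · rw [e₃ _ (mem_symbols τ _)]
      refine ⟨S.funMap (τ.funs.get i).2 a, rfl, fun b hb => ?_⟩
      exact Eq.symm hb
    · rw [Cmd.Avoids.eval_arr (c := checkInput τ) (by simp [checkInput, Cmd.Avoids]), h₃]
    · rw [Cmd.Avoids.eval_arr (c := checkInput τ) (by simp [checkInput, Cmd.Avoids])]
      exact iff_of_eq (congrFun (e₃ y (mem_symbols τ y)) a)

variable (τ)

/-- Decode the input and compute the greatest family for `φ`. -/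
noncomputable def modelCheck (φ : IncFormula L) [Fintype (Node φ)] (m : ℕ) :
    Cmd (Var R) (Base (Symb τ) ⊕ Node φ) (R + 1) :=
  .seq (decodeInput τ) (.seq fill (eliminate (rules τ φ id) m))

/-- The input is the code of a structure. -/
def validExp : RuleExp τ R N := not (failExp τ)

/-- The team of the whole formula is not empty. -/
def satExp (φ : IncFormula L) : RuleExp τ R (Node φ) :=
  and (validExp τ) (exs (us R) (nodeAt τ (.root φ) u))

omit [DecidableEq (Base (Symb τ))] in
theorem fresh_modelCheck (φ : IncFormula L) [Fintype (Node φ)] (m : ℕ)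
    (hτ : ∀ y, symbArity τ y ≤ R + 1) : (modelCheck (R := R) τ φ m).Fresh ∅ :=
  ⟨fresh_decodeInput τ hτ, fresh_fill, fresh_eliminate (goodRule_rules φ id) m⟩

omit [DecidableEq (Base (Symb τ))] in
theorem fresh_satExp (φ : IncFormula L) : (satExp (R := R) τ φ).Fresh ∅ :=
  ⟨trivial, fresh_exs us_nodup (by simp) trivial⟩

variable {τ}

/-- The arrays after elimination form a family and contain every family, because all of them are
filled with `true` beforehand. So the root array is non-empty exactly if some family has a non-empty
root. The validity test alone is stated separately for weight `0`. -/
theorem modelCheck_spec (φ : IncFormula L) [DecidableEq (Node φ)] [Fintype (Node φ)]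
    [Fintype (Base (Symb τ))] (hφ : φ.IsSentence) (hR : 1 ≤ R) (hφR : φ.Below R)
    (hτ : ∀ y, symbArity τ y ≤ R + 1) {E : Var R → Fin n} (hE : E zero = 0) (z : List Bool) :
    ((validExp τ).eval E ((modelCheck τ φ (Fintype.card (Base (Symb τ) ⊕ Node φ) + 1)).eval E
        (emptyStore (Node φ) τ R n z)) = true ↔
      ∃ S : L.Structure (Fin n), z = (symbols τ).flatMap fun y => charWord (symbRel τ S y)) ∧
    ((satExp τ φ).eval E ((modelCheck τ φ (Fintype.card (Base (Symb τ) ⊕ Node φ) + 1)).eval E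
        (emptyStore (Node φ) τ R n z)) = true ↔
      ∃ S : L.Structure (Fin n), z = ((symbols τ).flatMap fun y => charWord (symbRel τ S y)) ∧
        Sat S {emptyAssignment (Fin n)} φ) := by
  rw [satExp, eval_and, modelCheck, Cmd.eval, Cmd.eval]
  obtain ⟨h₁, h₂⟩ := decodeInput_spec (N := Node φ) hR hτ hE z
  generalize (decodeInput τ).eval E (emptyStore (Node φ) τ R n z) = D at h₁ h₂
  have h₃ : ∀ c, (fill.eval E D).arr (.inl c) = D.arr (.inl c) := fun c =>
    (avoids_fill c).eval_arr E D
  have h₄ := fun p s => eval_fill E D p s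
  generalize fill.eval E D = D' at h₃ h₄
  have h₅ : ∀ c, ((eliminate (rules τ φ id) (Fintype.card (Base (Symb τ) ⊕ Node φ) + 1)).eval E
      D').arr (.inl c) = D.arr (.inl c) := fun c =>
    ((avoids_eliminate _ _ c).eval_arr E D').trans (h₃ c)
  have hv : (validExp τ).eval E ((eliminate (rules τ φ id)
      (Fintype.card (Base (Symb τ) ⊕ Node φ) + 1)).eval E D') = true ↔
      ∃ S : L.Structure (Fin n), z = (symbols τ).flatMap fun y => charWord (symbRel τ S y) := by
    rw [validExp, eval_not, BExp.eval_arr, h₅, Bool.not_eq_true,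
      show (E ∘ fun _ : Fin (R + 1) => zero) = fun _ => 0 from funext fun _ => hE]
    exact ⟨h₁, fun ⟨S, hS⟩ => (h₂ S hS).1⟩
  refine ⟨hv, ?_⟩
  rw [hv]
  have key : ∀ S : L.Structure (Fin n),
      z = ((symbols τ).flatMap fun y => charWord (symbRel τ S y)) →
      ((exs (us R) (nodeAt τ (.root φ) u)).eval E ((eliminate (rules τ φ id)
        (Fintype.card (Base (Symb τ) ⊕ Node φ) + 1)).eval E D') = true ↔
        Sat S {emptyAssignment (Fin n)} φ) := by
    intro S hS
    have hD' : Represents S D' := (h₂ S hS).2.congr h₃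
    rw [eval_exs_us, sat_emptyAssignment_iff φ hφ hφR]
    constructor
    · rintro ⟨s, hs⟩
      exact ⟨_, ⟨s, hs⟩, family_eliminate φ hφR id hE hD'⟩
    · rintro ⟨T, ⟨s, hs⟩, hT⟩
      exact ⟨s, subset_eliminate φ hφR hE hD' hT _ (fun p s _ => h₄ p s) _ s hs⟩
  constructor
  · rintro ⟨⟨S, hS⟩, h⟩
    exact ⟨S, hS, (key S hS).1 h⟩
  · rintro ⟨S, hS, h⟩
    exact ⟨⟨S, hS⟩, (key S hS).2 h⟩

end program

/-! ### Complexity of the two problems -/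

section complexity

/-- The unary prefix with its end marker is self-delimiting, so a code determines the size of the
universe. -/
theorem replicate_append_false_inj {n m : ℕ} {y z : List Bool}
    (h : List.replicate n true ++ false :: y = List.replicate m true ++ false :: z) :
    n = m ∧ y = z := by
  induction n generalizing m with
  | zero =>
    cases m with
    | zero => simpa using h
    | succ m => simp [List.replicate_succ] at h
  | succ n ih =>
    cases m with
    | zero => simp [List.replicate_succ] at h
    | succ m =>
      simp only [List.replicate_succ, List.cons_append, List.cons.injEq, true_and] at h
      obtain ⟨rfl, rfl⟩ := ih h
      exact ⟨rfl, rfl⟩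

/-- Coefficients are natural numbers, so each monomial contributes at most the top power of `b`.
This splits a joint bound into a factor for the parameter and a factor for the input. -/
theorem eval_mul_le (p : Polynomial ℕ) (a : ℕ) {b : ℕ} (hb : 0 < b) :
    p.eval (a * b) ≤ b ^ p.natDegree * p.eval a := by
  rw [Polynomial.eval_eq_sum_range, Polynomial.eval_eq_sum_range, Finset.mul_sum]
  refine Finset.sum_le_sum fun i hi => ?_
  have : b ^ i ≤ b ^ p.natDegree :=
    Nat.pow_le_pow_right hb (Nat.lt_succ_iff.1 (Finset.mem_range.1 hi))
  calc p.coeff i * (a * b) ^ i = b ^ i * (p.coeff i * a ^ i) := by ring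
    _ ≤ _ := Nat.mul_le_mul_right _ this

theorem primrec_pow_const (d : ℕ) : Primrec fun k : ℕ => (k + 1) ^ d := by
  induction d with
  | zero => simpa using Primrec.const 1
  | succ d ih => simpa [pow_succ] using Primrec.nat_mul.comp ih Primrec.succ

open Computability in
theorem length_encodeNat_le (k : ℕ) : (encodeNat k).length ≤ k := by
  have h : ∀ p : PosNum, (encodePosNum p).length ≤ (p : ℕ) := by
    intro p
    induction p with
    | one => simp [encodePosNum]
    | bit0 p ih =>
      have := p.cast_pos (α := ℕ)
      rw [encodePosNum, List.length_cons, PosNum.cast_bit0]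
      omega
    | bit1 p ih =>
      have := p.cast_pos (α := ℕ)
      rw [encodePosNum, List.length_cons, PosNum.cast_bit1]
      omega
  have e := Num.to_of_nat k
  rw [encodeNat]
  generalize (k : Num) = m at e
  subst e
  cases m with
  | zero => simp [encodeNum]
  | pos p => exact h p

/-- The category of a number, computed from its binary representation: `0`, `1` or larger. -/
def nextCat (c : Fin 3) (b : Bool) : Fin 3 := if c = 0 ∧ b = true then 1 else 2

-- Bits come with the least significant one first. Zero is the empty word, one is the single bit
-- `true`, and any larger number starts with `false` or has a second bit; three states are enough.
open Computability in
theorem foldl_nextCat (k : ℕ) : (encodeNat k).foldl nextCat 0 =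
    if k = 0 then 0 else if k = 1 then 1 else 2 := by
  have h : ∀ (l : List Bool), l.foldl nextCat 2 = 2 := by
    intro l
    induction l with
    | nil => rfl
    | cons b l ih => exact ih
  have e := Num.to_of_nat k
  rw [encodeNat]
  generalize (k : Num) = m at e
  subst e
  cases m with
  | zero => simp [encodeNum]
  | pos p =>
    have hp := p.cast_pos (α := ℕ)
    rw [Num.cast_pos, if_neg (by omega), encodeNum]
    cases p with
    | one => rfl
    | bit0 p =>
      have hp := p.cast_pos (α := ℕ)
      rw [if_neg (by rw [PosNum.cast_bit0]; omega)]
      exact h _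
    | bit1 p =>
      have hp := p.cast_pos (α := ℕ)
      rw [if_neg (by rw [PosNum.cast_bit1]; omega), encodePosNum]
      obtain ⟨b, l, hl⟩ := List.exists_cons_of_ne_nil (encodePosNum_nonempty p)
      rw [hl]
      exact h l

variable {L : FirstOrder.Language.{u, v}} (τ : FiniteVocabulary L) (φ : IncFormula L)

theorem exists_encodeStructure_iff (Q : ∀ n, L.Structure (Fin n) → Prop) {n : ℕ} (hn : 0 < n)
    (y : List Bool) :
    (∃ m, 0 < m ∧ ∃ S : L.Structure (Fin m),
      List.replicate n true ++ false :: y = encodeStructure τ S ∧ Q m S) ↔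
    ∃ S : L.Structure (Fin n), y = ((symbols τ).flatMap fun y => charWord (symbRel τ S y)) ∧
      Q n S := by
  constructor
  · rintro ⟨m, -, S, h, hS⟩
    rw [encodeStructure_eq] at h
    obtain ⟨rfl, h⟩ := replicate_append_false_inj h
    exact ⟨S, h, hS⟩
  · rintro ⟨S, rfl, hS⟩
    exact ⟨n, hn, S, (encodeStructure_eq τ S).symm, hS⟩

theorem exists_bound : ∃ R, 1 ≤ R ∧ φ.Below R ∧ ∀ y : Symb τ, symbArity τ y ≤ R + 1 := by
  obtain ⟨R, h⟩ := ((Filter.eventually_ge_atTop 1).and (φ.eventually_below.and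
    (Filter.eventually_all.2 fun y : Symb τ => Filter.eventually_ge_atTop (symbArity τ y)))).exists
  exact ⟨R, h.1, h.2.1, fun y => (h.2.2 y).trans (Nat.le_succ R)⟩

variable {φ}

/-- A team with empty domain is contained in the team of the empty assignment, so its size is `0` or
`1`. -/
theorem exists_team_encard_iff (hφ : φ.IsSentence) {n : ℕ} (S : L.Structure (Fin n)) (k : ℕ) :
    (∃ T : Set (Assignment (Fin n)), IsTeamOver φ.freeVars T ∧ T.encard = k ∧ Sat S T φ) ↔
      k = 0 ∨ k = 1 ∧ Sat S {emptyAssignment (Fin n)} φ := by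
  have e : φ.freeVars = ∅ := hφ
  constructor
  · rintro ⟨T, hT, hk, h⟩
    have hT' : T ⊆ {emptyAssignment (Fin n)} := fun s hs => funext fun x => by
      have := hT s hs x
      simpa [e, emptyAssignment] using this
    rcases Set.subset_singleton_iff_eq.1 hT' with rfl | rfl
    · left
      simpa [eq_comm] using hk
    · right
      refine ⟨?_, h⟩
      rw [Set.encard_singleton] at hk
      exact_mod_cast hk.symm
  · rintro (rfl | ⟨rfl, h⟩)
    · exact ⟨∅, fun s hs => hs.elim, by simp, sat_empty S φ⟩
    · refine ⟨_, ?_, Set.encard_singleton _, h⟩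
      rintro s rfl x
      simp [e, emptyAssignment]

/-- All input symbols belong to the word here, and the same final expression is used for every
`cat`. -/
theorem polyTimeDecidable_modelChecking (hφ : φ.IsSentence) :
    PolyTimeDecidable (modelChecking τ φ) := by
  classical
  obtain ⟨R, hR, hφR, hτ⟩ := exists_bound τ φ
  have := finite_node φ
  have := finite_base (Symb τ)
  have := Fintype.ofFinite (Node φ)
  have := Fintype.ofFinite (Base (Symb τ))
  obtain ⟨M, p, hM⟩ := exists_machine (Γ₀ := Bool) .inl (fun _ _ => 0)
    (modelCheck (R := R) τ φ (Fintype.card (Base (Symb τ) ⊕ Node φ) + 1))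
    (fresh_modelCheck τ φ _ hτ) (fun _ => satExp τ φ) fun _ => fresh_satExp τ φ
  have hw : ∀ w : List Bool, BitProg.inputWord (.inl : Bool → Bool ⊕ Bool) w = w := fun w => by
    simp [BitProg.inputWord]
  refine ⟨⟨M, p, fun x => Classical.choice (hM x _ ?_ ?_)⟩⟩
  · intro n _ y hy
    rw [hw] at hy
    subst hy
    rw [Bool.eq_iff_iff, decide_eq_true_iff]
    exact (exists_encodeStructure_iff τ (fun m S => Sat S {emptyAssignment (Fin m)} φ)
      (Nat.pos_of_ne_zero (NeZero.ne n)) y).trans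
        (modelCheck_spec φ hφ hR hφR hτ (E := fun _ => 0) rfl y).2.symm
  · intro h
    rw [hw] at h
    refine decide_eq_false ?_
    rintro ⟨n, hn, S, rfl, -⟩
    exact h ⟨n, _, hn, encodeStructure_eq τ S⟩

theorem fpt_pWT (hφ : φ.IsSentence) : FPT (pWT τ φ) := by
  classical
  obtain ⟨R, hR, hφR, hτ⟩ := exists_bound τ φ
  have := finite_node φ
  have := finite_base (Symb τ)
  have := Fintype.ofFinite (Node φ)
  have := Fintype.ofFinite (Base (Symb τ))
  obtain ⟨M, p, hM⟩ := exists_machine (Γ₀ := Bool ⊕ Bool) id nextCat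
    (modelCheck (R := R) τ φ (Fintype.card (Base (Symb τ) ⊕ Node φ) + 1))
    -- The three expressions answer weight `0` (any code of a structure), weight `1` (model
    -- checking) and all larger weights (never).
    (fresh_modelCheck τ φ _ hτ) ![validExp τ, satExp τ φ, .not .tt]
    (by
      intro i
      fin_cases i
      · trivial
      · exact fresh_satExp τ φ
      · trivial)
  refine ⟨M, fun k => (k + 1) ^ p.natDegree, p.comp (.X + 1),
    (primrec_pow_const p.natDegree).to_comp, fun x k => ?_⟩
  have hw : BitProg.inputWord id (encodeInstance x k) = x := by
    simp [BitProg.inputWord, encodeInstance, List.filterMap_append, List.filterMap_map, comp_def]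
  have hc : BitProg.inputCat id nextCat (encodeInstance x k) 0 =
      if k = 0 then 0 else if k = 1 then 1 else 2 := by
    rw [← foldl_nextCat]
    simp [BitProg.inputCat, encodeInstance, List.foldl_map]
  have hlen : (encodeInstance x k).length = x.length + (Computability.encodeNat k).length := by
    simp [encodeInstance]
  refine (hM (encodeInstance x k) (decide ((x, k) ∈ pWT τ φ)) ?_ ?_).map fun h =>
    ⟨h.toEvalsTo, h.steps_le_m.trans ?_⟩
  rotate_left 2
  · have hk := length_encodeNat_le k
    -- The instance has length at most `|x| + k`, hence at most `(|x| + 1) * (k + 1)`, and the bound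
    -- for a product factors.
    refine (p.eval_le_eval_of_le (b := (x.length + 1) * (k + 1)) ?_).trans
      ((eval_mul_le p _ (Nat.succ_pos k)).trans_eq ?_)
    · rw [hlen]
      nlinarith
    · simp [Polynomial.eval_comp]
  · intro n _ y hy
    rw [hw] at hy
    subst hy
    rw [hc, Bool.eq_iff_iff, decide_eq_true_iff]
    have h₁ := exists_encodeStructure_iff τ
      (fun m S => ∃ T : Set (Assignment (Fin m)), IsTeamOver φ.freeVars T ∧ T.encard = k ∧
        Sat S T φ) (Nat.pos_of_ne_zero (NeZero.ne n)) y
    simp only [exists_team_encard_iff hφ] at h₁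
    refine Iff.trans ?_ (h₁.trans ?_)
    · simp only [← exists_team_encard_iff hφ]
      rfl
    have h₂ := modelCheck_spec φ hφ hR hφR hτ (E := fun _ => (0 : Fin n)) rfl y
    rcases Nat.lt_trichotomy k 1 with hk | rfl | hk
    · obtain rfl : k = 0 := by omega
      simpa [emptyStore] using h₂.1.symm
    · simpa [emptyStore] using h₂.2.symm
    · rw [if_neg (by omega), if_neg (by omega)]
      have h₀ : k ≠ 0 := by omega
      have h₁ : k ≠ 1 := by omega
      simp [h₀, h₁, BExp.eval]
  · intro h
    rw [hw] at h
    refine decide_eq_false ?_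
    rintro ⟨n, hn, S, hS, -⟩
    exact h ⟨n, _, hn, hS.trans (encodeStructure_eq τ S)⟩

end complexity

theorem mainTheorem11 {L : FirstOrder.Language.{u, v}} (τ : FiniteVocabulary L) (φ : IncFormula L)
    (hφ : φ.IsSentence) :
    FPT (pWT τ φ) ∧
    (∀ (A : Type w) [Nonempty A] (S : L.Structure A),
      (∃ T : Set (Assignment A), IsTeamOver φ.freeVars T ∧ T.Nonempty ∧ Sat S T φ) ↔
        Sat S {emptyAssignment A} φ) ∧
    PolyTimeDecidable (modelChecking τ φ) :=
  ⟨fpt_pWT τ hφ, fun _ _ _ => exists_team_iff φ hφ, polyTimeDecidable_modelChecking τ hφ⟩
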